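/- Let $\mathbb{R}_+=(0,\infty)$ and, for $\Omega\in\{\mathbb{R},\mathbb{R}_+\}$ with Lebesgue measure $|\cdot|$, let $X(\Omega)$ be one of the following spaces of (a.e. classes of) measurable functions $f:\Omega\to\mathbb{C}$ of finite norm: (a) the Lorentz space $L^{p,q}(\Omega)$ with $1<p,q<\infty$ and norm $\|f\|=\big(\int_0^\infty (t^{1/p}f^{**}(t))^q\,\frac{dt}{t}\big)^{1/q}$, where $f^{**}(t)=\frac1t\int_0^t f^*(s)\,ds$ and $f^*(t)=\inf\{\lambda\ge 0: |\{x\in\Omega:|f(x)|>\lambda\}|\le t\}$ (with $\inf\emptyset=\infty$); (b) the Orlicz space $L^\Phi(\Omega)$ with norm $\|f\|=\inf\{\lambda>0:\int_\Omega\Phi(|f(x)|/\lambda)\,dx\le1\}$, where $\Phi(x)=\int_0^x\varphi(t)\,dt$ for a non-decreasing left-continuous $\varphi:[0,\infty)\to[0,\infty]$ with $\varphi(0)=0$ and $\lim_{t\to\infty}\varphi(t)=\infty$ that is not identically $\infty$ on $(0,\infty)$, and where $L^\Phi(\mathbb{R}_+)$ is assumed to be reflexive; (c) the variable Lebesgue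 space $L^{p(\cdot)}(\Omega)$ with norm $\|f\|=\inf\{\lambda>0:\int_\Omega|f(x)/\lambda|^{p(x)}\,dx\le1\}$, where $p(\cdot):\mathbb{R}\to[1,\infty]$ is measurable and a.e. finite, $1<\operatorname{ess\,inf}p\le\operatorname{ess\,sup}p<\infty$, and the Hardy–Littlewood maximal operator $(Mf)(x)=\sup_{I\ni x}\frac1{|I|}\int_I|f(t)|\,dt$ (supremum over bounded intervals $I$) is bounded on $L^{p(\cdot)}(\mathbb{R})$. Let $F$ be the Fourier transform on $L^2(\mathbb{R})$ normalized by $(Ff)(\xi)=\int_{\mathbb{R}}f(x)e^{i\xi x}\,dx$ for $f \in L^1(\mathbb{R})\cap L^2(\mathbb{R})$. A function $a\in L^\infty(\mathbb{R})$ is a Fourier multiplier on $X(\mathbb{R})$ if $f\mapsto F^{-1}(a\cdot Ff)$ maps $L^2(\mathbb{R})\cap X(\mathbb{R})$ into $X(\mathbb{R})$ and extends to a bounded linear operator $W^0(a)$ on $X(\mathbb{R})$. The Wiener–Hopf operator with such a symbol $a$ is $W(a)=r_+W^0(a)\ell_+$ on $X(\mathbb{R}_+)$, where $r_+:X(\mathbb{R})\to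 X(\mathbb{R}_+)$ is the restriction and $\ell_+:X(\mathbb{R}_+)\to X(\mathbb{R})$ is the extension by zero. For $n\in\mathbb{Z}$ put $r_n(\xi)=\big(\frac{\xi-i}{\xi+i}\big)^n$, $\xi\in\mathbb{R}$. Then every $r_k$, $k\in\mathbb{Z}$, is a Fourier multiplier on $X(\mathbb{R})$, the function $\psi_0(x)=\sqrt2\,e^{-x}$, $x\in\mathbb{R}_+$, belongs to $X(\mathbb{R}_+)$, and, with $\psi_k=W(r_k)\psi_0$ for $k\ge1$, for every integer $n\ge0$ $$\operatorname{Ker}W(r_{-n})=\operatorname{span}\{\psi_k:k=0,1,\dots,n-1\}\subset X(\mathbb{R}_+)$$ (the span being $\{0\}$ for $n=0$). -/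

import Mathlib

open MeasureTheory Set Filter Topology
open scoped ENNReal NNReal FourierTransform

noncomputable section

namespace WH

/-! ### Normed spaces of measurable functions on the line -/

/-- Lebesgue measure on `ℝ₊ = (0, ∞)`. -/
abbrev volPos : Measure ℝ := volume.restrict (Ioi (0 : ℝ))

/-- A norm with values in `[0, ∞]` on the a.e. classes of complex measurable functions. -/
structure FunNorm (μ : Measure ℝ) where
  rho : (ℝ →ₘ[μ] ℂ) → ℝ≥0∞
  add_le : ∀ f g : ℝ →ₘ[μ] ℂ, rho (f + g) ≤ rho f + rho g
  smul_le : ∀ (c : ℂ) (f : ℝ →ₘ[μ] ℂ), rho (c • f) ≤ ‖c‖ₑ * rho f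
  eq_zero : ∀ f : ℝ →ₘ[μ] ℂ, rho f = 0 → f = 0

namespace FunNorm

variable {μ : Measure ℝ}

theorem rho_zero (N : FunNorm μ) : N.rho 0 = 0 := by
  have h := N.smul_le 0 0
  have h0 : (0 : ℂ) • (0 : ℝ →ₘ[μ] ℂ) = 0 := zero_smul ℂ (0 : ℝ →ₘ[μ] ℂ)
  rw [h0] at h
  simpa using h

/-- The functions of finite norm. -/
def submodule (N : FunNorm μ) : Submodule ℂ (ℝ →ₘ[μ] ℂ) where
  carrier := {f | N.rho f < ∞}
  zero_mem' := by simp [N.rho_zero]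
  add_mem' := fun {f g} hf hg =>
    lt_of_le_of_lt (N.add_le f g) (ENNReal.add_lt_top.2 ⟨hf, hg⟩)
  smul_mem' := fun c f hf =>
    lt_of_le_of_lt (N.smul_le c f) (ENNReal.mul_lt_top enorm_lt_top hf)

/-- The function space of a norm, as a normed space. -/
def Space (N : FunNorm μ) : Type := N.submodule

instance (N : FunNorm μ) : AddCommGroup N.Space :=
  inferInstanceAs (AddCommGroup N.submodule)

instance (N : FunNorm μ) : Module ℂ N.Space :=
  inferInstanceAs (Module ℂ N.submodule)

/-- The a.e. class underlying an element of the space. -/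
def incl (N : FunNorm μ) : N.Space →ₗ[ℂ] (ℝ →ₘ[μ] ℂ) := N.submodule.subtype

theorem incl_injective (N : FunNorm μ) : Function.Injective N.incl :=
  Subtype.val_injective

theorem rho_incl_lt_top (N : FunNorm μ) (f : N.Space) : N.rho (N.incl f) < ∞ := f.2

/-- A function of finite norm as an element of the space. -/
def toSpace (N : FunNorm μ) (f : ℝ →ₘ[μ] ℂ) (hf : N.rho f < ∞) : N.Space := ⟨f, hf⟩

@[simp]
theorem incl_toSpace (N : FunNorm μ) (f : ℝ →ₘ[μ] ℂ) (hf : N.rho f < ∞) :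
    N.incl (N.toSpace f hf) = f := rfl

instance (N : FunNorm μ) : Norm N.Space := ⟨fun f => (N.rho (N.incl f)).toReal⟩

theorem norm_def (N : FunNorm μ) (f : N.Space) : ‖f‖ = (N.rho (N.incl f)).toReal := rfl

theorem norm_smul_le' (N : FunNorm μ) (c : ℂ) (f : N.Space) : ‖c • f‖ ≤ ‖c‖ * ‖f‖ := by
  rw [norm_def, norm_def, map_smul, ← toReal_enorm c, ← ENNReal.toReal_mul]
  exact ENNReal.toReal_mono
    (ENNReal.mul_lt_top enorm_lt_top (N.rho_incl_lt_top f)).ne (N.smul_le c _)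

instance (N : FunNorm μ) : NormedAddCommGroup N.Space :=
  AddGroupNorm.toNormedAddCommGroup
    { toFun := fun f => ‖f‖
      map_zero' := by simp [norm_def, N.rho_zero]
      add_le' := fun f g => by
        rw [norm_def, norm_def, norm_def, map_add, ← ENNReal.toReal_add
          (N.rho_incl_lt_top f).ne (N.rho_incl_lt_top g).ne]
        exact ENNReal.toReal_mono (ENNReal.add_lt_top.2
          ⟨N.rho_incl_lt_top f, N.rho_incl_lt_top g⟩).ne (N.add_le _ _)
      neg' := fun f => by
        have h : ∀ g : N.Space, ‖-g‖ ≤ ‖g‖ := fun g => by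
          simpa using N.norm_smul_le' (-1) g
        exact le_antisymm (h f) (by simpa using h (-f))
      eq_zero_of_map_eq_zero' := fun f hf => by
        have h : N.rho (N.incl f) = 0 :=
          ((ENNReal.toReal_eq_zero_iff _).1 hf).resolve_right (N.rho_incl_lt_top f).ne
        exact N.incl_injective (by rw [N.eq_zero _ h, map_zero]) }

instance (N : FunNorm μ) : NormedSpace ℂ N.Space where
  norm_smul_le := N.norm_smul_le'

end FunNorm

/-- Restriction of a function on the line to `(0, ∞)`. -/
def restr (f : ℝ →ₘ[volume] ℂ) : ℝ →ₘ[volPos] ℂ :=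
  AEEqFun.mk f f.aestronglyMeasurable.restrict

theorem coeFn_restr (f : ℝ →ₘ[volume] ℂ) : restr f =ᵐ[volPos] f := AEEqFun.coeFn_mk _ _

/-- Extension of a function on `(0, ∞)` to the line by zero. -/
def ext0 (f : ℝ →ₘ[volPos] ℂ) : ℝ →ₘ[volume] ℂ :=
  AEEqFun.mk ((Ioi (0 : ℝ)).indicator f)
    ((aestronglyMeasurable_indicator_iff measurableSet_Ioi).2 f.aestronglyMeasurable)

theorem coeFn_ext0 (f : ℝ →ₘ[volPos] ℂ) :
    ext0 f =ᵐ[volume] (Ioi (0 : ℝ)).indicator f := AEEqFun.coeFn_mk _ _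

theorem restr_add (f g : ℝ →ₘ[volume] ℂ) : restr (f + g) = restr f + restr g := by
  apply AEEqFun.ext
  filter_upwards [coeFn_restr (f + g), coeFn_restr f, coeFn_restr g,
    AEEqFun.coeFn_add (restr f) (restr g), ae_restrict_of_ae (AEEqFun.coeFn_add f g)]
    with x h1 h2 h3 h4 h5
  rw [h1, h4, h5]; simp [h2, h3]

theorem restr_smul (c : ℂ) (f : ℝ →ₘ[volume] ℂ) : restr (c • f) = c • restr f := by
  apply AEEqFun.ext
  filter_upwards [coeFn_restr (c • f), coeFn_restr f,
    AEEqFun.coeFn_smul c (restr f), ae_restrict_of_ae (AEEqFun.coeFn_smul c f)]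
    with x h1 h2 h3 h4
  rw [h1, h3, h4]; simp [h2]

theorem ext0_add (f g : ℝ →ₘ[volPos] ℂ) : ext0 (f + g) = ext0 f + ext0 g := by
  apply AEEqFun.ext
  filter_upwards [coeFn_ext0 (f + g), coeFn_ext0 f, coeFn_ext0 g,
    AEEqFun.coeFn_add (ext0 f) (ext0 g),
    (ae_restrict_iff' measurableSet_Ioi).1 (AEEqFun.coeFn_add f g)]
    with x h1 h2 h3 h4 h5
  rw [h1, h4, Pi.add_apply, h2, h3]
  by_cases hx : x ∈ Ioi (0 : ℝ)
  · simp only [indicator_of_mem hx, h5 hx, Pi.add_apply]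
  · simp only [indicator_of_notMem hx, add_zero]

theorem ext0_smul (c : ℂ) (f : ℝ →ₘ[volPos] ℂ) : ext0 (c • f) = c • ext0 f := by
  apply AEEqFun.ext
  filter_upwards [coeFn_ext0 (c • f), coeFn_ext0 f,
    AEEqFun.coeFn_smul c (ext0 f),
    (ae_restrict_iff' measurableSet_Ioi).1 (AEEqFun.coeFn_smul c f)]
    with x h1 h2 h3 h4
  rw [h1, h3, Pi.smul_apply, h2]
  by_cases hx : x ∈ Ioi (0 : ℝ)
  · simp only [indicator_of_mem hx, h4 hx, Pi.smul_apply]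
  · simp only [indicator_of_notMem hx, smul_zero]

/-- A space `X`, given by its norms on `ℝ` and on `ℝ₊`, such that restriction and extension by
zero are contractions. -/
structure SpacePair where
  line : FunNorm volume
  half : FunNorm volPos
  restr_le : ∀ f, half.rho (restr f) ≤ line.rho f
  ext0_le : ∀ f, line.rho (ext0 f) ≤ half.rho f

namespace SpacePair

/-- The restriction operator `r₊ : X(ℝ) → X(ℝ₊)`. -/
def rPlus (X : SpacePair) : X.line.Space →L[ℂ] X.half.Space :=
  LinearMap.mkContinuous
    { toFun := fun f => X.half.toSpace (restr (X.line.incl f))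
        (lt_of_le_of_lt (X.restr_le _) (X.line.rho_incl_lt_top f))
      map_add' := fun f g => X.half.incl_injective (by simp [restr_add])
      map_smul' := fun c f => X.half.incl_injective (by simp [restr_smul]) }
    1 (fun f => by
      rw [one_mul]
      exact ENNReal.toReal_mono (X.line.rho_incl_lt_top f).ne (X.restr_le _))

/-- The operator of extension by zero `ℓ₊ : X(ℝ₊) → X(ℝ)`. -/
def ellPlus (X : SpacePair) : X.half.Space →L[ℂ] X.line.Space :=
  LinearMap.mkContinuous
    { toFun := fun f => X.line.toSpace (ext0 (X.half.incl f))
        (lt_of_le_of_lt (X.ext0_le _) (X.half.rho_incl_lt_top f))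
      map_add' := fun f g => X.line.incl_injective (by simp [ext0_add])
      map_smul' := fun c f => X.line.incl_injective (by simp [ext0_smul]) }
    1 (fun f => by
      rw [one_mul]
      exact ENNReal.toReal_mono (X.half.rho_incl_lt_top f).ne (X.ext0_le _))

end SpacePair

/-! ### Fourier convolution operators and Wiener-Hopf operators -/

theorem memLp_comp_mul {g : ℝ → ℂ} {q : ℝ≥0∞} (hg : MemLp g q volume) {c : ℝ} (hc : c ≠ 0) :
    MemLp (fun x => g (c * x)) q volume := by
  have hm : Measure.map (fun x : ℝ => c * x) volume = ENNReal.ofReal |c⁻¹| • volume :=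
    Real.map_volume_mul_left hc
  have h : MemLp g q (Measure.map (fun x : ℝ => c * x) volume) := by
    rw [hm]; exact hg.smul_measure ENNReal.ofReal_ne_top
  exact h.comp_of_map (measurable_const_mul c).aemeasurable

/-- The Fourier transform `(F f)(ξ) = ∫ f(x) e^{iξx} dx` on `L²(ℝ)`. Mathlib's transform is
`(𝓕 f)(w) = ∫ f(x) e^{-2πiwx} dx`. -/
def fourierL2 (f : Lp ℂ 2 (volume : Measure ℝ)) : Lp ℂ 2 (volume : Measure ℝ) :=
  MemLp.toLp (fun ξ => (𝓕 f : Lp ℂ 2 (volume : Measure ℝ)) (-(2 * Real.pi)⁻¹ * ξ))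
    (memLp_comp_mul (Lp.memLp _) (by simp [Real.pi_ne_zero]))

/-- The inverse Fourier transform `(F⁻¹ g)(x) = (2π)⁻¹ (F g)(-x)` on `L²(ℝ)`. -/
def fourierInvL2 (g : Lp ℂ 2 (volume : Measure ℝ)) : Lp ℂ 2 (volume : Measure ℝ) :=
  MemLp.toLp (fun x => ((2 * Real.pi)⁻¹ : ℂ) * fourierL2 g (-1 * x))
    ((memLp_comp_mul (Lp.memLp _) (by norm_num)).const_mul _)

/-- The product of a bounded function and a function in `L²(ℝ)`. -/
def mulL2 (a : ℝ → ℂ) (ha : MemLp a ∞ volume) (g : Lp ℂ 2 (volume : Measure ℝ)) :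
    Lp ℂ 2 (volume : Measure ℝ) :=
  MemLp.toLp (fun ξ => a ξ * g ξ) ((Lp.memLp g).mul ha)

/-- `T` is a bounded operator on `X(ℝ)` that extends `f ↦ F⁻¹(a · F f)` from `L²(ℝ) ∩ X(ℝ)`. -/
def IsConvolutionExtension (N : FunNorm volume) (a : ℝ → ℂ) (T : N.Space →L[ℂ] N.Space) : Prop :=
  ∃ ha : MemLp a ∞ volume, ∀ (f : N.Space) (hf : MemLp (N.incl f) 2 volume),
    N.incl (T f) = (fourierInvL2 (mulL2 a ha (fourierL2 (hf.toLp _))) : ℝ →ₘ[volume] ℂ)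

/-- `a` is a Fourier multiplier on `X(ℝ)`. -/
def IsFourierMultiplier (N : FunNorm volume) (a : ℝ → ℂ) : Prop :=
  ∃ T : N.Space →L[ℂ] N.Space, IsConvolutionExtension N a T

open Classical in
/-- The Fourier convolution operator `W⁰(a)` on `X(ℝ)`: the bounded extension in the definition of
a Fourier multiplier (there is only one if `L²(ℝ) ∩ X(ℝ)` is dense in `X(ℝ)`); by convention `0`
if `a` is not a Fourier multiplier. -/
def W0 (N : FunNorm volume) (a : ℝ → ℂ) : N.Space →L[ℂ] N.Space :=
  if h : IsFourierMultiplier N a then h.choose else 0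

/-- The Wiener-Hopf operator `W(a) = r₊ W⁰(a) ℓ₊` on `X(ℝ₊)`. -/
def W (X : SpacePair) (a : ℝ → ℂ) : X.half.Space →L[ℂ] X.half.Space :=
  X.rPlus ∘L W0 X.line a ∘L X.ellPlus

/-- The rational function `r_n(ξ) = ((ξ - i) / (ξ + i))^n`. -/
def r (n : ℤ) (ξ : ℝ) : ℂ := (((ξ : ℂ) - Complex.I) / ((ξ : ℂ) + Complex.I)) ^ n

/-- The functions `ψ_k = W(r_k) ψ_0`, `k ≥ 1`, obtained from `ψ_0`. -/
def psi (X : SpacePair) (psi0 : X.half.Space) : ℕ → X.half.Space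
  | 0 => psi0
  | k + 1 => W X (r ((k : ℤ) + 1)) psi0

/-! ### Lorentz spaces -/

/-- The distribution function `λ ↦ |{x : |f(x)| > λ}|`. -/
def distr (μ : Measure ℝ) (f : ℝ → ℂ) (l : ℝ≥0) : ℝ≥0∞ := μ {x | l < ‖f x‖₊}

/-- The non-increasing rearrangement `f*(t) = inf {λ ≥ 0 : μ_f(λ) ≤ t}`, with `inf ∅ = ∞`. -/
def rearr (μ : Measure ℝ) (f : ℝ → ℂ) (t : ℝ) : ℝ≥0∞ :=
  ⨅ (l : ℝ≥0) (_ : distr μ f l ≤ ENNReal.ofReal t), (l : ℝ≥0∞)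

/-- The maximal function `f**(t) = (1/t) ∫₀ᵗ f*(s) ds`. -/
def rearrAvg (μ : Measure ℝ) (f : ℝ → ℂ) (t : ℝ) : ℝ≥0∞ :=
  (ENNReal.ofReal t)⁻¹ * ∫⁻ s in Ioo 0 t, rearr μ f s

/-- The Lorentz norm `(∫₀^∞ (t^{1/p} f**(t))^q dt/t)^{1/q}`. -/
def lorentzRho (μ : Measure ℝ) (p q : ℝ) (f : ℝ → ℂ) : ℝ≥0∞ :=
  (∫⁻ t in Ioi (0 : ℝ),
    (ENNReal.ofReal (t ^ (1 / p)) * rearrAvg μ f t) ^ q * (ENNReal.ofReal t)⁻¹) ^ (1 / q)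

theorem distr_congr {μ : Measure ℝ} {f g : ℝ → ℂ} (h : f =ᵐ[μ] g) : distr μ f = distr μ g := by
  funext l
  apply measure_congr
  filter_upwards [h] with x hx
  exact propext (by change (l < ‖f x‖₊) ↔ (l < ‖g x‖₊); rw [hx])

theorem lorentzRho_mono {μ ν : Measure ℝ} {p q : ℝ} (hq : 0 ≤ q) {f g : ℝ → ℂ}
    (h : ∀ l, distr μ f l ≤ distr ν g l) : lorentzRho μ p q f ≤ lorentzRho ν p q g := by
  unfold lorentzRho rearrAvg
  have h1 : ∀ t, rearr μ f t ≤ rearr ν g t := fun t =>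
    le_iInf₂ fun l hl => iInf₂_le l ((h l).trans hl)
  have h2 : (0 : ℝ) ≤ 1 / q := by positivity
  gcongr
  exact h1 _

theorem rearr_antitone (μ : Measure ℝ) (f : ℝ → ℂ) : Antitone (rearr μ f) := fun _ _ hst =>
  le_iInf₂ fun l hl => iInf₂_le l (hl.trans (ENNReal.ofReal_le_ofReal hst))

theorem distr_antitone (μ : Measure ℝ) (f : ℝ → ℂ) : Antitone (distr μ f) := fun _ _ hst =>
  measure_mono fun _ hx => lt_of_le_of_lt hst hx

theorem distr_toNNReal_antitone (μ : Measure ℝ) (f : ℝ → ℂ) :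
    Antitone (fun l : ℝ => distr μ f l.toNNReal) := fun _ _ hst =>
  distr_antitone μ f (Real.toNNReal_le_toNNReal hst)

theorem volume_lt (R : ℝ≥0∞) : volume {l : ℝ | 0 < l ∧ ENNReal.ofReal l < R} = R := by
  induction R with
  | top => 
    have : {l : ℝ | 0 < l ∧ ENNReal.ofReal l < ∞} = Ioi 0 := by ext; simp
    rw [this, Real.volume_Ioi]
  | coe R =>
    have : {l : ℝ | 0 < l ∧ ENNReal.ofReal l < R} = Ioo 0 (R : ℝ) := by
      ext l
      simp only [mem_ofPred_eq, mem_Ioo, and_congr_right_iff]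
      intro hl
      rw [ENNReal.ofReal, ENNReal.coe_lt_coe, Real.toNNReal_lt_iff_lt_coe hl.le]
    rw [this, Real.volume_Ioo]; simp

theorem volume_le (R : ℝ≥0∞) : volume {l : ℝ | 0 < l ∧ ENNReal.ofReal l ≤ R} = R := by
  induction R with
  | top => 
    have : {l : ℝ | 0 < l ∧ ENNReal.ofReal l ≤ ∞} = Ioi 0 := by ext; simp
    rw [this, Real.volume_Ioi]
  | coe R =>
    have : {l : ℝ | 0 < l ∧ ENNReal.ofReal l ≤ R} = Ioc 0 (R : ℝ) := by
      ext l
      simp only [mem_ofPred_eq, mem_Ioc, and_congr_right_iff]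
      intro hl
      rw [ENNReal.ofReal, ENNReal.coe_le_coe, Real.toNNReal_le_iff_le_coe]
    rw [this, Real.volume_Ioc]; simp

theorem rearr_le {μ : Measure ℝ} {f : ℝ → ℂ} {t : ℝ} (l : ℝ≥0)
    (h : distr μ f l ≤ ENNReal.ofReal t) : rearr μ f t ≤ l :=
  iInf₂_le (f := fun (l : ℝ≥0) (_ : distr μ f l ≤ ENNReal.ofReal t) => (l : ℝ≥0∞)) l h

theorem rearr_eq_volume (μ : Measure ℝ) (f : ℝ → ℂ) (s : ℝ) :
    rearr μ f s = volume {l : ℝ | 0 < l ∧ ENNReal.ofReal s < distr μ f l.toNNReal} := by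
  apply le_antisymm
  · conv_lhs => rw [← volume_lt (rearr μ f s)]
    refine measure_mono fun l hl => ⟨hl.1, ?_⟩
    by_contra hcon
    exact absurd (rearr_le l.toNNReal (not_lt.1 hcon)) (not_le.2 hl.2)
  · conv_rhs => rw [← volume_le (rearr μ f s)]
    refine measure_mono fun l hl => ⟨hl.1, le_iInf₂ fun l' hl' => ?_⟩
    by_contra hcon
    have h1 : l' ≤ l.toNNReal := ENNReal.coe_le_coe.1 (not_le.1 hcon).le
    exact absurd (hl.2.trans_le (distr_antitone μ f h1)) (not_lt.2 hl')

theorem lintegral_rearr (μ : Measure ℝ) (f : ℝ → ℂ) (t : ℝ) :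
    ∫⁻ s in Ioo 0 t, rearr μ f s =
      ∫⁻ l in Ioi (0 : ℝ), min (distr μ f l.toNNReal) (ENNReal.ofReal t) := by
  have hD : Measurable (fun l : ℝ => distr μ f l.toNNReal) :=
    (distr_toNNReal_antitone μ f).measurable
  have h1 : ∀ s, rearr μ f s = ∫⁻ l in Ioi (0 : ℝ),
      {z : ℝ × ℝ | ENNReal.ofReal z.1 < distr μ f z.2.toNNReal}.indicator 1 (s, l) := by
    intro s
    rw [rearr_eq_volume]
    have hm : MeasurableSet {l : ℝ | ENNReal.ofReal s < distr μ f l.toNNReal} :=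
      measurableSet_lt measurable_const hD
    have : (fun l : ℝ => {z : ℝ × ℝ | ENNReal.ofReal z.1 < distr μ f z.2.toNNReal}.indicator
        (1 : ℝ × ℝ → ℝ≥0∞) (s, l)) =
        {l : ℝ | ENNReal.ofReal s < distr μ f l.toNNReal}.indicator 1 := rfl
    rw [this, lintegral_indicator_one hm, Measure.restrict_apply hm, inter_comm]
    rfl
  have hmz : MeasurableSet {z : ℝ × ℝ | ENNReal.ofReal z.1 < distr μ f z.2.toNNReal} :=
    measurableSet_lt (ENNReal.measurable_ofReal.comp measurable_fst) (hD.comp measurable_snd)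
  simp_rw [h1]
  rw [lintegral_lintegral_swap (f := fun s l =>
    {z : ℝ × ℝ | ENNReal.ofReal z.1 < distr μ f z.2.toNNReal}.indicator (1 : ℝ × ℝ → ℝ≥0∞) (s, l))
    (measurable_one.indicator hmz).aemeasurable]
  refine lintegral_congr fun l => ?_
  have hm : MeasurableSet {s : ℝ | ENNReal.ofReal s < distr μ f l.toNNReal} :=
    measurableSet_lt ENNReal.measurable_ofReal measurable_const
  have : (fun s : ℝ => {z : ℝ × ℝ | ENNReal.ofReal z.1 < distr μ f z.2.toNNReal}.indicator
      (1 : ℝ × ℝ → ℝ≥0∞) (s, l)) =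
      {s : ℝ | ENNReal.ofReal s < distr μ f l.toNNReal}.indicator 1 := rfl
  rw [this, lintegral_indicator_one hm, Measure.restrict_apply hm]
  conv_rhs => rw [← volume_lt (min (distr μ f l.toNNReal) (ENNReal.ofReal t))]
  congr 1
  ext s
  simp only [mem_inter_iff, mem_ofPred_eq, mem_Ioo, lt_min_iff]
  constructor
  · rintro ⟨h, h0, ht⟩
    exact ⟨h0, h, (ENNReal.ofReal_lt_ofReal_iff (h0.trans ht)).2 ht⟩
  · rintro ⟨h0, h, ht⟩
    exact ⟨h, h0, (ENNReal.ofReal_lt_ofReal_iff_of_nonneg h0.le).1 ht⟩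

theorem lintegral_excess {μ : Measure ℝ} {f : ℝ → ℂ} (hf : AEStronglyMeasurable f μ) (l0 : ℝ≥0) :
    ∫⁻ x, ENNReal.ofReal (‖f x‖ - l0) ∂μ = ∫⁻ l in Ioi (l0 : ℝ), distr μ f l.toNNReal := by
  have h1 : ∫⁻ x, ENNReal.ofReal (‖f x‖ - l0) ∂μ = ∫⁻ x, ENNReal.ofReal (max (‖f x‖ - l0) 0) ∂μ :=
    lintegral_congr fun x => by rw [ENNReal.ofReal_max]; simp
  rw [h1, lintegral_eq_lintegral_meas_lt (f := fun x => max (‖f x‖ - l0) 0) μ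
    (ae_of_all _ fun x => le_max_right _ _)
    ((hf.norm.aemeasurable.sub aemeasurable_const).max aemeasurable_const)]
  rw [← lintegral_indicator measurableSet_Ioi, ← lintegral_indicator measurableSet_Ioi,
    ← lintegral_add_right_eq_self ((Ioi (l0 : ℝ)).indicator _) (l0 : ℝ)]
  refine lintegral_congr fun t => ?_
  by_cases ht : 0 < t
  · rw [indicator_of_mem (show t ∈ Ioi (0 : ℝ) from ht),
      indicator_of_mem (show t + l0 ∈ Ioi (l0 : ℝ) by simpa using ht)]
    unfold distr
    congr 1
    ext x
    have h2 : 0 ≤ t + l0 := by positivity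
    simp only [mem_ofPred_eq, lt_max_iff]
    rw [Real.toNNReal_lt_iff_lt_coe h2, coe_nnnorm]
    constructor
    · rintro (h | h) <;> linarith
    · intro h; left; linarith
  · rw [indicator_of_notMem (by simpa using ht), indicator_of_notMem (by simpa using ht)]

theorem lintegral_rearr_le {μ : Measure ℝ} {f : ℝ → ℂ} (hf : AEStronglyMeasurable f μ)
    (t : ℝ) (l0 : ℝ≥0) :
    ∫⁻ s in Ioo 0 t, rearr μ f s ≤
      ENNReal.ofReal t * l0 + ∫⁻ x, ENNReal.ofReal (‖f x‖ - l0) ∂μ := by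
  rw [lintegral_rearr, lintegral_excess hf, ← Ioc_union_Ioi_eq_Ioi l0.coe_nonneg,
    lintegral_union measurableSet_Ioi (by
      rw [Set.disjoint_left]; exact fun x hx hx' => absurd hx.2 (not_le.2 hx'))]
  refine add_le_add ?_ (lintegral_mono fun l => min_le_left _ _)
  refine (lintegral_mono fun l => min_le_right _ _).trans ?_
  rw [setLIntegral_const, Real.volume_Ioc]
  exact le_of_eq (by congr 1; simp)

theorem lintegral_rearr_eq {μ : Measure ℝ} {f : ℝ → ℂ} (hf : AEStronglyMeasurable f μ)
    {t : ℝ} {l0 : ℝ≥0} (h : rearr μ f t = l0) :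
    ENNReal.ofReal t * l0 + ∫⁻ x, ENNReal.ofReal (‖f x‖ - l0) ∂μ ≤
      ∫⁻ s in Ioo 0 t, rearr μ f s := by
  rw [lintegral_rearr, lintegral_excess hf, ← Ioc_union_Ioi_eq_Ioi l0.coe_nonneg,
    lintegral_union measurableSet_Ioi (by
      rw [Set.disjoint_left]; exact fun x hx hx' => absurd hx.2 (not_le.2 hx'))]
  refine add_le_add ?_ ?_
  · have h1 : ENNReal.ofReal t * l0 = ∫⁻ _ in Ioo (0 : ℝ) l0, ENNReal.ofReal t := by
      rw [setLIntegral_const, Real.volume_Ioo]; congr 1; simp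
    rw [h1]
    refine (setLIntegral_mono' measurableSet_Ioo fun l hl => ?_).trans
      (lintegral_mono_set Ioo_subset_Ioc_self)
    refine le_min ?_ le_rfl
    by_contra hcon
    have h2 : rearr μ f t ≤ l.toNNReal := rearr_le _ (not_le.1 hcon).le
    rw [h, ENNReal.coe_le_coe, Real.le_toNNReal_iff_coe_le hl.1.le] at h2
    exact absurd hl.2 (not_lt.2 h2)
  · refine setLIntegral_mono' measurableSet_Ioi fun l hl => le_min le_rfl ?_
    have h2 : rearr μ f t < (l.toNNReal : ℝ≥0∞) := by
      rw [h, ENNReal.coe_lt_coe]; exact Real.lt_toNNReal_iff_coe_lt.2 hl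
    obtain ⟨l', hl', h3⟩ : ∃ l' : ℝ≥0, distr μ f l' ≤ ENNReal.ofReal t ∧ l' < l.toNNReal := by
      simp only [rearr, iInf_lt_iff] at h2
      obtain ⟨l', hl', h3⟩ := h2
      exact ⟨l', hl', by exact_mod_cast h3⟩
    exact (distr_antitone μ f h3.le).trans hl'

theorem lintegral_rearr_add {μ : Measure ℝ} {f g : ℝ → ℂ} (hf : AEStronglyMeasurable f μ)
    (hg : AEStronglyMeasurable g μ) {t : ℝ} (ht : 0 < t) :
    ∫⁻ s in Ioo 0 t, rearr μ (f + g) s ≤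
      (∫⁻ s in Ioo 0 t, rearr μ f s) + ∫⁻ s in Ioo 0 t, rearr μ g s := by
  have htop : ∀ h : ℝ → ℂ, rearr μ h t = ∞ → ∫⁻ s in Ioo 0 t, rearr μ h s = ∞ := by
    intro h hh
    rw [eq_top_iff]
    calc ∞ = ∫⁻ _ in Ioo 0 t, ∞ := by
          rw [setLIntegral_const, Real.volume_Ioo, ENNReal.top_mul]; simpa using ht
      _ ≤ _ := setLIntegral_mono' measurableSet_Ioo fun s hs =>
          hh ▸ rearr_antitone μ h hs.2.le
  by_cases h1 : rearr μ f t = ∞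
  · rw [htop f h1, top_add]; exact le_top
  by_cases h2 : rearr μ g t = ∞
  · rw [htop g h2, add_top]; exact le_top
  lift rearr μ f t to ℝ≥0 using h1 with l1 hl1
  lift rearr μ g t to ℝ≥0 using h2 with l2 hl2
  refine (lintegral_rearr_le (hf.add hg) t (l1 + l2)).trans
    (le_trans ?_ (add_le_add (lintegral_rearr_eq hf hl1.symm) (lintegral_rearr_eq hg hl2.symm)))
  have h3 : ∫⁻ x, ENNReal.ofReal (‖(f + g) x‖ - (l1 + l2 : ℝ≥0)) ∂μ ≤
      (∫⁻ x, ENNReal.ofReal (‖f x‖ - l1) ∂μ) + ∫⁻ x, ENNReal.ofReal (‖g x‖ - l2) ∂μ := by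
    have hm : AEMeasurable (fun x => ENNReal.ofReal (‖f x‖ - l1)) μ :=
      (hf.norm.aemeasurable.sub aemeasurable_const).ennreal_ofReal
    rw [← lintegral_add_left' hm]
    refine lintegral_mono fun x => ?_
    refine (ENNReal.ofReal_le_ofReal ?_).trans ENNReal.ofReal_add_le
    have := norm_add_le (f x) (g x)
    push_cast
    simp only [Pi.add_apply]
    linarith
  calc _ ≤ ENNReal.ofReal t * (l1 + l2 : ℝ≥0) + ((∫⁻ x, ENNReal.ofReal (‖f x‖ - l1) ∂μ) +
        ∫⁻ x, ENNReal.ofReal (‖g x‖ - l2) ∂μ) := add_le_add le_rfl h3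
    _ = _ := by push_cast; ring

theorem measurable_rearrAvg (μ : Measure ℝ) (f : ℝ → ℂ) : Measurable (rearrAvg μ f) := by
  have h : Monotone fun t : ℝ => ∫⁻ s in Ioo 0 t, rearr μ f s := fun _ _ hst =>
    lintegral_mono_set (Ioo_subset_Ioo_right hst)
  exact ENNReal.measurable_ofReal.inv.mul h.measurable

theorem lorentzRho_add {μ : Measure ℝ} {p q : ℝ} (hq : 1 ≤ q) {f g : ℝ → ℂ}
    (hf : AEStronglyMeasurable f μ) (hg : AEStronglyMeasurable g μ) :
    lorentzRho μ p q (f + g) ≤ lorentzRho μ p q f + lorentzRho μ p q g := by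
  have hq0 : (0 : ℝ) ≤ q := by linarith
  have hq1 : (0 : ℝ) ≤ 1 / q := by positivity
  set ν : Measure ℝ := (volume.restrict (Ioi (0 : ℝ))).withDensity fun t => (ENNReal.ofReal t)⁻¹
  have hT : ∀ h : ℝ → ℂ, Measurable fun t : ℝ =>
      ENNReal.ofReal (t ^ (1 / p)) * rearrAvg μ h t := fun h =>
    ((measurable_id.pow_const _).ennreal_ofReal).mul (measurable_rearrAvg μ h)
  have key : ∀ h : ℝ → ℂ, lorentzRho μ p q h =
      (∫⁻ t, (ENNReal.ofReal (t ^ (1 / p)) * rearrAvg μ h t) ^ q ∂ν) ^ (1 / q) := by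
    intro h
    have hd : Measurable fun t : ℝ => (ENNReal.ofReal t)⁻¹ := ENNReal.measurable_ofReal.inv
    rw [lintegral_withDensity_eq_lintegral_mul _ hd ((hT h).pow_const q)]
    simp only [lorentzRho, Pi.mul_apply, mul_comm]
  rw [key, key, key]
  refine le_trans ?_ (ENNReal.lintegral_Lp_add_le (hT f).aemeasurable (hT g).aemeasurable hq)
  have hae : ∀ᵐ t ∂ν, 0 < t :=
    (withDensity_absolutelyContinuous _ _).ae_le (ae_restrict_mem measurableSet_Ioi)
  refine ENNReal.rpow_le_rpow (lintegral_mono_ae ?_) hq1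
  filter_upwards [hae] with t ht
  refine ENNReal.rpow_le_rpow ?_ hq0
  simp only [Pi.add_apply, rearrAvg, ← mul_add]
  gcongr
  exact lintegral_rearr_add hf hg ht

theorem rearr_smul_le (μ : Measure ℝ) (c : ℂ) (f : ℝ → ℂ) (t : ℝ) :
    rearr μ (c • f) t ≤ ‖c‖ₑ * rearr μ f t := by
  by_cases hc : c = 0
  · refine le_trans (iInf₂_le 0 ?_) bot_le
    simp [distr, hc]
  · have hc' : ‖c‖ₑ ≠ 0 := by simpa using hc
    rw [rearr, rearr, ENNReal.mul_iInf_of_ne hc' enorm_ne_top]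
    refine le_iInf fun l => ?_
    rw [ENNReal.mul_iInf_of_ne hc' enorm_ne_top]
    refine le_iInf fun hl => ?_
    refine (iInf₂_le (f := fun (l : ℝ≥0) (_ : distr μ (c • f) l ≤ ENNReal.ofReal t) => (l : ℝ≥0∞))
      (‖c‖₊ * l) (le_trans (measure_mono fun x hx => ?_) hl)).trans ?_
    · simp only [mem_ofPred_eq, Pi.smul_apply, nnnorm_smul] at hx ⊢
      exact lt_of_mul_lt_mul_left' hx
    · simp [enorm_eq_nnnorm]

theorem lorentzRho_smul {μ : Measure ℝ} {p q : ℝ} (hq : 1 ≤ q) (c : ℂ) (f : ℝ → ℂ) :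
    lorentzRho μ p q (c • f) ≤ ‖c‖ₑ * lorentzRho μ p q f := by
  have hq0 : (0 : ℝ) < q := by linarith
  have hq1 : (0 : ℝ) ≤ 1 / q := by positivity
  have h1 : ∀ t, rearrAvg μ (c • f) t ≤ ‖c‖ₑ * rearrAvg μ f t := by
    intro t
    unfold rearrAvg
    rw [mul_left_comm, ← lintegral_const_mul' _ _ enorm_ne_top]
    gcongr
    exact rearr_smul_le μ c f _
  have h2 : ‖c‖ₑ = (‖c‖ₑ ^ q) ^ (1 / q) := by
    rw [← ENNReal.rpow_mul, mul_one_div_cancel hq0.ne', ENNReal.rpow_one]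
  unfold lorentzRho
  conv_rhs => rw [h2]
  rw [← ENNReal.mul_rpow_of_nonneg _ _ hq1, ← lintegral_const_mul' _ _
    (ENNReal.rpow_ne_top_of_nonneg hq0.le enorm_ne_top)]
  refine ENNReal.rpow_le_rpow (lintegral_mono fun t => ?_) hq1
  rw [← mul_assoc, ← ENNReal.mul_rpow_of_nonneg _ _ hq0.le, mul_left_comm]
  gcongr
  exact h1 t

theorem lorentzRho_eq_zero {μ : Measure ℝ} {p q : ℝ} (hq : 1 ≤ q) {f : ℝ → ℂ}
    (h : lorentzRho μ p q f = 0) : f =ᵐ[μ] 0 := by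
  have hq0 : (0 : ℝ) < q := by linarith
  have hm : Measurable fun t : ℝ =>
      (ENNReal.ofReal (t ^ (1 / p)) * rearrAvg μ f t) ^ q * (ENNReal.ofReal t)⁻¹ :=
    ((((measurable_id.pow_const _).ennreal_ofReal).mul (measurable_rearrAvg μ f)).pow_const
      q).mul ENNReal.measurable_ofReal.inv
  rw [lorentzRho, ENNReal.rpow_eq_zero_iff_of_pos (by positivity), lintegral_eq_zero_iff hm] at h
  have hne : (ae (volume.restrict (Ioi (0 : ℝ)))).NeBot := by
    rw [ae_neBot, Ne, Measure.restrict_eq_zero, Real.volume_Ioi]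
    exact ENNReal.top_ne_zero
  obtain ⟨t, ht, ht0⟩ := (h.and (ae_restrict_mem measurableSet_Ioi)).exists
  have ht0' : 0 < t := ht0
  have h1 : rearrAvg μ f t = 0 := by
    simp only [Pi.zero_apply, mul_eq_zero, ENNReal.inv_eq_zero, ENNReal.ofReal_ne_top, or_false,
      ENNReal.rpow_eq_zero_iff_of_pos hq0, ENNReal.ofReal_eq_zero] at ht
    exact ht.resolve_left (not_le.2 (Real.rpow_pos_of_pos ht0' _))
  rw [rearrAvg, mul_eq_zero, ENNReal.inv_eq_zero, or_iff_right ENNReal.ofReal_ne_top,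
    lintegral_rearr, lintegral_eq_zero_iff
      ((distr_toNNReal_antitone μ f).measurable.min measurable_const)] at h1
  have h2 : ∀ᵐ l : ℝ ∂(volume.restrict (Ioi (0 : ℝ))), distr μ f l.toNNReal = 0 := by
    filter_upwards [h1] with l hl
    rcases min_eq_iff.1 hl with h3 | h3
    · exact h3.1
    · exact absurd h3.1 (by simpa using ht0')
  have h3 : ∀ k : ℕ, distr μ f (((k : ℝ≥0) + 1)⁻¹) = 0 := by
    intro k
    have hk : (0 : ℝ) < ((k : ℝ) + 1)⁻¹ := by positivity
    have h4 : ∀ᵐ l : ℝ ∂(volume.restrict (Ioo (0 : ℝ) ((k : ℝ) + 1)⁻¹)),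
        distr μ f l.toNNReal = 0 := ae_restrict_of_ae_restrict_of_subset Ioo_subset_Ioi_self h2
    have : (ae (volume.restrict (Ioo (0 : ℝ) ((k : ℝ) + 1)⁻¹))).NeBot := by
      rw [ae_neBot, Ne, Measure.restrict_eq_zero, Real.volume_Ioo]
      simpa using hk
    obtain ⟨l, hl, hl'⟩ := (h4.and (ae_restrict_mem measurableSet_Ioo)).exists
    refine le_antisymm (le_trans (distr_antitone μ f ?_) hl.le) bot_le
    rw [Real.toNNReal_le_iff_le_coe]
    push_cast
    exact hl'.2.le
  have h5 : ∀ᵐ x ∂μ, ∀ k : ℕ, ¬ (((k : ℝ≥0) + 1)⁻¹ < ‖f x‖₊) :=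
    ae_all_iff.2 fun k => by
      rw [ae_iff]; simp only [not_not]; exact h3 k
  filter_upwards [h5] with x hx
  by_contra hne
  have hpos : 0 < ‖f x‖ := norm_pos_iff.2 hne
  obtain ⟨k, hk⟩ := exists_nat_one_div_lt hpos
  refine hx k ?_
  rw [← NNReal.coe_lt_coe]
  push_cast
  rw [one_div] at hk
  exact hk

/-- The Lorentz norm on the measure space `(ℝ, μ)`. -/
def lorentzNorm (μ : Measure ℝ) (p q : ℝ) (hq : 1 < q) : FunNorm μ where
  rho f := lorentzRho μ p q f
  add_le f g := by
    refine le_trans (lorentzRho_mono (by linarith) fun l => ?_)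
      (lorentzRho_add hq.le f.aestronglyMeasurable g.aestronglyMeasurable)
    rw [distr_congr (AEEqFun.coeFn_add f g)]
  smul_le c f := by
    refine le_trans (lorentzRho_mono (by linarith) fun l => ?_) (lorentzRho_smul hq.le c f)
    rw [distr_congr (AEEqFun.coeFn_smul c f)]
  eq_zero f hf := AEEqFun.ext ((lorentzRho_eq_zero hq.le hf).trans AEEqFun.coeFn_zero.symm)

theorem distr_restr_le (f : ℝ →ₘ[volume] ℂ) (l : ℝ≥0) :
    distr volPos (restr f) l ≤ distr volume f l := by
  rw [distr_congr (coeFn_restr f)]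
  exact Measure.restrict_apply_le _ _

theorem distr_ext0_le (f : ℝ →ₘ[volPos] ℂ) (l : ℝ≥0) :
    distr volume (ext0 f) l ≤ distr volPos f l := by
  rw [distr_congr (coeFn_ext0 f), distr, distr,
    Measure.restrict_apply' measurableSet_Ioi]
  refine measure_mono fun x hx => ?_
  by_cases h : x ∈ Ioi (0 : ℝ)
  · exact ⟨by simpa [indicator_of_mem h] using hx, h⟩
  · simp [indicator_of_notMem h] at hx

/-- The Lorentz space `L^{p,q}`. -/
def lorentz (p q : ℝ) (hq : 1 < q) : SpacePair where
  line := lorentzNorm volume p q hq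
  half := lorentzNorm volPos p q hq
  restr_le f := lorentzRho_mono (by linarith) (distr_restr_le f)
  ext0_le f := lorentzRho_mono (by linarith) (distr_ext0_le f)

/-! ### Luxemburg norms -/

/-- The conditions on `M(x, t)` under which the Luxemburg functional is a norm. -/
structure IsModular (μ : Measure ℝ) (M : ℝ → ℝ≥0∞ → ℝ≥0∞) : Prop where
  meas : ∀ g : ℝ → ℝ≥0∞, AEMeasurable g μ → AEMeasurable (fun x => M x (g x)) μ
  mono : ∀ᵐ x ∂μ, Monotone (M x)
  zero : ∀ᵐ x ∂μ, M x 0 = 0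
  convex : ∀ᵐ x ∂μ, ∀ a b s t : ℝ≥0∞, a + b = 1 → M x (a * s + b * t) ≤ a * M x s + b * M x t
  pos : ∀ᵐ x ∂μ, ∀ t : ℝ≥0∞, t ≠ 0 → ∃ k : ℕ, M x (k * t) ≠ 0

/-- The Luxemburg functional `inf {λ > 0 : ∫ M(x, g(x)/λ) dμ(x) ≤ 1}`. -/
def luxemburg (μ : Measure ℝ) (M : ℝ → ℝ≥0∞ → ℝ≥0∞) (g : ℝ → ℝ≥0∞) : ℝ≥0∞ :=
  ⨅ (l : ℝ≥0) (_ : 0 < l ∧ ∫⁻ x, M x (g x / l) ∂μ ≤ 1), (l : ℝ≥0∞)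

theorem luxemburg_le {μ : Measure ℝ} {M : ℝ → ℝ≥0∞ → ℝ≥0∞} {g : ℝ → ℝ≥0∞} (l : ℝ≥0)
    (hl : 0 < l) (h : ∫⁻ x, M x (g x / l) ∂μ ≤ 1) : luxemburg μ M g ≤ l :=
  iInf₂_le (f := fun (l : ℝ≥0) (_ : 0 < l ∧ ∫⁻ x, M x (g x / l) ∂μ ≤ 1) => (l : ℝ≥0∞)) l ⟨hl, h⟩

theorem luxemburg_mono {μ ν : Measure ℝ} {M : ℝ → ℝ≥0∞ → ℝ≥0∞} {g h : ℝ → ℝ≥0∞}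
    (H : ∀ l : ℝ≥0, 0 < l → ∫⁻ x, M x (g x / l) ∂μ ≤ ∫⁻ x, M x (h x / l) ∂ν) :
    luxemburg μ M g ≤ luxemburg ν M h :=
  le_iInf₂ fun l hl => luxemburg_le l hl.1 ((H l hl.1).trans hl.2)

namespace IsModular

variable {μ : Measure ℝ} {M : ℝ → ℝ≥0∞ → ℝ≥0∞}

theorem lintegral_div_le (hM : IsModular μ M) (g : ℝ → ℝ≥0∞) {m : ℕ} (hm : m ≠ 0) :
    ∫⁻ x, M x ((m : ℝ≥0∞)⁻¹ * g x) ∂μ ≤ (m : ℝ≥0∞)⁻¹ * ∫⁻ x, M x (g x) ∂μ := by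
  have hm' : (m : ℝ≥0∞)⁻¹ ≠ ∞ := by simpa using hm
  have h1 : (m : ℝ≥0∞)⁻¹ ≤ 1 := by
    rw [ENNReal.inv_le_one]; exact_mod_cast Nat.one_le_iff_ne_zero.2 hm
  rw [← lintegral_const_mul' _ _ hm']
  refine lintegral_mono_ae ?_
  filter_upwards [hM.zero, hM.convex] with x hx hx'
  have := hx' (m : ℝ≥0∞)⁻¹ (1 - (m : ℝ≥0∞)⁻¹) (g x) 0 (add_tsub_cancel_of_le h1)
  simpa [hx] using this

/-- The functions of finite Luxemburg norm are those with `∫ M(x, g(x)/λ) dμ(x) < ∞` for some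
`λ > 0`. -/
theorem luxemburg_lt_top_iff (hM : IsModular μ M) (g : ℝ → ℝ≥0∞) :
    luxemburg μ M g < ∞ ↔ ∃ l : ℝ≥0, 0 < l ∧ ∫⁻ x, M x (g x / l) ∂μ < ∞ := by
  constructor
  · intro h
    simp only [luxemburg, iInf_lt_iff] at h
    obtain ⟨l, hl, _⟩ := h
    exact ⟨l, hl.1, hl.2.trans_lt ENNReal.one_lt_top⟩
  · rintro ⟨l, hl, h⟩
    obtain ⟨m, hm⟩ := ENNReal.exists_nat_gt h.ne
    have hm0 : m ≠ 0 := by rintro rfl; simp at hm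
    have hm0' : (m : ℝ≥0∞) ≠ 0 := by exact_mod_cast hm0
    refine lt_of_le_of_lt (luxemburg_le (m * l) (by positivity) ?_)
      (ENNReal.coe_lt_top (r := m * l))
    have h1 : ∀ x, g x / ((m * l : ℝ≥0) : ℝ≥0∞) = (m : ℝ≥0∞)⁻¹ * (g x / l) := by
      intro x
      rw [ENNReal.coe_mul, ENNReal.coe_natCast, ENNReal.div_eq_inv_mul, ENNReal.div_eq_inv_mul,
        ENNReal.mul_inv (Or.inl hm0') (Or.inl (ENNReal.natCast_ne_top m)), mul_assoc]
    simp_rw [h1]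
    refine (hM.lintegral_div_le _ hm0).trans ?_
    calc (m : ℝ≥0∞)⁻¹ * ∫⁻ x, M x (g x / l) ∂μ ≤ (m : ℝ≥0∞)⁻¹ * m := by gcongr
      _ = 1 := ENNReal.inv_mul_cancel hm0' (ENNReal.natCast_ne_top m)

theorem luxemburg_zero (hM : IsModular μ M) : luxemburg μ M 0 = 0 := by
  refine le_antisymm (le_of_forall_gt fun c hc => ?_) bot_le
  obtain ⟨l, hl, hl'⟩ := ENNReal.lt_iff_exists_nnreal_btwn.1 hc
  refine lt_of_le_of_lt (luxemburg_le l (by exact_mod_cast hl) ?_) hl'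
  have : ∫⁻ x, M x ((0 : ℝ → ℝ≥0∞) x / l) ∂μ = 0 := by
    rw [← lintegral_zero (μ := μ)]
    refine lintegral_congr_ae ?_
    filter_upwards [hM.zero] with x hx
    simpa using hx
  rw [this]; exact zero_le_one

theorem luxemburg_add (hM : IsModular μ M) {g h : ℝ → ℝ≥0∞} (hg : AEMeasurable g μ) :
    luxemburg μ M (g + h) ≤ luxemburg μ M g + luxemburg μ M h := by
  conv_rhs => rw [luxemburg, luxemburg]
  simp_rw [ENNReal.iInf_add, ENNReal.add_iInf]
  refine le_iInf₂ fun l1 hl1 => le_iInf₂ fun l2 hl2 => ?_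
  obtain ⟨h1, h1'⟩ := hl1
  obtain ⟨h2, h2'⟩ := hl2
  have h1e : (l1 : ℝ≥0∞) ≠ 0 := by exact_mod_cast h1.ne'
  have h2e : (l2 : ℝ≥0∞) ≠ 0 := by exact_mod_cast h2.ne'
  have h3e : (l1 + l2 : ℝ≥0∞) ≠ 0 := by simp [h1e]
  have h3t : (l1 + l2 : ℝ≥0∞) ≠ ∞ := by simp
  set a : ℝ≥0∞ := l1 / (l1 + l2) with ha
  set b : ℝ≥0∞ := l2 / (l1 + l2) with hb
  have hab : a + b = 1 := by
    rw [ha, hb, ← ENNReal.add_div, ENNReal.div_self h3e h3t]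
  have ha' : a ≠ ∞ := fun h => by simp [h] at hab
  have hb' : b ≠ ∞ := fun h => by simp [h] at hab
  have hkey : ∀ x, (g + h) x / ((l1 + l2 : ℝ≥0) : ℝ≥0∞) = a * (g x / l1) + b * (h x / l2) := by
    intro x
    rw [Pi.add_apply, ENNReal.add_div, ENNReal.coe_add]
    have e : ∀ (u v w : ℝ≥0∞), v ≠ 0 → v ≠ ∞ → u / w = v / w * (u / v) := by
      intro u v w h0 ht
      rw [ENNReal.div_eq_inv_mul, ENNReal.div_eq_inv_mul, ENNReal.div_eq_inv_mul, mul_assoc,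
        ← mul_assoc v, ENNReal.mul_inv_cancel h0 ht, one_mul]
    rw [e (g x) l1 _ h1e ENNReal.coe_ne_top, e (h x) l2 _ h2e ENNReal.coe_ne_top]
  refine le_trans (luxemburg_le (l1 + l2) (by positivity) ?_) (by rw [ENNReal.coe_add])
  simp_rw [hkey]
  calc ∫⁻ x, M x (a * (g x / l1) + b * (h x / l2)) ∂μ
      ≤ ∫⁻ x, (a * M x (g x / l1) + b * M x (h x / l2)) ∂μ := by
        refine lintegral_mono_ae ?_
        filter_upwards [hM.convex] with x hx
        exact hx _ _ _ _ hab
    _ = a * ∫⁻ x, M x (g x / l1) ∂μ + b * ∫⁻ x, M x (h x / l2) ∂μ := by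
        rw [lintegral_add_left' ((hM.meas _ (hg.div_const _)).const_mul _),
          lintegral_const_mul' _ _ ha', lintegral_const_mul' _ _ hb']
    _ ≤ a * 1 + b * 1 := by gcongr
    _ = 1 := by rw [mul_one, mul_one, hab]

theorem luxemburg_smul (hM : IsModular μ M) (c : ℝ≥0) (g : ℝ → ℝ≥0∞) :
    luxemburg μ M (fun x => c * g x) ≤ c * luxemburg μ M g := by
  by_cases hc : c = 0
  · have : (fun x => ((c : ℝ≥0) : ℝ≥0∞) * g x) = 0 := by funext x; simp [hc]
    rw [this, hM.luxemburg_zero]; exact bot_le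
  · have hc' : (c : ℝ≥0∞) ≠ 0 := by exact_mod_cast hc
    conv_rhs => rw [luxemburg]
    rw [ENNReal.mul_iInf_of_ne hc' ENNReal.coe_ne_top]
    refine le_iInf fun l => ?_
    rw [ENNReal.mul_iInf_of_ne hc' ENNReal.coe_ne_top]
    refine le_iInf fun hl => ?_
    refine le_trans (luxemburg_le (c * l) (mul_pos (pos_iff_ne_zero.2 hc) hl.1) ?_)
      (by rw [ENNReal.coe_mul])
    have : ∀ x, (c : ℝ≥0∞) * g x / ((c * l : ℝ≥0) : ℝ≥0∞) = g x / l := fun x => by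
      rw [ENNReal.coe_mul, ENNReal.mul_div_mul_left _ _ hc' ENNReal.coe_ne_top]
    simp_rw [this]
    exact hl.2

theorem luxemburg_eq_zero (hM : IsModular μ M) {g : ℝ → ℝ≥0∞} (hg : AEMeasurable g μ)
    (h : luxemburg μ M g = 0) : g =ᵐ[μ] 0 := by
  have h1 : ∀ n : ℕ, n ≠ 0 → ∫⁻ x, M x (n * g x) ∂μ ≤ 1 := by
    intro n hn
    have h2 : luxemburg μ M g < (n : ℝ≥0∞)⁻¹ := by
      rw [h]; simp
    simp only [luxemburg, iInf_lt_iff] at h2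
    obtain ⟨l, ⟨hl, hl'⟩, hln⟩ := h2
    refine le_trans (lintegral_mono_ae ?_) hl'
    filter_upwards [hM.mono] with x hx
    refine hx ?_
    rw [ENNReal.div_eq_inv_mul]
    gcongr
    rw [ENNReal.le_inv_iff_mul_le, mul_comm, ← ENNReal.le_inv_iff_mul_le]
    exact hln.le
  have h3 : ∀ k : ℕ, ∀ᵐ x ∂μ, M x (k * g x) = 0 := by
    intro k
    by_cases hk : k = 0
    · filter_upwards [hM.zero] with x hx
      simpa [hk] using hx
    have h4 : ∫⁻ x, M x (k * g x) ∂μ = 0 := by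
      refine le_antisymm (le_of_forall_gt fun c hc => ?_) bot_le
      obtain ⟨m, hm⟩ := ENNReal.exists_inv_nat_lt hc.ne'
      rcases Nat.eq_zero_or_pos m with rfl | hm0
      · simp at hm
      refine lt_of_le_of_lt ?_ hm
      have h5 := hM.lintegral_div_le (fun x => ((m * k : ℕ) : ℝ≥0∞) * g x) hm0.ne'
      have h6 : ∀ x, (m : ℝ≥0∞)⁻¹ * (((m * k : ℕ) : ℝ≥0∞) * g x) = k * g x := fun x => by
        rw [Nat.cast_mul, mul_assoc, ← mul_assoc, ENNReal.inv_mul_cancel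
          (by exact_mod_cast hm0.ne') (ENNReal.natCast_ne_top m), one_mul]
      simp_rw [h6] at h5
      refine h5.trans ?_
      calc _ ≤ (m : ℝ≥0∞)⁻¹ * 1 := by gcongr; exact h1 _ (by positivity)
        _ = _ := mul_one _
    exact (lintegral_eq_zero_iff' (hM.meas _ (hg.const_mul _))).1 h4
  filter_upwards [ae_all_iff.2 h3, hM.pos] with x hx hx'
  by_contra hne
  obtain ⟨k, hk⟩ := hx' _ hne
  exact hk (hx k)

/-- The Luxemburg norm. -/
def norm (hM : IsModular μ M) : FunNorm μ where
  rho f := luxemburg μ M fun x => ‖f x‖ₑ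
  add_le f g := by
    refine le_trans (luxemburg_mono fun l _ => lintegral_mono_ae ?_)
      (hM.luxemburg_add f.aestronglyMeasurable.enorm)
    filter_upwards [hM.mono, AEEqFun.coeFn_add f g] with x hx hx'
    refine hx ?_
    rw [hx', Pi.add_apply, Pi.add_apply]
    gcongr
    exact enorm_add_le _ _
  smul_le c f := by
    refine le_trans (luxemburg_mono fun l _ => lintegral_mono_ae ?_)
      (hM.luxemburg_smul ‖c‖₊ fun x => ‖f x‖ₑ)
    filter_upwards [AEEqFun.coeFn_smul c f] with x hx
    rw [hx, Pi.smul_apply, enorm_smul]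
    rfl
  eq_zero f hf := by
    refine AEEqFun.ext ?_
    filter_upwards [hM.luxemburg_eq_zero f.aestronglyMeasurable.enorm hf,
      AEEqFun.coeFn_zero (μ := μ) (β := ℂ)] with x hx hx'
    rw [hx']
    simpa using hx

theorem restrict {M : ℝ → ℝ≥0∞ → ℝ≥0∞} (hM : IsModular volume M) : IsModular volPos M where
  meas g hg := by
    have h1 : AEMeasurable ((Ioi (0 : ℝ)).indicator g) volume :=
      (aemeasurable_indicator_iff measurableSet_Ioi).2 hg
    refine (hM.meas _ h1).restrict.congr ?_
    filter_upwards [ae_restrict_mem measurableSet_Ioi] with x hx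
    rw [indicator_of_mem hx]
  mono := ae_restrict_of_ae hM.mono
  zero := ae_restrict_of_ae hM.zero
  convex := ae_restrict_of_ae hM.convex
  pos := ae_restrict_of_ae hM.pos

/-- The spaces on `ℝ` and `ℝ₊` given by a Luxemburg norm. -/
def space {M : ℝ → ℝ≥0∞ → ℝ≥0∞} (hM : IsModular volume M) : SpacePair where
  line := hM.norm
  half := hM.restrict.norm
  restr_le f := luxemburg_mono fun l _ => by
    refine le_trans (lintegral_mono_ae ?_) (setLIntegral_le_lintegral (Ioi (0 : ℝ)) _)
    filter_upwards [coeFn_restr f] with x hx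
    rw [hx]
  ext0_le f := luxemburg_mono fun l _ => by
    rw [← lintegral_indicator measurableSet_Ioi]
    refine lintegral_mono_ae ?_
    filter_upwards [coeFn_ext0 f, hM.zero] with x hx hx'
    rw [hx]
    by_cases h : x ∈ Ioi (0 : ℝ)
    · simp only [indicator_of_mem h]; exact le_rfl
    · simp [indicator_of_notMem h, hx']

end IsModular

/-! ### Orlicz spaces -/

/-- `φ : [0, ∞) → [0, ∞]` is non-decreasing and left-continuous with `φ(0) = 0` and
`φ(∞) = ∞`, and not identically infinite on `(0, ∞)`. -/
structure IsYoungDensity (φ : ℝ≥0 → ℝ≥0∞) : Prop where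
  mono : Monotone φ
  leftCont : ∀ t, ContinuousWithinAt φ (Iic t) t
  zero : φ 0 = 0
  tendsto : Tendsto φ atTop (𝓝 ∞)
  finite : ∃ t, 0 < t ∧ φ t < ∞

/-- The Young function `Φ(x) = ∫₀ˣ φ(t) dt`. -/
def young (φ : ℝ≥0 → ℝ≥0∞) (x : ℝ≥0∞) : ℝ≥0∞ :=
  ∫⁻ t in {t : ℝ | 0 < t ∧ ENNReal.ofReal t ≤ x}, φ t.toNNReal

theorem young_mono (φ : ℝ≥0 → ℝ≥0∞) : Monotone (young φ) := fun _ _ hst =>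
  lintegral_mono_set fun _ hx => ⟨hx.1, hx.2.trans hst⟩

theorem young_zero (φ : ℝ≥0 → ℝ≥0∞) : young φ 0 = 0 := by
  have : {t : ℝ | 0 < t ∧ ENNReal.ofReal t ≤ 0} = ∅ := by
    ext t
    simp only [mem_ofPred_eq, mem_empty_iff_false, iff_false, not_and]
    intro h; simpa using h
  rw [young, this]; simp

theorem young_coe (φ : ℝ≥0 → ℝ≥0∞) (x : ℝ≥0) :
    young φ x = ∫⁻ t in Ioc 0 (x : ℝ), φ t.toNNReal := by
  have : {t : ℝ | 0 < t ∧ ENNReal.ofReal t ≤ x} = Ioc 0 (x : ℝ) := by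
    ext t
    simp only [mem_ofPred_eq, mem_Ioc, and_congr_right_iff]
    intro ht
    rw [ENNReal.ofReal, ENNReal.coe_le_coe, Real.toNNReal_le_iff_le_coe]
  rw [young, this]

theorem young_coe_add (φ : ℝ≥0 → ℝ≥0∞) {s t : ℝ≥0} (h : s ≤ t) :
    young φ t = young φ s + ∫⁻ u in Ioc (s : ℝ) t, φ u.toNNReal := by
  have h' : (s : ℝ) ≤ t := by exact_mod_cast h
  have hd : Disjoint (Ioc 0 (s : ℝ)) (Ioc (s : ℝ) t) :=
    Set.disjoint_left.2 fun x hx hx' => absurd hx.2 (not_le.2 hx'.1)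
  rw [young_coe, young_coe, ← Ioc_union_Ioc_eq_Ioc s.coe_nonneg h',
    lintegral_union measurableSet_Ioc hd]

theorem IsYoungDensity.exists_le {φ : ℝ≥0 → ℝ≥0∞} (hφ : IsYoungDensity φ) :
    ∃ T : ℝ≥0, ∀ n : ℕ, ∀ x : ℝ≥0∞, (T + n : ℝ≥0) ≤ x → (n : ℝ≥0∞) ≤ young φ x := by
  obtain ⟨T, hT⟩ := eventually_atTop.1 (hφ.tendsto.eventually (lt_mem_nhds ENNReal.one_lt_top))
  refine ⟨T, fun n x hx => le_trans ?_ (young_mono φ hx)⟩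
  rw [young_coe_add φ (le_self_add : T ≤ T + n)]
  refine le_trans ?_ le_add_self
  calc (n : ℝ≥0∞) = ∫⁻ _ in Ioc (T : ℝ) (T + n : ℝ≥0), 1 := by
        rw [setLIntegral_const, Real.volume_Ioc]; simp
    _ ≤ _ := setLIntegral_mono' measurableSet_Ioc fun u hu =>
        (hT _ (NNReal.le_toNNReal_of_coe_le hu.1.le)).le

theorem IsYoungDensity.young_top {φ : ℝ≥0 → ℝ≥0∞} (hφ : IsYoungDensity φ) : young φ ∞ = ∞ := by
  obtain ⟨T, hT⟩ := hφ.exists_le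
  exact ENNReal.eq_top_of_forall_nnreal_le fun r => by
    obtain ⟨n, hn⟩ := exists_nat_ge r
    exact le_trans (by exact_mod_cast hn) (hT n ∞ le_top)

theorem IsYoungDensity.convex_aux {φ : ℝ≥0 → ℝ≥0∞} (hφ : IsYoungDensity φ) {a b s t : ℝ≥0}
    (hab : a + b = 1) (hst : s ≤ t) :
    young φ ((a * s + b * t : ℝ≥0) : ℝ≥0∞) ≤ a * young φ s + b * young φ t := by
  set z : ℝ≥0 := a * s + b * t with hz
  have habR : (a : ℝ) + b = 1 := by exact_mod_cast hab
  have hstR : (s : ℝ) ≤ t := by exact_mod_cast hst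
  have hzR : (z : ℝ) = a * s + b * t := by rw [hz]; push_cast; rfl
  have h1 : (z : ℝ) - s = b * (t - s) := by
    rw [hzR]; linear_combination (s : ℝ) * habR
  have h2 : (t : ℝ) - z = a * (t - s) := by
    rw [hzR]; linear_combination (-(t : ℝ)) * habR
  have hsz : s ≤ z := by
    rw [← NNReal.coe_le_coe, ← sub_nonneg, h1]
    exact mul_nonneg b.coe_nonneg (sub_nonneg.2 hstR)
  have hzt : z ≤ t := by
    rw [← NNReal.coe_le_coe, ← sub_nonneg, h2]
    exact mul_nonneg a.coe_nonneg (sub_nonneg.2 hstR)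
  rw [young_coe_add φ hzt, young_coe_add φ hsz]
  set A := ∫⁻ u in Ioc (s : ℝ) z, φ u.toNNReal
  set B := ∫⁻ u in Ioc (z : ℝ) t, φ u.toNNReal
  have hA : A ≤ φ z * ENNReal.ofReal (z - s) := by
    rw [← Real.volume_Ioc, ← setLIntegral_const]
    exact setLIntegral_mono' measurableSet_Ioc fun u hu =>
      hφ.mono (Real.toNNReal_le_iff_le_coe.2 hu.2)
  have hB : φ z * ENNReal.ofReal (t - z) ≤ B := by
    rw [← Real.volume_Ioc, ← setLIntegral_const]
    exact setLIntegral_mono' measurableSet_Ioc fun u hu =>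
      hφ.mono (NNReal.le_toNNReal_of_coe_le hu.1.le)
  have hAB : (a : ℝ≥0∞) * A ≤ b * B := by
    calc (a : ℝ≥0∞) * A ≤ a * (φ z * ENNReal.ofReal (z - s)) := by gcongr
      _ = b * (φ z * ENNReal.ofReal (t - z)) := by
          rw [h1, h2, ENNReal.ofReal_mul b.coe_nonneg, ENNReal.ofReal_mul a.coe_nonneg,
            ENNReal.ofReal_coe_nnreal, ENNReal.ofReal_coe_nnreal]
          ring
      _ ≤ b * B := by gcongr
  have habE : (a : ℝ≥0∞) + b = 1 := by exact_mod_cast hab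
  calc young φ s + A = (a + b) * (young φ s + A) := by rw [habE, one_mul]
    _ = a * young φ s + b * (young φ s + A) + a * A := by ring
    _ ≤ a * young φ s + b * (young φ s + A) + b * B := by gcongr
    _ = _ := by ring

theorem IsYoungDensity.convex {φ : ℝ≥0 → ℝ≥0∞} (hφ : IsYoungDensity φ) {a b s t : ℝ≥0∞}
    (hab : a + b = 1) : young φ (a * s + b * t) ≤ a * young φ s + b * young φ t := by
  wlog hst : s ≤ t generalizing a b s t
  · rw [add_comm (a * s), add_comm (a * young φ s)]
    exact this (by rw [add_comm]; exact hab) (not_le.1 hst).le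
  by_cases hb : b = 0
  · have ha : a = 1 := by simpa [hb] using hab
    simp [ha, hb]
  by_cases ht : t = ∞
  · have h : a * young φ s + b * young φ t = ∞ := by
      rw [ht, hφ.young_top, ENNReal.mul_top hb, add_top]
    rw [h]; exact le_top
  have hs : s ≠ ∞ := ne_top_of_le_ne_top ht hst
  have ha' : a ≠ ∞ := by rintro rfl; simp at hab
  have hb' : b ≠ ∞ := by rintro rfl; simp at hab
  lift a to ℝ≥0 using ha'
  lift b to ℝ≥0 using hb'
  lift s to ℝ≥0 using hs
  lift t to ℝ≥0 using ht
  exact_mod_cast hφ.convex_aux (by exact_mod_cast hab) (by exact_mod_cast hst)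

theorem IsYoungDensity.isModular {φ : ℝ≥0 → ℝ≥0∞} (hφ : IsYoungDensity φ) :
    IsModular volume fun _ => young φ where
  meas _ hg := (young_mono φ).measurable.comp_aemeasurable hg
  mono := ae_of_all _ fun _ => young_mono φ
  zero := ae_of_all _ fun _ => young_zero φ
  convex := ae_of_all _ fun _ _ _ _ _ hab => hφ.convex hab
  pos := ae_of_all _ fun _ t ht => by
    obtain ⟨T, hT⟩ := hφ.exists_le
    obtain ⟨k, hk⟩ := ENNReal.exists_nat_mul_gt ht (ENNReal.coe_ne_top (r := T + (1 : ℕ)))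
    refine ⟨k, fun h => ?_⟩
    have := hT 1 _ hk.le
    rw [h] at this
    simp at this

/-- The Orlicz space `L^Φ`. -/
def orlicz (φ : ℝ≥0 → ℝ≥0∞) (hφ : IsYoungDensity φ) : SpacePair := hφ.isModular.space

/-- Reflexivity: the canonical map into the bidual is surjective. -/
def IsReflexive (E : Type*) [NormedAddCommGroup E] [NormedSpace ℂ E] : Prop :=
  Function.Surjective (NormedSpace.inclusionInDoubleDual ℂ E)

/-! ### Variable Lebesgue spaces -/

/-- `p(·)` is a variable exponent on `ℝ`: a measurable, a.e. finite function with values in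
`[1, ∞]`. -/
structure IsExponent (p : ℝ → ℝ≥0∞) : Prop where
  meas : AEMeasurable p volume
  one_le : ∀ x, 1 ≤ p x
  finite : ∀ᵐ x, p x < ∞

/-- The function `t ↦ t^{p(x)}` (the value at the points with `p(x) = ∞` plays no role). -/
def powExp (p : ℝ → ℝ≥0∞) (x : ℝ) (t : ℝ≥0∞) : ℝ≥0∞ := t ^ (p x).toReal

theorem IsExponent.isModular {p : ℝ → ℝ≥0∞} (hp : IsExponent p) :
    IsModular volume (powExp p) := by
  have h1 : ∀ᵐ x, 1 ≤ (p x).toReal := by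
    filter_upwards [hp.finite] with x hx
    have := ENNReal.toReal_mono hx.ne (hp.one_le x)
    simpa using this
  refine ⟨fun g hg => hg.pow hp.meas.ennreal_toReal, ?_, ?_, ?_, ?_⟩
  · filter_upwards [h1] with x hx
    exact ENNReal.monotone_rpow_of_nonneg (by linarith)
  · filter_upwards [h1] with x hx
    exact ENNReal.zero_rpow_of_pos (by linarith)
  · filter_upwards [h1] with x hx
    exact fun a b s t hab => ENNReal.rpow_arith_mean_le_arith_mean2_rpow a b s t hab hx
  · filter_upwards [h1] with x hx
    intro t ht
    refine ⟨1, fun h => ?_⟩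
    rw [powExp, Nat.cast_one, one_mul, ENNReal.rpow_eq_zero_iff_of_pos (by linarith)] at h
    exact ht h

/-- The variable Lebesgue space `L^{p(·)}`. -/
def varLebesgue (p : ℝ → ℝ≥0∞) (hp : IsExponent p) : SpacePair := hp.isModular.space

/-- The Hardy-Littlewood maximal function: the supremum of the averages of `|f|` over the bounded
intervals that contain `x`. -/
def maximal (f : ℝ → ℂ) (x : ℝ) : ℝ≥0∞ :=
  ⨆ (a : ℝ) (b : ℝ) (_ : a < b) (_ : x ∈ Icc a b),
    (∫⁻ t in Icc a b, ‖f t‖ₑ) / ENNReal.ofReal (b - a)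

/-- The class `𝓑_M(ℝ)`: `1 < p₋ ≤ p₊ < ∞` and the maximal operator is bounded on `L^{p(·)}(ℝ)`. -/
structure IsBM (p : ℝ → ℝ≥0∞) (hp : IsExponent p) : Prop where
  one_lt_essInf : 1 < essInf p volume
  essSup_lt_top : essSup p volume < ∞
  maximal_bounded : ∃ C : ℝ≥0, ∀ f : (varLebesgue p hp).line.Space,
    luxemburg volume (powExp p) (maximal ((varLebesgue p hp).line.incl f)) ≤
      C * (varLebesgue p hp).line.rho ((varLebesgue p hp).line.incl f)

/-! ### The three classes of spaces -/

/-- `X` is (a) a Lorentz space `L^{p,q}` with `1 < p, q < ∞`, (b) a reflexive Orlicz space `L^Φ`,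
or (c) a variable Lebesgue space `L^{p(·)}` with `p(·) ∈ 𝓑_M(ℝ)`. -/
inductive IsAdmissible : SpacePair → Prop
  | lorentz (p q : ℝ) (hp : 1 < p) (hq : 1 < q) : IsAdmissible (lorentz p q hq)
  | orlicz (φ : ℝ≥0 → ℝ≥0∞) (hφ : IsYoungDensity φ)
      (hr : IsReflexive (orlicz φ hφ).half.Space) : IsAdmissible (orlicz φ hφ)
  | varLebesgue (p : ℝ → ℝ≥0∞) (hp : IsExponent p) (hM : IsBM p hp) :
      IsAdmissible (varLebesgue p hp)

end WH
end

noncomputable section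

namespace WH

/-! ### One-sided exponential kernels -/

/-! With the normalisation `e^{iξx}`, the function equal to `e^{-x}` for `x > 0` and to zero
elsewhere has Fourier transform `1/(1 - iξ)`, and `r_1(ξ) = 1 - 2/(1 - iξ)`. Hence `1 - 2K_1` and `1
- 2K_{-1}` realise `W⁰(r_1)` and `W⁰(r_{-1})`, where `K_1` and `K_{-1}` are the convolutions with
`e^{-u}` on `u > 0` and with `e^u` on `u < 0`. Let `A` and `B` be the compressions of these two
operators to the half-line (`halfShift`). If `f` vanishes on the negative half-line, so does `K_1
f`; and `K_{-1} f` on `(0, ∞)` depends only on the values of `f` there. Therefore `W(r_n) = A^n`,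
`W(r_{-n}) = B^n` and `BA = 1`.

The equation `B f = 0` reads `f(x) = 2 ∫_x^∞ e^{x-t} f(t) dt`. It forces `(e^{-x} f)' = -2 e^{-x}
f`, so `Ker B` is spanned by `ψ_0` (`exists_eq_mul_expFun`). For a left inverse `B` of `A` whose
kernel is spanned by one vector `v`, the kernel of `B^n` is spanned by `A^k v`, `k < n`
(`ker_pow_eq_span`), and here `A^k ψ_0 = ψ_k`. The pieces are assembled in `IsConvBounded.ker_W`.

Two properties of `X` are needed. One is that convolution with `e^{-|u|}` is bounded
(`IsConvBounded`): in Lorentz spaces because it is bounded on `L¹` and on `L^∞`, in Orlicz spaces by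
Jensen's inequality, in variable Lebesgue spaces because the maximal function dominates it. The
other is that `L²` functions are dense in `X(ℝ₊)`: `W0` is an arbitrarily chosen extension, and
density makes the Wiener-Hopf operator independent of the choice (`IsConvBounded.W_eq`). For Lorentz
and variable Lebesgue spaces density comes from truncation and dominated convergence; for reflexive
Orlicz spaces it comes from weak compactness, with no `Δ₂` condition extracted from reflexivity. -/

/-- The kernel `e^{-σu}` on the half-line `σu > 0`. -/
def expKer (σ u : ℝ) : ℝ := if 0 < σ * u then Real.exp (-(σ * u)) else 0

/-- The convolution of `f` with the one-sided exponential kernel. -/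
def conv (σ : ℝ) (f : ℝ → ℂ) (x : ℝ) : ℂ := ∫ t, (expKer σ (x - t) : ℂ) * f t

/-- The convolution of a nonnegative function with `e^{-|u|}`. -/
def absConv (g : ℝ → ℝ≥0∞) (x : ℝ) : ℝ≥0∞ := ∫⁻ t, ENNReal.ofReal (Real.exp (-|x - t|)) * g t

theorem measurable_expKer (σ : ℝ) : Measurable (expKer σ) := by
  unfold expKer
  exact Measurable.ite (measurableSet_lt measurable_const (measurable_const_mul σ))
    (by fun_prop) measurable_const

theorem expKer_nonneg (σ u : ℝ) : 0 ≤ expKer σ u := by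
  unfold expKer; split_ifs <;> positivity

theorem expKer_le {σ : ℝ} (hσ : |σ| = 1) (u : ℝ) : expKer σ u ≤ Real.exp (-|u|) := by
  unfold expKer
  split_ifs with h
  · have : |u| = σ * u := by rw [← abs_of_pos h, abs_mul, hσ, one_mul]
    rw [this]
  · positivity

theorem enorm_expKer_mul_le {σ : ℝ} (hσ : |σ| = 1) (u : ℝ) (z : ℂ) :
    ‖(expKer σ u : ℂ) * z‖ₑ ≤ ENNReal.ofReal (Real.exp (-|u|)) * ‖z‖ₑ := by
  rw [enorm_mul]
  gcongr
  rw [← ofReal_norm, Complex.norm_real, Real.norm_of_nonneg (expKer_nonneg _ _)]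
  exact ENNReal.ofReal_le_ofReal (expKer_le hσ u)

theorem enorm_conv_le {σ : ℝ} (hσ : |σ| = 1) (f : ℝ → ℂ) (x : ℝ) :
    ‖conv σ f x‖ₑ ≤ absConv (fun t => ‖f t‖ₑ) x :=
  (enorm_integral_le_lintegral_enorm _).trans
    (lintegral_mono fun t => enorm_expKer_mul_le hσ (x - t) (f t))

theorem stronglyMeasurable_conv (σ : ℝ) {f : ℝ → ℂ} (hf : StronglyMeasurable f) :
    StronglyMeasurable (conv σ f) := by
  have h : StronglyMeasurable fun z : ℝ × ℝ => (expKer σ (z.1 - z.2) : ℂ) * f z.2 :=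
    ((Complex.measurable_ofReal.comp ((measurable_expKer σ).comp
      (measurable_fst.sub measurable_snd))).mul (hf.measurable.comp measurable_snd)).stronglyMeasurable
  exact h.integral_prod_right (ν := volume)

theorem measurable_absConv {g : ℝ → ℝ≥0∞} (hg : Measurable g) : Measurable (absConv g) := by
  have h : Measurable fun z : ℝ × ℝ => ENNReal.ofReal (Real.exp (-|z.1 - z.2|)) * g z.2 := by
    refine Measurable.mul ?_ (hg.comp measurable_snd)
    have : Continuous fun z : ℝ × ℝ => Real.exp (-|z.1 - z.2|) := by fun_prop
    exact this.measurable.ennreal_ofReal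
  exact h.lintegral_prod_right (ν := volume)

theorem conv_congr (σ : ℝ) {f g : ℝ → ℂ} (h : f =ᵐ[volume] g) (x : ℝ) : conv σ f x = conv σ g x :=
  integral_congr_ae (by filter_upwards [h] with t ht; rw [ht])

theorem absConv_congr {f g : ℝ → ℝ≥0∞} (h : f =ᵐ[volume] g) (x : ℝ) : absConv f x = absConv g x :=
  lintegral_congr_ae (by filter_upwards [h] with t ht; rw [ht])

theorem absConv_mono {f g : ℝ → ℝ≥0∞} (h : ∀ᵐ t, f t ≤ g t) (x : ℝ) : absConv f x ≤ absConv g x :=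
  lintegral_mono_ae (by filter_upwards [h] with t ht; gcongr)

/-! ### Mass of the kernel `e^{-|u|}` and its action on `L¹ + L^∞`. -/

theorem lintegral_exp_neg_abs : ∫⁻ t : ℝ, ENNReal.ofReal (Real.exp (-|t|)) = 2 := by
  have h1 : ∫⁻ t in Ioi (0 : ℝ), ENNReal.ofReal (Real.exp (-|t|)) = 1 := by
    have : ∫⁻ t in Ioi (0 : ℝ), ENNReal.ofReal (Real.exp (-|t|)) =
        ∫⁻ t in Ioi (0 : ℝ), ENNReal.ofReal (Real.exp (-t)) :=
      setLIntegral_congr_fun measurableSet_Ioi fun t ht => by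
        rw [abs_of_pos (show (0 : ℝ) < t from ht)]
    rw [this, ← ofReal_integral_eq_lintegral_ofReal (integrableOn_exp_neg_Ioi 0)
      (ae_of_all _ fun t => (Real.exp_pos _).le), integral_exp_neg_Ioi_zero]
    simp
  have h2 : ∫⁻ t in Iic (0 : ℝ), ENNReal.ofReal (Real.exp (-|t|)) = 1 := by
    have : ∫⁻ t in Iic (0 : ℝ), ENNReal.ofReal (Real.exp (-|t|)) =
        ∫⁻ t in Iic (0 : ℝ), ENNReal.ofReal (Real.exp t) :=
      setLIntegral_congr_fun measurableSet_Iic fun t ht => by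
        rw [abs_of_nonpos (show t ≤ 0 from ht), neg_neg]
    rw [this, ← ofReal_integral_eq_lintegral_ofReal (integrableOn_exp_Iic 0)
      (ae_of_all _ fun t => (Real.exp_pos _).le), integral_exp_Iic_zero]
    simp
  rw [← lintegral_add_compl _ (measurableSet_Iic (a := (0 : ℝ))), h2, compl_Iic, h1]
  norm_num

theorem lintegral_exp_neg_abs_sub_left (x : ℝ) :
    ∫⁻ t : ℝ, ENNReal.ofReal (Real.exp (-|x - t|)) = 2 := by
  rw [lintegral_sub_left_eq_self (fun t : ℝ => ENNReal.ofReal (Real.exp (-|t|))) x]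
  exact lintegral_exp_neg_abs

theorem lintegral_exp_neg_abs_sub_right (t : ℝ) :
    ∫⁻ x : ℝ, ENNReal.ofReal (Real.exp (-|x - t|)) = 2 := by
  rw [lintegral_sub_right_eq_self (fun t : ℝ => ENNReal.ofReal (Real.exp (-|t|))) t]
  exact lintegral_exp_neg_abs

theorem measurable_expKernel (x : ℝ) :
    Measurable fun t : ℝ => ENNReal.ofReal (Real.exp (-|x - t|)) := by
  have : Continuous fun t : ℝ => Real.exp (-|x - t|) := by fun_prop
  exact this.measurable.ennreal_ofReal

theorem lintegral_absConv {g : ℝ → ℝ≥0∞} (hg : Measurable g) :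
    ∫⁻ x, absConv g x = 2 * ∫⁻ t, g t := by
  unfold absConv
  rw [lintegral_lintegral_swap]
  · rw [← lintegral_const_mul _ hg]
    refine lintegral_congr fun t => ?_
    rw [lintegral_mul_const, lintegral_exp_neg_abs_sub_right]
    have : Continuous fun x : ℝ => Real.exp (-|x - t|) := by fun_prop
    exact this.measurable.ennreal_ofReal
  · refine Measurable.aemeasurable (Measurable.mul ?_ (hg.comp measurable_snd))
    have : Continuous fun z : ℝ × ℝ => Real.exp (-|z.1 - z.2|) := by fun_prop
    exact this.measurable.ennreal_ofReal

/-- In the splitting `|f| ≤ c + (|f| - c)₊` the constant is weighed by the total mass 2 of the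
kernel, the excess by its supremum 1. Thus `absConv` is finite at every point, not only almost
everywhere, once the excess over some level is integrable; the pointwise additivity of `conv` rests
on this. -/
theorem absConv_le_of_excess {f : ℝ → ℂ} (c : ℝ≥0) (x : ℝ) :
    absConv (fun t => ‖f t‖ₑ) x ≤ 2 * c + ∫⁻ t, ENNReal.ofReal (‖f t‖ - c) := by
  have h : ∀ t, ENNReal.ofReal (Real.exp (-|x - t|)) * ‖f t‖ₑ ≤
      ENNReal.ofReal (Real.exp (-|x - t|)) * c + ENNReal.ofReal (‖f t‖ - c) := by
    intro t
    have h1 : ‖f t‖ₑ ≤ c + ENNReal.ofReal (‖f t‖ - c) := by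
      rw [← ofReal_norm, ← ENNReal.ofReal_coe_nnreal]
      refine (ENNReal.ofReal_le_ofReal ?_).trans ENNReal.ofReal_add_le
      linarith
    have h2 : ENNReal.ofReal (Real.exp (-|x - t|)) ≤ 1 := by
      rw [ENNReal.ofReal_le_one, Real.exp_le_one_iff]
      linarith [abs_nonneg (x - t)]
    calc _ ≤ ENNReal.ofReal (Real.exp (-|x - t|)) * (c + ENNReal.ofReal (‖f t‖ - c)) := by gcongr
      _ = ENNReal.ofReal (Real.exp (-|x - t|)) * c +
          ENNReal.ofReal (Real.exp (-|x - t|)) * ENNReal.ofReal (‖f t‖ - c) := mul_add _ _ _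
      _ ≤ _ := by
        gcongr
        calc _ ≤ 1 * ENNReal.ofReal (‖f t‖ - c) := by gcongr
          _ = _ := one_mul _
  refine (lintegral_mono h).trans ?_
  rw [lintegral_add_left ((measurable_expKernel x).mul_const _),
    lintegral_mul_const _ (measurable_expKernel x), lintegral_exp_neg_abs_sub_left]

theorem integrable_expKer_mul {σ : ℝ} (hσ : |σ| = 1) {f : ℝ → ℂ}
    (hf : AEStronglyMeasurable f volume) {x : ℝ} (h : absConv (fun t => ‖f t‖ₑ) x < ∞) :
    Integrable fun t => (expKer σ (x - t) : ℂ) * f t := by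
  refine ⟨?_, lt_of_le_of_lt (lintegral_mono fun t => enorm_expKer_mul_le hσ (x - t) (f t)) h⟩
  exact (Complex.measurable_ofReal.comp ((measurable_expKer σ).comp
      (measurable_const.sub measurable_id))).aestronglyMeasurable.mul hf

theorem conv_add {σ : ℝ} (hσ : |σ| = 1) {f g : ℝ → ℂ}
    (hf : AEStronglyMeasurable f volume) (hg : AEStronglyMeasurable g volume) {x : ℝ}
    (hf' : absConv (fun t => ‖f t‖ₑ) x < ∞) (hg' : absConv (fun t => ‖g t‖ₑ) x < ∞) :
    conv σ (f + g) x = conv σ f x + conv σ g x := by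
  unfold conv
  rw [← integral_add (integrable_expKer_mul hσ hf hf') (integrable_expKer_mul hσ hg hg')]
  exact integral_congr_ae (ae_of_all _ fun t => by simp [mul_add])

theorem conv_smul (σ : ℝ) (c : ℂ) (f : ℝ → ℂ) (x : ℝ) :
    conv σ (c • f) x = c * conv σ f x := by
  unfold conv
  rw [← integral_const_mul]
  exact integral_congr_ae (ae_of_all _ fun t => by simp; ring)

/-! ### Function norms for which the exponential convolutions are bounded -/

/-- A function norm on the line with the properties of the spaces considered here: its
functions lie in `L¹ + L^∞`, convolution with `e^{-|u|}` is bounded, and it contains the indicator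
function of `[0, 1]`. -/
structure IsConvBounded (N : FunNorm volume) : Prop where
  excess : ∀ f : ℝ →ₘ[volume] ℂ, N.rho f < ∞ →
    ∃ c : ℝ≥0, ∫⁻ t, ENNReal.ofReal (‖f t‖ - c) < ∞
  bound : ∃ C : ℝ≥0, ∀ f g : ℝ →ₘ[volume] ℂ, N.rho f < ∞ →
    (∀ᵐ x, ‖g x‖ₑ ≤ absConv (fun t => ‖f t‖ₑ) x) → N.rho g ≤ C * N.rho f
  indicator : ∀ f : ℝ →ₘ[volume] ℂ, (f =ᵐ[volume] (Icc (0 : ℝ) 1).indicator 1) → N.rho f < ∞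

theorem IsConvBounded.absConv_lt_top {N : FunNorm volume} (hN : IsConvBounded N) {f : ℝ →ₘ[volume] ℂ}
    (hf : N.rho f < ∞) (x : ℝ) : absConv (fun t => ‖f t‖ₑ) x < ∞ := by
  obtain ⟨c, hc⟩ := hN.excess f hf
  refine lt_of_le_of_lt (absConv_le_of_excess c x) (ENNReal.add_lt_top.2 ⟨?_, hc⟩)
  exact ENNReal.mul_lt_top (by simp) (by simp)

/-- The convolution with the exponential kernel as a map on a.e. classes. -/
def convAE (σ : ℝ) (f : ℝ →ₘ[volume] ℂ) : ℝ →ₘ[volume] ℂ :=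
  AEEqFun.mk (conv σ f) (stronglyMeasurable_conv σ f.stronglyMeasurable).aestronglyMeasurable

theorem coeFn_convAE (σ : ℝ) (f : ℝ →ₘ[volume] ℂ) : convAE σ f =ᵐ[volume] conv σ f :=
  AEEqFun.coeFn_mk _ _

theorem enorm_convAE_le {σ : ℝ} (hσ : |σ| = 1) (f : ℝ →ₘ[volume] ℂ) :
    ∀ᵐ x, ‖convAE σ f x‖ₑ ≤ absConv (fun t => ‖f t‖ₑ) x := by
  filter_upwards [coeFn_convAE σ f] with x hx
  rw [hx]
  exact enorm_conv_le hσ f x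

theorem IsConvBounded.rho_convAE_lt_top {N : FunNorm volume} (hN : IsConvBounded N) {σ : ℝ} (hσ : |σ| = 1)
    {f : ℝ →ₘ[volume] ℂ} (hf : N.rho f < ∞) : N.rho (convAE σ f) < ∞ := by
  obtain ⟨C, hC⟩ := hN.bound
  exact lt_of_le_of_lt (hC f _ hf (enorm_convAE_le hσ f)) (ENNReal.mul_lt_top (by simp) hf)

theorem IsConvBounded.convAE_add {N : FunNorm volume} (hN : IsConvBounded N) {σ : ℝ} (hσ : |σ| = 1)
    {f g : ℝ →ₘ[volume] ℂ} (hf : N.rho f < ∞) (hg : N.rho g < ∞) :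
    convAE σ (f + g) = convAE σ f + convAE σ g := by
  apply AEEqFun.ext
  filter_upwards [coeFn_convAE σ (f + g), coeFn_convAE σ f, coeFn_convAE σ g,
    AEEqFun.coeFn_add (convAE σ f) (convAE σ g)] with x h1 h2 h3 h4
  rw [h1, h4, Pi.add_apply, h2, h3, conv_congr σ (AEEqFun.coeFn_add f g),
    conv_add hσ f.aestronglyMeasurable g.aestronglyMeasurable (hN.absConv_lt_top hf x)
      (hN.absConv_lt_top hg x)]

theorem convAE_smul (σ : ℝ) (c : ℂ) (f : ℝ →ₘ[volume] ℂ) :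
    convAE σ (c • f) = c • convAE σ f := by
  apply AEEqFun.ext
  filter_upwards [coeFn_convAE σ (c • f), coeFn_convAE σ f,
    AEEqFun.coeFn_smul c (convAE σ f)] with x h1 h2 h3
  rw [h1, h3, Pi.smul_apply, h2, conv_congr σ (AEEqFun.coeFn_smul c f), conv_smul, smul_eq_mul]

/-- The convolution operator as a bounded operator. -/
def IsConvBounded.convOp {N : FunNorm volume} (hN : IsConvBounded N) {σ : ℝ} (hσ : |σ| = 1) :
    N.Space →L[ℂ] N.Space :=
  LinearMap.mkContinuousOfExistsBound
    { toFun := fun f => N.toSpace (convAE σ (N.incl f))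
        (hN.rho_convAE_lt_top hσ (N.rho_incl_lt_top f))
      map_add' := fun f g => N.incl_injective (by
        simp [hN.convAE_add hσ (N.rho_incl_lt_top f) (N.rho_incl_lt_top g)])
      map_smul' := fun c f => N.incl_injective (by simp [convAE_smul]) }
    (by
      obtain ⟨C, hC⟩ := hN.bound
      refine ⟨C, fun f => ?_⟩
      have h := hC (N.incl f) _ (N.rho_incl_lt_top f) (enorm_convAE_le hσ _)
      have h' := ENNReal.toReal_mono
        (ENNReal.mul_lt_top ENNReal.coe_lt_top (N.rho_incl_lt_top f)).ne h
      rwa [ENNReal.toReal_mul] at h')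

theorem IsConvBounded.incl_convOp {N : FunNorm volume} (hN : IsConvBounded N) {σ : ℝ} (hσ : |σ| = 1)
    (f : N.Space) : N.incl (hN.convOp hσ f) = convAE σ (N.incl f) := rfl

/-- The operator `1 - 2 K_σ`, where `K_σ` is the convolution with the exponential kernel. -/
def IsConvBounded.shift {N : FunNorm volume} (hN : IsConvBounded N) {σ : ℝ} (hσ : |σ| = 1) :
    N.Space →L[ℂ] N.Space := 1 - (2 : ℂ) • hN.convOp hσ

theorem IsConvBounded.incl_shift {N : FunNorm volume} (hN : IsConvBounded N) {σ : ℝ} (hσ : |σ| = 1)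
    (f : N.Space) : N.incl (hN.shift hσ f) = N.incl f - (2 : ℂ) • convAE σ (N.incl f) := by
  simp [IsConvBounded.shift, hN.incl_convOp]

theorem IsConvBounded.coeFn_shift {N : FunNorm volume} (hN : IsConvBounded N) {σ : ℝ} (hσ : |σ| = 1)
    (f : N.Space) :
    N.incl (hN.shift hσ f) =ᵐ[volume] fun x => N.incl f x - 2 * conv σ (N.incl f) x := by
  rw [hN.incl_shift]
  filter_upwards [AEEqFun.coeFn_sub (N.incl f) ((2 : ℂ) • convAE σ (N.incl f)),
    AEEqFun.coeFn_smul (2 : ℂ) (convAE σ (N.incl f)), coeFn_convAE σ (N.incl f)] with x h1 h2 h3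
  rw [h1, Pi.sub_apply, h2, Pi.smul_apply, h3, smul_eq_mul]

/-! ### The exponential convolutions on `L²` and the Fourier transform -/

/-- Cauchy-Schwarz for the measure `e^{-|x-t|} dt`, whose total mass 2 is the factor on the right.
-/
theorem absConv_sq_le {g : ℝ → ℝ≥0∞} (hg : Measurable g) (x : ℝ) :
    absConv g x ^ (2 : ℝ) ≤ 2 * absConv (fun t => g t ^ (2 : ℝ)) x := by
  set ν : Measure ℝ := volume.withDensity fun t => ENNReal.ofReal (Real.exp (-|x - t|)) with hν
  have key : ∀ h : ℝ → ℝ≥0∞, Measurable h → ∫⁻ t, h t ∂ν = absConv h x := fun h hh => by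
    rw [hν, lintegral_withDensity_eq_lintegral_mul _ (measurable_expKernel x) hh]
    rfl
  have h1 := ENNReal.lintegral_mul_le_Lp_mul_Lq ν (p := 2) (q := 2)
    (by constructor <;> norm_num) (f := fun _ => 1) (g := g) aemeasurable_const hg.aemeasurable
  have h2 : ∫⁻ _ : ℝ, (1 : ℝ≥0∞) ∂ν = 2 := by
    rw [key _ measurable_const]
    simpa [absConv] using lintegral_exp_neg_abs_sub_left x
  simp only [Pi.mul_apply, one_mul, ENNReal.one_rpow] at h1
  rw [h2, key _ hg, key _ (hg.pow_const _)] at h1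
  calc absConv g x ^ (2 : ℝ)
      ≤ (2 ^ (1 / 2 : ℝ) * absConv (fun t => g t ^ (2 : ℝ)) x ^ (1 / 2 : ℝ)) ^ (2 : ℝ) := by gcongr
    _ = _ := by
      rw [ENNReal.mul_rpow_of_nonneg _ _ (by norm_num), ← ENNReal.rpow_mul, ← ENNReal.rpow_mul]
      norm_num

theorem lintegral_absConv_sq_le {g : ℝ → ℝ≥0∞} (hg : Measurable g) :
    ∫⁻ x, absConv g x ^ (2 : ℝ) ≤ 4 * ∫⁻ t, g t ^ (2 : ℝ) := by
  refine (lintegral_mono (absConv_sq_le hg)).trans ?_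
  rw [lintegral_const_mul _ (measurable_absConv (hg.pow_const _)),
    lintegral_absConv (hg.pow_const _), ← mul_assoc]
  norm_num

theorem lintegral_sq_lt_top {f : ℝ → ℂ} (hf : MemLp f 2 volume) :
    ∫⁻ t, ‖f t‖ₑ ^ (2 : ℝ) < ∞ := by
  simpa using lintegral_rpow_enorm_lt_top_of_eLpNorm_lt_top (by simp) (by simp) hf.2

theorem lintegral_absConv_enorm_sq_lt_top {f : ℝ → ℂ} (hf : MemLp f 2 volume) :
    ∫⁻ x, absConv (fun t => ‖f t‖ₑ) x ^ (2 : ℝ) < ∞ := by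
  set f' := hf.1.mk f
  have h : f =ᵐ[volume] f' := hf.1.ae_eq_mk
  have h' : (fun t => ‖f t‖ₑ) =ᵐ[volume] fun t => ‖f' t‖ₑ := by
    filter_upwards [h] with t ht; rw [ht]
  simp_rw [absConv_congr h']
  refine lt_of_le_of_lt
    (lintegral_absConv_sq_le hf.1.stronglyMeasurable_mk.measurable.enorm) ?_
  exact ENNReal.mul_lt_top (by simp) (lintegral_sq_lt_top (hf.ae_eq h))

theorem memLp_conv {σ : ℝ} (hσ : |σ| = 1) {f : ℝ → ℂ} (hf : MemLp f 2 volume) :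
    MemLp (conv σ f) 2 volume := by
  constructor
  · have h : conv σ f = conv σ (hf.1.mk f) := funext (conv_congr σ hf.1.ae_eq_mk)
    rw [h]
    exact (stronglyMeasurable_conv σ hf.1.stronglyMeasurable_mk).aestronglyMeasurable
  · rw [eLpNorm_lt_top_iff_lintegral_rpow_enorm_lt_top (by simp) (by simp)]
    refine lt_of_le_of_lt (lintegral_mono fun x => ?_) (lintegral_absConv_enorm_sq_lt_top hf)
    simp only [ENNReal.toReal_ofNat]
    gcongr
    exact enorm_conv_le hσ f x

theorem expKer_neg (σ u : ℝ) : expKer (-σ) (-u) = expKer σ u := by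
  simp [expKer]

/-- Fubini and the reflection `expKer_neg`: for the bilinear pairing the transpose of `K_σ` is
`K_{-σ}`. This moves the convolution from an `L²` function to a test function. -/
theorem integral_conv_mul {σ : ℝ} (hσ : |σ| = 1) {f g : ℝ → ℂ} (hf : MemLp f 2 volume)
    (hg : MemLp g 2 volume) :
    ∫ x, conv σ f x * g x = ∫ t, f t * conv (-σ) g t := by
  have hm : AEStronglyMeasurable
      (fun z : ℝ × ℝ => (expKer σ (z.1 - z.2) : ℂ) * f z.2 * g z.1) (volume.prod volume) :=
    ((Complex.measurable_ofReal.comp ((measurable_expKer σ).comp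
      (measurable_fst.sub measurable_snd))).aestronglyMeasurable.mul hf.1.comp_snd).mul
      hg.1.comp_fst
  have hint : Integrable (fun z : ℝ × ℝ => (expKer σ (z.1 - z.2) : ℂ) * f z.2 * g z.1)
      (volume.prod volume) := by
    refine ⟨hm, ?_⟩
    rw [HasFiniteIntegral, lintegral_prod _ hm.enorm]
    -- Absolute integrability of the double integral comes from `ab ≤ a² + b²`, applied to `absConv
    -- |f|` and `|g|`, both in `L²`.
    have h1 : ∀ x, ∫⁻ t, ‖(expKer σ (x - t) : ℂ) * f t * g x‖ₑ ≤
        absConv (fun t => ‖f t‖ₑ) x ^ (2 : ℝ) + ‖g x‖ₑ ^ (2 : ℝ) := by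
      intro x
      simp_rw [enorm_mul _ (g x)]
      rw [lintegral_mul_const' _ _ enorm_ne_top]
      refine le_trans (mul_le_mul_left (lintegral_mono fun t =>
        enorm_expKer_mul_le hσ (x - t) (f t)) _) ?_
      change absConv (fun t => ‖f t‖ₑ) x * ‖g x‖ₑ ≤ _
      rw [ENNReal.rpow_two, ENNReal.rpow_two, sq, sq]
      rcases le_total (absConv (fun t => ‖f t‖ₑ) x) ‖g x‖ₑ with h | h
      · exact (mul_le_mul_left h _).trans le_add_self
      · exact (mul_le_mul_right h _).trans le_self_add
    refine lt_of_le_of_lt (lintegral_mono h1) ?_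
    rw [lintegral_add_right' _ (hg.1.enorm.pow_const _)]
    exact ENNReal.add_lt_top.2 ⟨lintegral_absConv_enorm_sq_lt_top hf, lintegral_sq_lt_top hg⟩
  calc ∫ x, conv σ f x * g x = ∫ x, ∫ t, (expKer σ (x - t) : ℂ) * f t * g x :=
        integral_congr_ae (ae_of_all _ fun x => (integral_mul_const _ _).symm)
    _ = ∫ t, ∫ x, (expKer σ (x - t) : ℂ) * f t * g x := integral_integral_swap hint
    _ = _ := integral_congr_ae (ae_of_all _ fun t => by
        simp only [conv]
        rw [← integral_const_mul]
        refine integral_congr_ae (ae_of_all _ fun x => ?_)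
        have : expKer (-σ) (t - x) = expKer σ (x - t) := by rw [← expKer_neg σ (x - t), neg_sub]
        simp only [this]
        ring)

-- `K_{-σ}` inverts the operator `1 - σ d/dx`: on the half-line where the kernel lives, the
-- integrand is up to sign the derivative of `e^{-σ(x-t)} ψ(x)`, and `ψ` vanishes at infinity.
open scoped SchwartzMap in
theorem conv_schwartz {σ : ℝ} (hσ : |σ| = 1) (ψ : 𝓢(ℝ, ℂ)) (t : ℝ) :
    conv (-σ) (fun x => ψ x - σ * deriv ψ x) t = ψ t := by
  have hd : ∀ x, HasDerivAt ψ (deriv ψ x) x := fun x => ψ.differentiable.differentiableAt.hasDerivAt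
  have hint : Integrable fun x => ψ x - σ * deriv ψ x :=
    ψ.integrable.sub ((SchwartzMap.derivCLM ℝ ℂ ψ).integrable.const_mul _)
  have hfin : absConv (fun x => ‖ψ x - σ * deriv ψ x‖ₑ) t < ∞ := by
    refine lt_of_le_of_lt (absConv_le_of_excess (f := fun x => ψ x - σ * deriv ψ x) 0 t) ?_
    simp only [NNReal.coe_zero, sub_zero, ofReal_norm, ENNReal.coe_zero, mul_zero, zero_add]
    exact hint.2
  have hk := integrable_expKer_mul (σ := -σ) (by rwa [abs_neg]) hint.1 hfin
  have hE : ∀ a x : ℝ, HasDerivAt (fun x : ℝ => (Real.exp (a * (x - t)) : ℂ))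
      (a * Real.exp (a * (x - t)) : ℝ) x := fun a x => by
    have : HasDerivAt (fun x : ℝ => Real.exp (a * (x - t))) (a * Real.exp (a * (x - t))) x := by
      have := (((hasDerivAt_id x).sub_const t).const_mul a).exp
      simpa [mul_comm] using this
    exact this.ofReal_comp
  have hlim : Tendsto ψ (cocompact ℝ) (𝓝 0) := ψ.toZeroAtInfty.zero_at_infty'
  have hbd : ∀ (a : ℝ) (l : Filter ℝ), l ≤ cocompact ℝ → (∀ᶠ x in l, a * (x - t) ≤ 0) →
      Tendsto (fun x : ℝ => (Real.exp (a * (x - t)) : ℂ) * ψ x) l (𝓝 0) := by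
    intro a l hl h
    refine squeeze_zero_norm' ?_ (tendsto_zero_iff_norm_tendsto_zero.1 (hlim.mono_left hl))
    filter_upwards [h] with x hx
    rw [norm_mul, Complex.norm_real, Real.norm_of_nonneg (Real.exp_pos _).le]
    exact mul_le_of_le_one_left (norm_nonneg _) (Real.exp_le_one_iff.2 hx)
  rcases eq_or_eq_neg_of_abs_eq hσ with rfl | rfl
  · have h1 : (fun x : ℝ => (expKer (-1) (t - x) : ℂ) * (ψ x - (1 : ℝ) * deriv ψ x)) =
        (Ioi t).indicator fun x => (Real.exp (-1 * (x - t)) : ℂ) * (ψ x - deriv ψ x) := by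
      funext x
      by_cases hx : t < x
      · rw [indicator_of_mem (show x ∈ Ioi t from hx), expKer, if_pos (by linarith)]
        simp
      · rw [indicator_of_notMem (show x ∉ Ioi t from hx), expKer, if_neg (by linarith)]
        simp
    rw [h1, integrable_indicator_iff measurableSet_Ioi] at hk
    rw [conv, h1, integral_indicator measurableSet_Ioi,
      integral_Ioi_of_hasDerivAt_of_tendsto'
        (f := fun x => -((Real.exp (-1 * (x - t)) : ℂ) * ψ x)) (m := 0) ?_ hk ?_]
    · simp
    · intro x _
      refine ((hE (-1) x).mul (hd x)).neg.congr_deriv ?_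
      push_cast; ring
    · rw [← neg_zero]
      refine (hbd (-1) atTop atTop_le_cocompact ?_).neg
      filter_upwards [eventually_ge_atTop t] with x hx
      linarith
  · have h1 : (fun x : ℝ => (expKer (- -1) (t - x) : ℂ) * (ψ x - (-1 : ℝ) * deriv ψ x)) =
        (Iio t).indicator fun x => (Real.exp (1 * (x - t)) : ℂ) * (ψ x + deriv ψ x) := by
      funext x
      by_cases hx : x < t
      · rw [indicator_of_mem (show x ∈ Iio t from hx), expKer, if_pos (by linarith)]
        simp
      · rw [indicator_of_notMem (show x ∉ Iio t from hx), expKer, if_neg (by linarith)]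
        simp
    rw [h1, integrable_indicator_iff measurableSet_Iio, ← integrableOn_Iic_iff_integrableOn_Iio]
      at hk
    rw [conv, h1, integral_indicator measurableSet_Iio, ← integral_Iic_eq_integral_Iio,
      integral_Iic_of_hasDerivAt_of_tendsto'
        (f := fun x => ((Real.exp (1 * (x - t)) : ℂ) * ψ x)) (m := 0) ?_ hk ?_]
    · simp
    · intro x _
      refine ((hE 1 x).mul (hd x)).congr_deriv ?_
      push_cast; ring
    · refine hbd 1 atBot atBot_le_cocompact ?_
      filter_upwards [eventually_le_atBot t] with x hx
      linarith

open scoped SchwartzMap in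
/-- The Fourier transform on `L²` is self-adjoint with respect to the bilinear pairing. -/
theorem integral_mul_fourier (f : Lp ℂ 2 (volume : Measure ℝ)) (φ : 𝓢(ℝ, ℂ)) :
    ∫ x, φ x * (𝓕 f : Lp ℂ 2 (volume : Measure ℝ)) x = ∫ x, (𝓕 φ) x * f x := by
  have h := DFunLike.congr_fun (Lp.fourier_toTemperedDistribution_eq f) φ
  rw [TemperedDistribution.fourier_apply, Lp.toTemperedDistribution_apply,
    Lp.toTemperedDistribution_apply] at h
  exact h.symm

theorem locallyIntegrable_Lp_two (f : Lp ℂ 2 (volume : Measure ℝ)) :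
    LocallyIntegrable f volume :=
  (Lp.memLp f).locallyIntegrable (by norm_num)

open scoped SchwartzMap ContDiff in
theorem ae_eq_of_integral_schwartz {f g : ℝ → ℂ} (hf : LocallyIntegrable f volume)
    (hg : LocallyIntegrable g volume)
    (h : ∀ φ : 𝓢(ℝ, ℂ), ∫ x, φ x * f x = ∫ x, φ x * g x) : f =ᵐ[volume] g := by
  refine ae_eq_of_integral_contDiff_smul_eq hf hg fun u hu hu' => ?_
  have h1 : ContDiff ℝ ∞ fun x => (u x : ℂ) := Complex.ofRealCLM.contDiff.comp hu
  have h2 : HasCompactSupport fun x => (u x : ℂ) := hu'.comp_left Complex.ofReal_zero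
  have := h (h2.toSchwartzMap h1)
  simpa [Complex.real_smul] using this

-- By duality with Schwartz functions. Multiplication of a test function by `1 + 2πiσw` becomes `1 -
-- σ d/dx` after `𝓕`, and `K_{-σ}`, the transpose of `K_σ`, undoes that operator by `conv_schwartz`.
open scoped SchwartzMap in
theorem fourier_conv {σ : ℝ} (hσ : |σ| = 1) (f y : Lp ℂ 2 (volume : Measure ℝ))
    (hy : y =ᵐ[volume] conv σ f) :
    (fun w : ℝ => (1 + σ * (2 * Real.pi * Complex.I * w)) *
      (𝓕 y : Lp ℂ 2 (volume : Measure ℝ)) w) =ᵐ[volume] (𝓕 f : Lp ℂ 2 (volume : Measure ℝ)) := by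
  refine ae_eq_of_integral_schwartz ?_ (locallyIntegrable_Lp_two _) fun φ => ?_
  · exact (locallyIntegrable_Lp_two _).continuous_mul (by fun_prop)
  -- The factor `1 + 2πiσw` is absorbed into the test function, which stays Schwartz.
  set χ : 𝓢(ℝ, ℂ) := φ + (σ * (2 * Real.pi * Complex.I)) •
    SchwartzMap.smulLeftCLM ℂ (fun w : ℝ => inner ℝ w (1 : ℝ)) φ with hχ
  have htg : (fun w : ℝ => inner ℝ w (1 : ℝ)).HasTemperateGrowth := by fun_prop
  have hχa : ∀ w, χ w = φ w * (1 + σ * (2 * Real.pi * Complex.I * w)) := by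
    intro w
    simp only [hχ, add_apply, smul_apply,
      SchwartzMap.smulLeftCLM_apply_apply htg]
    simp
    ring
  have hFχ : ∀ x, (𝓕 χ : 𝓢(ℝ, ℂ)) x = (𝓕 φ : 𝓢(ℝ, ℂ)) x - σ * deriv (𝓕 φ : 𝓢(ℝ, ℂ)) x := by
    intro x
    have h1 := SchwartzMap.lineDerivOp_fourier_eq φ (1 : ℝ)
    have h2 : 𝓕 χ = 𝓕 φ - (σ : ℂ) • LineDeriv.lineDerivOp (1 : ℝ) (𝓕 φ) := by
      rw [h1, hχ, FourierTransform.fourier_add, FourierTransform.fourier_smul,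
        FourierTransform.fourier_smul, smul_smul, sub_eq_add_neg, ← neg_smul]
      congr 2
      ring
    rw [h2, sub_apply, smul_apply, smul_eq_mul]
    congr 2
  calc ∫ w, φ w * ((1 + σ * (2 * Real.pi * Complex.I * w)) *
      (𝓕 y : Lp ℂ 2 (volume : Measure ℝ)) w)
      = ∫ w, χ w * (𝓕 y : Lp ℂ 2 (volume : Measure ℝ)) w := by
        refine integral_congr_ae (ae_of_all _ fun w => ?_)
        simp only [hχa]; ring
    _ = ∫ x, (𝓕 χ) x * y x := integral_mul_fourier y χ
    _ = ∫ x, conv σ f x * (𝓕 χ) x := by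
        refine integral_congr_ae ?_
        filter_upwards [hy] with x hx
        rw [hx, mul_comm]
    _ = ∫ t, f t * conv (-σ) (𝓕 χ : 𝓢(ℝ, ℂ)) t :=
        integral_conv_mul hσ (Lp.memLp f) ((𝓕 χ).memLp 2 volume)
    _ = ∫ t, f t * (𝓕 φ) t := by
        refine integral_congr_ae (ae_of_all _ fun t => ?_)
        have : ((𝓕 χ : 𝓢(ℝ, ℂ)) : ℝ → ℂ) =
            fun x => (𝓕 φ : 𝓢(ℝ, ℂ)) x - σ * deriv (𝓕 φ : 𝓢(ℝ, ℂ)) x := funext hFχ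
        simp only [this, conv_schwartz hσ (𝓕 φ) t]
    _ = ∫ x, (𝓕 φ) x * f x := by simp_rw [mul_comm]
    _ = _ := (integral_mul_fourier f φ).symm

/-! ### Fourier inversion in the normalisation `e^{iξx}`. -/

theorem ae_comp_mul {p : ℝ → Prop} (h : ∀ᵐ x, p x) {c : ℝ} (hc : c ≠ 0) : ∀ᵐ x, p (c * x) := by
  have hq : Measure.QuasiMeasurePreserving (fun x : ℝ => c * x) volume volume := by
    refine ⟨measurable_const_mul c, ?_⟩
    rw [Real.map_volume_mul_left hc]
    exact Measure.smul_absolutelyContinuous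
  exact hq.ae h

theorem coeFn_fourierL2 (f : Lp ℂ 2 (volume : Measure ℝ)) :
    fourierL2 f =ᵐ[volume] fun ξ =>
      (𝓕 f : Lp ℂ 2 (volume : Measure ℝ)) (-(2 * Real.pi)⁻¹ * ξ) :=
  MemLp.coeFn_toLp _

theorem coeFn_fourierInvL2 (g : Lp ℂ 2 (volume : Measure ℝ)) :
    fourierInvL2 g =ᵐ[volume] fun x => ((2 * Real.pi)⁻¹ : ℂ) *
      (𝓕 g : Lp ℂ 2 (volume : Measure ℝ)) ((2 * Real.pi)⁻¹ * x) := by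
  filter_upwards [MemLp.coeFn_toLp ((memLp_comp_mul (Lp.memLp (fourierL2 g))
    (show (-1 : ℝ) ≠ 0 by norm_num)).const_mul ((2 * Real.pi)⁻¹ : ℂ)),
    ae_comp_mul (coeFn_fourierL2 g) (show (-1 : ℝ) ≠ 0 by norm_num)] with x h1 h2
  rw [fourierInvL2, h1, h2]
  congr 2
  ring

-- The substitution `x ↦ 2πx` cancels the factor `2π` in the exponent, and the sign of the frequency
-- exchanges `𝓕` with `𝓕⁻`. This is how the change of normalisation passes through the inversion
-- formula.
open scoped SchwartzMap in
theorem fourier_dilation (φ φ₁ : 𝓢(ℝ, ℂ)) (h : ∀ x, φ₁ x = φ (2 * Real.pi * x)) (w : ℝ) :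
    (2 * Real.pi : ℂ) * (𝓕 φ₁ : 𝓢(ℝ, ℂ)) (-(2 * Real.pi) * w) = (𝓕⁻ φ : 𝓢(ℝ, ℂ)) w := by
  rw [SchwartzMap.fourier_coe, SchwartzMap.fourierInv_coe, Real.fourier_eq', Real.fourierInv_eq']
  have h1 := Measure.integral_comp_mul_left (fun x : ℝ =>
    Complex.exp (((2 * Real.pi * inner ℝ x w : ℝ) : ℂ) * Complex.I) • φ x) (2 * Real.pi)
  have hpi := Real.pi_pos
  rw [abs_of_pos (by positivity)] at h1
  have h2 : (2 * Real.pi : ℂ) * ((2 * Real.pi)⁻¹ • ∫ x : ℝ,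
    Complex.exp (((2 * Real.pi * inner ℝ x w : ℝ) : ℂ) * Complex.I) • φ x : ℂ) = ∫ x : ℝ,
    Complex.exp (((2 * Real.pi * inner ℝ x w : ℝ) : ℂ) * Complex.I) • φ x := by
    rw [Complex.real_smul]
    push_cast
    rw [← mul_assoc, mul_inv_cancel₀, one_mul]
    exact_mod_cast (by positivity : (2 * Real.pi) ≠ 0)
  rw [← h2, ← h1]
  congr 1
  refine integral_congr_ae (ae_of_all _ fun x => ?_)
  simp only [h]
  congr 4
  simp
  ring

-- Tested against Schwartz functions, the dilations in `fourierL2` and `fourierInvL2` are moved onto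
-- the test function; the symmetry of `𝓕` under the bilinear pairing then reduces the claim to
-- inversion for Schwartz functions.
open scoped SchwartzMap in
theorem fourierInvL2_fourierL2 (g : Lp ℂ 2 (volume : Measure ℝ)) :
    fourierInvL2 (fourierL2 g) = g := by
  have hpi : 0 < 2 * Real.pi := by positivity
  have hpi' : (2 * Real.pi : ℂ) ≠ 0 := by exact_mod_cast hpi.ne'
  refine Lp.ext (ae_eq_of_integral_schwartz (locallyIntegrable_Lp_two _)
    (locallyIntegrable_Lp_two _) fun φ => ?_)
  set h := fourierL2 g with hh
  let e : ℝ ≃L[ℝ] ℝ := ContinuousLinearEquiv.unitsEquivAut ℝ (Units.mk0 (2 * Real.pi) hpi.ne')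
  set φ₁ : 𝓢(ℝ, ℂ) := SchwartzMap.compCLMOfContinuousLinearEquiv ℝ e φ with hφ₁
  have hφ₁a : ∀ x, φ₁ x = φ (2 * Real.pi * x) := by
    intro x
    simp [hφ₁, e, mul_comm]
  have s1 : ∫ x, φ x * fourierInvL2 h x =
      ∫ x, ((2 * Real.pi)⁻¹ : ℂ) * (φ₁ ((2 * Real.pi)⁻¹ * x) *
        (𝓕 h : Lp ℂ 2 (volume : Measure ℝ)) ((2 * Real.pi)⁻¹ * x)) := by
    refine integral_congr_ae ?_
    filter_upwards [coeFn_fourierInvL2 h] with x hx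
    rw [hx, hφ₁a, mul_inv_cancel_left₀ hpi.ne']
    ring
  have s2 : ∫ x, φ x * fourierInvL2 h x =
      ∫ w, φ₁ w * (𝓕 h : Lp ℂ 2 (volume : Measure ℝ)) w := by
    rw [s1, integral_const_mul, Measure.integral_comp_mul_left (fun w =>
      φ₁ w * (𝓕 h : Lp ℂ 2 (volume : Measure ℝ)) w), inv_inv, abs_of_pos hpi, Complex.real_smul]
    push_cast
    rw [inv_mul_cancel_left₀ hpi']
  have s3 : ∫ x, (𝓕 φ₁ : 𝓢(ℝ, ℂ)) x * h x =
      ∫ w, (2 * Real.pi : ℂ)⁻¹ * ((𝓕⁻ φ : 𝓢(ℝ, ℂ)) (-(2 * Real.pi)⁻¹ * w) *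
        (𝓕 g : Lp ℂ 2 (volume : Measure ℝ)) (-(2 * Real.pi)⁻¹ * w)) := by
    refine integral_congr_ae ?_
    filter_upwards [coeFn_fourierL2 g] with x hx
    rw [hh, hx, ← fourier_dilation φ φ₁ hφ₁a]
    have : -(2 * Real.pi) * (-(2 * Real.pi)⁻¹ * x) = x := by field_simp
    rw [this]
    field_simp
  have s4 : ∫ x, (𝓕 φ₁ : 𝓢(ℝ, ℂ)) x * h x =
      ∫ w, (𝓕⁻ φ : 𝓢(ℝ, ℂ)) w * (𝓕 g : Lp ℂ 2 (volume : Measure ℝ)) w := by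
    rw [s3, integral_const_mul, Measure.integral_comp_mul_left (fun w =>
      (𝓕⁻ φ : 𝓢(ℝ, ℂ)) w * (𝓕 g : Lp ℂ 2 (volume : Measure ℝ)) w), inv_neg, inv_inv, abs_neg,
      abs_of_pos hpi, Complex.real_smul]
    push_cast
    rw [inv_mul_cancel_left₀ hpi']
  rw [s2, integral_mul_fourier, s4, integral_mul_fourier, FourierTransform.fourier_fourierInv_eq]

/-! ### The symbols `r k` and the multipliers of `1 - 2K_σ`. -/

theorem add_I_ne_zero (ξ : ℝ) : (ξ : ℂ) + Complex.I ≠ 0 := fun h => by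
  simpa using congrArg Complex.im h

theorem sub_I_ne_zero (ξ : ℝ) : (ξ : ℂ) - Complex.I ≠ 0 := fun h => by
  simpa using congrArg Complex.im h

theorem norm_r (k : ℤ) (ξ : ℝ) : ‖r k ξ‖ = 1 := by
  have h : ‖(ξ : ℂ) - Complex.I‖ = ‖(ξ : ℂ) + Complex.I‖ := by
    rw [← Complex.norm_conj]; simp
  rw [r, norm_zpow, norm_div, h, div_self (norm_ne_zero_iff.2 (add_I_ne_zero ξ)), one_zpow]

theorem memLp_r (k : ℤ) : MemLp (r k) ∞ (volume : Measure ℝ) := by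
  refine memLp_top_of_bound ?_ 1 (ae_of_all _ fun ξ => (norm_r k ξ).le)
  have : Measurable (r k) := by
    unfold r
    exact (((Complex.measurable_ofReal.sub_const _).div
      (Complex.measurable_ofReal.add_const _)).pow_const k)
  exact this.aestronglyMeasurable

theorem r_add (j k : ℤ) (ξ : ℝ) : r (j + k) ξ = r j ξ * r k ξ := by
  unfold r
  exact zpow_add₀ (div_ne_zero (sub_I_ne_zero ξ) (add_I_ne_zero ξ)) j k

/-- This is `1 - 2/(1 - iξ) = (ξ - i)/(ξ + i)` and its conjugate, the reason for the operator `1 -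
2K_σ`. In the application `v` is the transform of a function and `z` that of its convolution. -/
theorem one_sub_two_div {s : ℤ} (hs : |(s : ℝ)| = 1) (ξ : ℝ) {z v : ℂ}
    (h : (1 - s * (Complex.I * ξ)) * z = v) : v - 2 * z = r s ξ * v := by
  have hI := Complex.I_mul_I
  rcases eq_or_eq_neg_of_abs_eq hs with h1 | h1
  · obtain rfl : s = 1 := by exact_mod_cast h1
    have h0 := add_I_ne_zero ξ
    rw [r, zpow_one, ← h]
    field_simp
    push_cast
    linear_combination (-2 * z * ξ) * hI
  · obtain rfl : s = -1 := by exact_mod_cast h1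
    have h0 := sub_I_ne_zero ξ
    rw [r, zpow_neg_one, inv_div, ← h]
    field_simp
    push_cast
    linear_combination (-2 * z * ξ) * hI

theorem fourierL2_shift {s : ℤ} (hs : |(s : ℝ)| = 1) (f y : Lp ℂ 2 (volume : Measure ℝ))
    (hy : y =ᵐ[volume] fun x => f x - 2 * conv s f x) :
    fourierL2 y =ᵐ[volume] fun ξ => r s ξ * fourierL2 f ξ := by
  have hpi : 0 < 2 * Real.pi := by positivity
  have hpi' : (2 * Real.pi : ℂ) ≠ 0 := by exact_mod_cast hpi.ne'
  have hc : -(2 * Real.pi)⁻¹ ≠ 0 := neg_ne_zero.2 (inv_ne_zero hpi.ne')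
  set K : Lp ℂ 2 (volume : Measure ℝ) := (memLp_conv hs (Lp.memLp f)).toLp with hK
  have hKa : K =ᵐ[volume] conv s f := MemLp.coeFn_toLp _
  have hyK : y = f - (2 : ℂ) • K := by
    refine Lp.ext ?_
    filter_upwards [hy, hKa, Lp.coeFn_sub f ((2 : ℂ) • K), Lp.coeFn_smul (2 : ℂ) K]
      with x h1 h2 h3 h4
    rw [h1, h3, Pi.sub_apply, h4, Pi.smul_apply, h2, smul_eq_mul]
  have hF : (𝓕 y : Lp ℂ 2 (volume : Measure ℝ)) = 𝓕 f - (2 : ℂ) • 𝓕 K := by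
    rw [hyK, sub_eq_add_neg, ← neg_smul, FourierTransform.fourier_add,
      FourierTransform.fourier_smul, neg_smul, ← sub_eq_add_neg]
  have hFa : (𝓕 y : Lp ℂ 2 (volume : Measure ℝ)) =ᵐ[volume]
      fun w => (𝓕 f : Lp ℂ 2 (volume : Measure ℝ)) w -
        2 * (𝓕 K : Lp ℂ 2 (volume : Measure ℝ)) w := by
    rw [hF]
    filter_upwards [Lp.coeFn_sub (𝓕 f : Lp ℂ 2 (volume : Measure ℝ)) ((2 : ℂ) • 𝓕 K),
      Lp.coeFn_smul (2 : ℂ) (𝓕 K : Lp ℂ 2 (volume : Measure ℝ))] with x h1 h2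
    rw [h1, Pi.sub_apply, h2, Pi.smul_apply, smul_eq_mul]
  filter_upwards [coeFn_fourierL2 y, coeFn_fourierL2 f, ae_comp_mul hFa hc,
    ae_comp_mul (fourier_conv hs f K hKa) hc] with ξ h1 h2 h3 h4
  rw [h1, h2, h3]
  -- At the frequency `w = -ξ/(2π)` the factor `1 + 2πisw` of `fourier_conv` equals `1 - isξ`.
  refine one_sub_two_div hs ξ ?_
  rw [← h4]
  congr 1
  push_cast
  field_simp
  ring

/-! ### Symbols -/

/-- `T` preserves `L² ∩ X(ℝ)` and acts there as multiplication by `a` on the Fourier side. -/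
def HasSymbol (N : FunNorm volume) (T : N.Space →L[ℂ] N.Space) (a : ℝ → ℂ) : Prop :=
  ∀ (f : N.Space) (hf : MemLp (N.incl f) 2 volume), ∃ h : MemLp (N.incl (T f)) 2 volume,
    fourierL2 (h.toLp _) =ᵐ[volume] fun ξ => a ξ * fourierL2 (hf.toLp _) ξ

theorem HasSymbol.one (N : FunNorm volume) : HasSymbol N 1 (r 0) := fun f hf =>
  ⟨hf, ae_of_all _ fun ξ => by simp [r]⟩

/-- Preservation of `L²`, demanded in `HasSymbol`, allows the outer operator to be applied to the
output of the inner one, so symbols multiply. -/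
theorem HasSymbol.comp {N : FunNorm volume} {S T : N.Space →L[ℂ] N.Space} {j k : ℤ}
    (hS : HasSymbol N S (r j)) (hT : HasSymbol N T (r k)) : HasSymbol N (S * T) (r (j + k)) := by
  intro f hf
  obtain ⟨h1, h1'⟩ := hT f hf
  obtain ⟨h2, h2'⟩ := hS (T f) h1
  refine ⟨h2, ?_⟩
  filter_upwards [h1', h2'] with ξ e1 e2
  rw [r_add, mul_assoc, ← e1]
  exact e2

theorem HasSymbol.pow {N : FunNorm volume} {T : N.Space →L[ℂ] N.Space} {k : ℤ}
    (hT : HasSymbol N T (r k)) (n : ℕ) : HasSymbol N (T ^ n) (r (n * k)) := by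
  induction n with
  | zero => simpa using HasSymbol.one N
  | succ n ih =>
    rw [pow_succ]
    convert ih.comp hT using 2
    push_cast; ring

theorem HasSymbol.isConvolutionExtension {N : FunNorm volume} {T : N.Space →L[ℂ] N.Space} {k : ℤ}
    (hT : HasSymbol N T (r k)) : IsConvolutionExtension N (r k) T := by
  refine ⟨memLp_r k, fun f hf => ?_⟩
  obtain ⟨h, h'⟩ := hT f hf
  have : mulL2 (r k) (memLp_r k) (fourierL2 (hf.toLp _)) = fourierL2 (h.toLp _) :=
    Lp.ext ((MemLp.coeFn_toLp _).trans h'.symm)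
  rw [this, fourierInvL2_fourierL2]
  exact (AEEqFun.mk_coeFn _).symm

theorem IsConvBounded.hasSymbol_shift {N : FunNorm volume} (hN : IsConvBounded N) {s : ℤ}
    (hs : |(s : ℝ)| = 1) : HasSymbol N (hN.shift hs) (r s) := by
  intro f hf
  have h1 := hN.coeFn_shift hs f
  have h : MemLp (N.incl (hN.shift hs f)) 2 volume :=
    (hf.sub ((memLp_conv hs hf).const_mul 2)).ae_eq h1.symm
  refine ⟨h, fourierL2_shift hs _ _ ?_⟩
  filter_upwards [MemLp.coeFn_toLp h, MemLp.coeFn_toLp hf, h1] with x e1 e2 e3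
  rw [e1, e2, e3, conv_congr s (MemLp.coeFn_toLp hf)]

/-- Two operators with the same symbol agree on `L² ∩ X(ℝ)`. -/
theorem IsConvolutionExtension.eq {N : FunNorm volume} {a : ℝ → ℂ} {S T : N.Space →L[ℂ] N.Space}
    (hS : IsConvolutionExtension N a S) (hT : IsConvolutionExtension N a T) {f : N.Space}
    (hf : MemLp (N.incl f) 2 volume) : S f = T f := by
  obtain ⟨h1, h1'⟩ := hS
  obtain ⟨h2, h2'⟩ := hT
  exact N.incl_injective (by rw [h1' f hf, h2' f hf])

theorem isConvolutionExtension_W0 {N : FunNorm volume} {a : ℝ → ℂ} (h : IsFourierMultiplier N a) :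
    IsConvolutionExtension N a (W0 N a) := by
  rw [W0, dif_pos h]
  exact h.choose_spec

/-! ### Restriction and extension -/

theorem restr_ext0 (f : ℝ →ₘ[volPos] ℂ) : restr (ext0 f) = f := by
  apply AEEqFun.ext
  filter_upwards [coeFn_restr (ext0 f), ae_restrict_of_ae (coeFn_ext0 f),
    ae_restrict_mem measurableSet_Ioi] with x h1 h2 h3
  rw [h1, h2, indicator_of_mem h3]

theorem coeFn_ext0_restr (f : ℝ →ₘ[volume] ℂ) :
    ext0 (restr f) =ᵐ[volume] (Ioi (0 : ℝ)).indicator f := by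
  filter_upwards [coeFn_ext0 (restr f), (ae_restrict_iff' measurableSet_Ioi).1 (coeFn_restr f)]
    with x h1 h2
  rw [h1]
  by_cases hx : x ∈ Ioi (0 : ℝ)
  · rw [indicator_of_mem hx, indicator_of_mem hx, h2 hx]
  · rw [indicator_of_notMem hx, indicator_of_notMem hx]

theorem SpacePair.incl_rPlus (X : SpacePair) (f : X.line.Space) :
    X.half.incl (X.rPlus f) = restr (X.line.incl f) := rfl

theorem SpacePair.incl_ellPlus (X : SpacePair) (f : X.half.Space) :
    X.line.incl (X.ellPlus f) = ext0 (X.half.incl f) := rfl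

theorem SpacePair.rPlus_ellPlus (X : SpacePair) (f : X.half.Space) : X.rPlus (X.ellPlus f) = f :=
  X.half.incl_injective (restr_ext0 _)

theorem SpacePair.ellPlus_rPlus (X : SpacePair) {f : X.line.Space}
    (hf : ∀ᵐ x, x ≤ 0 → X.line.incl f x = 0) : X.ellPlus (X.rPlus f) = f := by
  refine X.line.incl_injective (AEEqFun.ext ?_)
  rw [X.incl_ellPlus, X.incl_rPlus]
  filter_upwards [coeFn_ext0_restr (X.line.incl f), hf] with x h1 h2
  rw [h1]
  by_cases hx : x ∈ Ioi (0 : ℝ)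
  · rw [indicator_of_mem hx]
  · rw [indicator_of_notMem hx, h2 (not_lt.1 hx)]

/-- The kernel for `σ = 1` looks only at `t < x`; for `x ≤ 0` the function vanishes there. -/
theorem conv_one_of_nonpos {f : ℝ → ℂ} (hf : ∀ᵐ x, x ≤ 0 → f x = 0) {x : ℝ} (hx : x ≤ 0) :
    conv ((1 : ℤ) : ℝ) f x = 0 := by
  refine integral_eq_zero_of_ae ?_
  filter_upwards [hf] with t ht
  rcases le_or_gt t 0 with h | h
  · simp [ht h]
  · rw [expKer, if_neg (by push_cast; linarith)]
    simp

/-- The kernel for `σ = -1` looks only at `t > x`, so for `x ≥ 0` the values on the negative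
half-line are never seen. -/
theorem conv_neg_one_indicator (f : ℝ → ℂ) {x : ℝ} (hx : 0 ≤ x) :
    conv ((-1 : ℤ) : ℝ) ((Ioi (0 : ℝ)).indicator f) x = conv ((-1 : ℤ) : ℝ) f x := by
  unfold conv
  congr 1
  funext t
  by_cases ht : t ∈ Ioi (0 : ℝ)
  · rw [indicator_of_mem ht]
  · have : t ≤ 0 := not_lt.1 ht
    rw [expKer, if_neg (by push_cast; linarith)]
    simp

theorem conv_neg_one_eq (f : ℝ → ℂ) (x : ℝ) :
    conv ((-1 : ℤ) : ℝ) f x = Real.exp x * ∫ t in Ioi x, (Real.exp (-t) : ℂ) * f t := by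
  rw [conv, ← integral_const_mul, ← integral_indicator measurableSet_Ioi]
  congr 1
  funext t
  by_cases ht : x < t
  · rw [indicator_of_mem (show t ∈ Ioi x from ht), expKer, if_pos (by push_cast; linarith),
      ← mul_assoc, ← Complex.ofReal_mul, ← Real.exp_add]
    congr 3
    push_cast; ring
  · rw [indicator_of_notMem (show t ∉ Ioi x from ht), expKer, if_neg (by push_cast; linarith)]
    simp

/-! ### Powers of a left inverse -/

/-- If `B^{n+1} x = 0`, then `B^n x = c v` for some `c`; since `B^n A^n = 1`, subtracting `c A^n v`
from `x` leaves an element of `Ker B^n`. Each step of the induction thus adds one vector. Conversely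
`B^{m+1+k} A^k v = B^{m+1} v = 0`. -/
theorem ker_pow_eq_span {E : Type*} [AddCommGroup E] [Module ℂ E] {A B : E →ₗ[ℂ] E}
    (hBA : ∀ x, B (A x) = x) {v : E} (hB : LinearMap.ker B = Submodule.span ℂ {v}) (n : ℕ) :
    LinearMap.ker (B ^ n) = Submodule.span ℂ ((fun k : ℕ => (A ^ k) v) '' {k | k < n}) := by
  have hpow : ∀ n x, (B ^ n) ((A ^ n) x) = x := by
    intro n
    induction n with
    | zero => intro x; simp
    | succ n ih => intro x; rw [pow_succ, pow_succ', Module.End.mul_apply, Module.End.mul_apply,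
        hBA, ih]
  have hv : B v = 0 := by
    rw [← LinearMap.mem_ker, hB]; exact Submodule.mem_span_singleton_self v
  induction n with
  | zero =>
    simp only [not_lt_zero, ofPred_false, image_empty, Submodule.span_empty, pow_zero]
    exact LinearMap.ker_eq_bot.2 fun _ _ h => h
  | succ n ih =>
    refine le_antisymm (fun x hx => ?_) (Submodule.span_le.2 ?_)
    · have h1 : (B ^ n) x ∈ LinearMap.ker B := by
        rw [LinearMap.mem_ker] at hx ⊢
        rwa [pow_succ', Module.End.mul_apply] at hx
      rw [hB, Submodule.mem_span_singleton] at h1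
      obtain ⟨c, hc⟩ := h1
      have h2 : x - c • (A ^ n) v ∈ LinearMap.ker (B ^ n) := by
        rw [LinearMap.mem_ker, map_sub, map_smul, hpow, hc, sub_self]
      rw [ih] at h2
      have h3 : c • (A ^ n) v ∈
          Submodule.span ℂ ((fun k : ℕ => (A ^ k) v) '' {k | k < n + 1}) :=
        Submodule.smul_mem _ _ (Submodule.subset_span ⟨n, Nat.lt_succ_self n, rfl⟩)
      have h4 : x - c • (A ^ n) v ∈
          Submodule.span ℂ ((fun k : ℕ => (A ^ k) v) '' {k | k < n + 1}) :=
        Submodule.span_mono (image_mono fun k (hk : k < n) => hk.trans n.lt_succ_self) h2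
      simpa only [sub_add_cancel] using Submodule.add_mem _ h4 h3
    · rintro _ ⟨k, hk, rfl⟩
      have hk' : k < n + 1 := hk
      obtain ⟨m, rfl⟩ : ∃ m, n = m + k := ⟨n - k, by omega⟩
      change (B ^ (m + k + 1)) ((A ^ k) v) = 0
      rw [show m + k + 1 = (m + 1) + k by ring, pow_add, Module.End.mul_apply, hpow, pow_succ,
        Module.End.mul_apply, hv, map_zero]

/-! ### The function `e^{-x}` -/

/-- The function `√2 e^{-x}` on `(0, ∞)`, extended by zero. -/
def expFun (x : ℝ) : ℂ :=
  (Ioi (0 : ℝ)).indicator (fun x : ℝ => ((Real.sqrt 2 * Real.exp (-x) : ℝ) : ℂ)) x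

theorem measurable_expFun : Measurable expFun :=
  Measurable.indicator (by fun_prop) measurableSet_Ioi

/-- The a.e. class of `expFun`. -/
def expAE : ℝ →ₘ[volume] ℂ := AEEqFun.mk expFun measurable_expFun.aestronglyMeasurable

theorem coeFn_expAE : expAE =ᵐ[volume] expFun := AEEqFun.coeFn_mk _ _

/-- For `x > 0` and `t ∈ [0, 1]` one has `|x - t| ≤ x + 1`, so the convolution of `e^{-|u|}` with
the indicator of `[0, 1]` is at least `e^{-x-1}`. Membership of `e^{-x}` therefore needs no
computation of its norm in the individual spaces. -/
theorem IsConvBounded.rho_expAE_lt_top {N : FunNorm volume} (hN : IsConvBounded N) : N.rho expAE < ∞ := by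
  obtain ⟨C, hC⟩ := hN.bound
  have hm : AEStronglyMeasurable ((Icc (0 : ℝ) 1).indicator (1 : ℝ → ℂ)) volume :=
    (measurable_one.indicator measurableSet_Icc).aestronglyMeasurable
  set χ : ℝ →ₘ[volume] ℂ := AEEqFun.mk _ hm with hχ
  have hχa : χ =ᵐ[volume] (Icc (0 : ℝ) 1).indicator 1 := AEEqFun.coeFn_mk _ _
  have hχ' := hN.indicator χ hχa
  -- Chosen so that `a⁻¹ √2 e^{-x} = e^{-x-1}`, the lower bound for the convolution.
  set a : ℂ := ((Real.sqrt 2 * Real.exp 1 : ℝ) : ℂ) with ha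
  have ha0 : a ≠ 0 := by
    rw [ha, Complex.ofReal_ne_zero]; positivity
  have h1 : ∀ᵐ x, ‖(a⁻¹ • expAE : ℝ →ₘ[volume] ℂ) x‖ₑ ≤ absConv (fun t => ‖χ t‖ₑ) x := by
    filter_upwards [AEEqFun.coeFn_smul a⁻¹ expAE, coeFn_expAE] with x e1 e2
    rw [e1, Pi.smul_apply, e2, expFun]
    by_cases hx : x ∈ Ioi (0 : ℝ)
    · rw [indicator_of_mem hx]
      have hx' : 0 < x := hx
      have e3 : a⁻¹ • ((Real.sqrt 2 * Real.exp (-x) : ℝ) : ℂ) = (Real.exp (-x - 1) : ℝ) := by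
        rw [smul_eq_mul, ha, ← Complex.ofReal_inv, ← Complex.ofReal_mul, Real.exp_sub]
        congr 1
        have := Real.exp_pos 1
        field_simp
      have e4 : ∀ t, ‖((Icc (0 : ℝ) 1).indicator (1 : ℝ → ℂ)) t‖ₑ =
          (Icc (0 : ℝ) 1).indicator 1 t := fun t => by
        by_cases ht : t ∈ Icc (0 : ℝ) 1 <;> simp [ht]
      have e5 : (fun t => ‖χ t‖ₑ) =ᵐ[volume] (Icc (0 : ℝ) 1).indicator 1 := by
        filter_upwards [hχa] with t ht
        rw [ht, e4]
      rw [e3, absConv_congr e5, ← ofReal_norm, Complex.norm_real,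
        Real.norm_of_nonneg (Real.exp_pos _).le, absConv]
      calc ENNReal.ofReal (Real.exp (-x - 1))
          = ∫⁻ _ in Icc (0 : ℝ) 1, ENNReal.ofReal (Real.exp (-x - 1)) := by
            rw [setLIntegral_const, Real.volume_Icc]; simp
        _ ≤ ∫⁻ t in Icc (0 : ℝ) 1, ENNReal.ofReal (Real.exp (-|x - t|)) :=
            setLIntegral_mono' measurableSet_Icc fun t ht => by
              apply ENNReal.ofReal_le_ofReal
              apply Real.exp_le_exp.2
              have : |x - t| ≤ x + 1 := abs_le.2 ⟨by linarith [ht.2], by linarith [ht.1]⟩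
              linarith
        _ = _ := by
            rw [← lintegral_indicator measurableSet_Icc]
            congr 1
            funext t
            by_cases ht : t ∈ Icc (0 : ℝ) 1 <;> simp [ht]
    · rw [indicator_of_notMem hx]; simp
  have h2 : N.rho (a⁻¹ • expAE) < ∞ :=
    lt_of_le_of_lt (hC χ _ hχ' h1) (ENNReal.mul_lt_top (by simp) hχ')
  have h3 : expAE = a • (a⁻¹ • expAE) := (smul_inv_smul₀ ha0 expAE).symm
  rw [h3]
  exact lt_of_le_of_lt (N.smul_le _ _) (ENNReal.mul_lt_top enorm_lt_top h2)

theorem integral_exp_neg_mul_expFun {x : ℝ} (hx : 0 < x) :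
    ∫ t in Ioi x, (Real.exp (-t) : ℂ) * expFun t =
      ((Real.sqrt 2 * (Real.exp (-2 * x) / 2) : ℝ) : ℂ) := by
  have h1 : ∫ t in Ioi x, (Real.exp (-t) : ℂ) * expFun t =
      ∫ t in Ioi x, ((Real.sqrt 2 * Real.exp (-2 * t) : ℝ) : ℂ) := by
    refine setIntegral_congr_fun measurableSet_Ioi fun t ht => ?_
    have ht0 : t ∈ Ioi (0 : ℝ) := hx.trans ht
    simp only [expFun, indicator_of_mem ht0]
    rw [← Complex.ofReal_mul, mul_left_comm, ← Real.exp_add]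
    congr 3; ring
  rw [h1, integral_complex_ofReal, integral_const_mul, integral_exp_mul_Ioi (by norm_num)]
  congr 2
  ring

/-- A function on the half-line with `f(x) = 2 ∫_x^∞ e^{x-t} f(t) dt` is a multiple of `e^{-x}`. -/
theorem exists_eq_mul_expFun {F : ℝ → ℂ}
    (hint : IntegrableOn (fun t => (Real.exp (-t) : ℂ) * F t) (Ioi 0))
    (hF : ∀ᵐ x, 0 < x → F x = 2 * (Real.exp x * ∫ t in Ioi x, (Real.exp (-t) : ℂ) * F t)) :
    ∃ c : ℂ, ∀ᵐ x, 0 < x → F x = c * expFun x := by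
  set h : ℝ → ℂ := (Ioi (0 : ℝ)).indicator fun t => (Real.exp (-t) : ℂ) * F t with hh
  have hhi : Integrable h := (integrable_indicator_iff measurableSet_Ioi).2 hint
  set C0 : ℂ := ∫ t in Ioi (0 : ℝ), (Real.exp (-t) : ℂ) * F t with hC0
  -- For `x > 0` this is `∫_x^∞ e^{-t} F(t) dt`. As a primitive of an integrable function it is
  -- continuous on the whole line, before any regularity of `F` is known.
  set G : ℝ → ℂ := fun x => C0 - ∫ t in (0 : ℝ)..x, h t with hG
  have hGc : Continuous G :=
    continuous_const.sub (intervalIntegral.continuous_primitive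
      (fun a b => hhi.intervalIntegrable) 0)
  have hGe : ∀ x, 0 < x → G x = ∫ t in Ioi x, (Real.exp (-t) : ℂ) * F t := by
    intro x hx
    have e1 : ∫ t in (0 : ℝ)..x, h t = ∫ t in (0 : ℝ)..x, (Real.exp (-t) : ℂ) * F t := by
      rw [intervalIntegral.integral_of_le hx.le, intervalIntegral.integral_of_le hx.le]
      refine setIntegral_congr_fun measurableSet_Ioc fun t ht => ?_
      simp only [hh, indicator_of_mem (show t ∈ Ioi (0 : ℝ) from ht.1)]
    have e2 : C0 = (∫ t in (0 : ℝ)..x, (Real.exp (-t) : ℂ) * F t) +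
        ∫ t in Ioi x, (Real.exp (-t) : ℂ) * F t := by
      rw [intervalIntegral.integral_of_le hx.le, hC0, ← Ioc_union_Ioi_eq_Ioi hx.le,
        setIntegral_union (Ioc_disjoint_Ioi le_rfl) measurableSet_Ioi
          (hint.mono_set Ioc_subset_Ioi_self) (hint.mono_set (Ioi_subset_Ioi hx.le))]
    rw [hG]
    simp only [e1]
    rw [e2]; ring
  have hFG : ∀ᵐ x, 0 < x → F x = 2 * (Real.exp x * G x) := by
    filter_upwards [hF] with x hx hx0
    rw [hx hx0, hGe x hx0]
  -- Inserting `e^{-t} F(t) = 2 G(t)` gives an integral equation for the continuous function `G`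
  -- alone. Hence `G` is differentiable with `G' = -2G`, and `e^{2x} G(x)` is constant.
  have hG2 : ∀ x, 0 < x → G x = C0 - ∫ t in (0 : ℝ)..x, 2 * G t := by
    intro x hx
    change C0 - (∫ t in (0 : ℝ)..x, h t) = _
    congr 1
    refine intervalIntegral.integral_congr_ae ?_
    filter_upwards [hFG] with t ht htx
    rw [uIoc_of_le hx.le] at htx
    rw [hh, indicator_of_mem (show t ∈ Ioi (0 : ℝ) from htx.1), ht htx.1, mul_left_comm, ← mul_assoc (Real.exp (-t) : ℂ), ← Complex.ofReal_mul,
      ← Real.exp_add, neg_add_cancel, Real.exp_zero, Complex.ofReal_one, one_mul]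
  have hder : ∀ x, 0 < x → HasDerivAt G (-(2 * G x)) x := by
    intro x hx
    have e1 : HasDerivAt (fun x => C0 - ∫ t in (0 : ℝ)..x, 2 * G t) (-(2 * G x)) x := by
      have hc : Continuous fun t => 2 * G t := continuous_const.mul hGc
      have := (intervalIntegral.integral_hasDerivAt_right (hc.intervalIntegrable 0 x)
        (hc.stronglyMeasurableAtFilter _ _) hc.continuousAt).const_sub C0
      exact this
    refine e1.congr_of_eventuallyEq ?_
    filter_upwards [lt_mem_nhds hx] with y hy
    exact hG2 y hy
  have hder2 : ∀ x, 0 < x → HasDerivAt (fun x : ℝ => (Real.exp (2 * x) : ℂ) * G x) 0 x := by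
    intro x hx
    have e1 : HasDerivAt (fun x : ℝ => (Real.exp (2 * x) : ℂ)) ((2 * Real.exp (2 * x) : ℝ) : ℂ) x := by
      have := ((hasDerivAt_id x).const_mul (2 : ℝ)).exp
      have e : HasDerivAt (fun x : ℝ => Real.exp (2 * x)) (2 * Real.exp (2 * x)) x := by
        simpa [mul_comm] using this
      exact e.ofReal_comp
    refine (e1.mul (hder x hx)).congr_deriv ?_
    push_cast; ring
  have hconst : ∀ x, 0 < x → (Real.exp (2 * x) : ℂ) * G x = (Real.exp (2 * 1) : ℂ) * G 1 := by
    intro x hx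
    exact isOpen_Ioi.is_const_of_deriv_eq_zero isPreconnected_Ioi
      (fun y hy => (hder2 y hy).differentiableAt.differentiableWithinAt)
      (fun y hy => (hder2 y hy).deriv) (show x ∈ Ioi (0 : ℝ) from hx)
      (mem_Ioi.2 zero_lt_one)
  set d : ℂ := (Real.exp (2 * 1) : ℂ) * G 1 with hd
  -- `F = 2 e^x G = 2 d e^{-x}`, and `expFun` already carries the factor `√2`.
  refine ⟨2 * d / (Real.sqrt 2 : ℂ), ?_⟩
  filter_upwards [hFG] with x hx hx0
  have hs : (Real.sqrt 2 : ℂ) ≠ 0 := by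
    rw [Complex.ofReal_ne_zero]; positivity
  rw [hx hx0, expFun, indicator_of_mem (show x ∈ Ioi (0 : ℝ) from hx0), ← hconst x hx0]
  push_cast
  have e1 : Complex.exp (2 * x) * Complex.exp (-x) = Complex.exp x := by
    rw [← Complex.exp_add]; congr 1; ring
  rw [← e1]
  field_simp

/-! ### The kernels of the Wiener-Hopf operators -/

theorem abs_intCast_one : |((1 : ℤ) : ℝ)| = 1 := by norm_num

theorem abs_intCast_neg_one : |((-1 : ℤ) : ℝ)| = 1 := by norm_num

theorem coeFn_ext0_eq_zero (f : ℝ →ₘ[volPos] ℂ) : ∀ᵐ x, x ≤ 0 → ext0 f x = 0 := by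
  filter_upwards [coeFn_ext0 f] with x hx hx0
  rw [hx, indicator_of_notMem (notMem_Ioi.2 hx0)]

theorem memLp_ext0 {f : ℝ →ₘ[volPos] ℂ} (hf : MemLp f 2 volPos) : MemLp (ext0 f) 2 volume :=
  ((memLp_indicator_iff_restrict measurableSet_Ioi).2 hf).ae_eq (coeFn_ext0 f).symm

variable {X : SpacePair}

/-- The operator `r₊ (1 - 2 K_σ) ℓ₊` on `X(ℝ₊)`. -/
def IsConvBounded.halfShift (hN : IsConvBounded X.line) {σ : ℝ} (hσ : |σ| = 1) :
    X.half.Space →L[ℂ] X.half.Space := X.rPlus ∘L hN.shift hσ ∘L X.ellPlus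

/-- Causality: `1 - 2K_1` leaves the functions supported on the half-line invariant, so extension by
zero intertwines it with its compression. Consequently powers of the compression are compressions of
powers. -/
theorem IsConvBounded.ellPlus_halfShift (hN : IsConvBounded X.line) (f : X.half.Space) :
    X.ellPlus (hN.halfShift abs_intCast_one f) = hN.shift abs_intCast_one (X.ellPlus f) := by
  refine X.ellPlus_rPlus ?_
  have h0 := coeFn_ext0_eq_zero (X.half.incl f)
  filter_upwards [hN.coeFn_shift abs_intCast_one (X.ellPlus f), h0] with x h1 h2 hx
  refine h1.trans ?_
  rw [X.incl_ellPlus, h2 hx, conv_one_of_nonpos h0 hx]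
  simp

/-- The anticausal counterpart: `K_{-1} g` on `(0, ∞)` depends only on the restriction of `g`, so
here it is the restriction that intertwines. -/
theorem IsConvBounded.rPlus_shift (hN : IsConvBounded X.line) (g : X.line.Space) :
    X.rPlus (hN.shift abs_intCast_neg_one g) =
      hN.halfShift abs_intCast_neg_one (X.rPlus g) := by
  refine X.half.incl_injective (AEEqFun.ext ?_)
  change restr (X.line.incl (hN.shift abs_intCast_neg_one g)) =ᵐ[volPos]
    restr (X.line.incl (hN.shift abs_intCast_neg_one (X.ellPlus (X.rPlus g))))
  have e : X.line.incl (X.ellPlus (X.rPlus g)) =ᵐ[volume]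
      (Ioi (0 : ℝ)).indicator (X.line.incl g) := coeFn_ext0_restr _
  filter_upwards [coeFn_restr (X.line.incl (hN.shift abs_intCast_neg_one g)),
    coeFn_restr (X.line.incl (hN.shift abs_intCast_neg_one (X.ellPlus (X.rPlus g)))),
    ae_restrict_of_ae (hN.coeFn_shift abs_intCast_neg_one g),
    ae_restrict_of_ae (hN.coeFn_shift abs_intCast_neg_one (X.ellPlus (X.rPlus g))),
    ae_restrict_of_ae e, ae_restrict_mem measurableSet_Ioi] with x h1 h2 h3 h4 h5 hx
  have hx' : (0 : ℝ) ≤ x := le_of_lt hx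
  rw [h1, h2, h3, h4, conv_congr _ e, conv_neg_one_indicator _ hx', h5, indicator_of_mem hx]

theorem IsConvBounded.ellPlus_halfShift_pow (hN : IsConvBounded X.line) (n : ℕ) (f : X.half.Space) :
    X.ellPlus ((hN.halfShift abs_intCast_one ^ n) f) =
      (hN.shift abs_intCast_one ^ n) (X.ellPlus f) := by
  induction n generalizing f with
  | zero => simp
  | succ n ih =>
    rw [pow_succ, pow_succ, mul_apply_eq_comp, mul_apply_eq_comp, ih,
      hN.ellPlus_halfShift]

theorem IsConvBounded.rPlus_shift_pow (hN : IsConvBounded X.line) (n : ℕ) (g : X.line.Space) :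
    X.rPlus ((hN.shift abs_intCast_neg_one ^ n) g) =
      (hN.halfShift abs_intCast_neg_one ^ n) (X.rPlus g) := by
  induction n generalizing g with
  | zero => simp
  | succ n ih =>
    rw [pow_succ, pow_succ, mul_apply_eq_comp, mul_apply_eq_comp, ih,
      hN.rPlus_shift]

/-! ### Identification of the Wiener-Hopf operators with powers of `halfShift`. -/

theorem IsConvBounded.isFourierMultiplier (hN : IsConvBounded X.line) (k : ℤ) :
    IsFourierMultiplier X.line (r k) := by
  obtain ⟨n, rfl | rfl⟩ := k.eq_nat_or_neg
  · have := ((hN.hasSymbol_shift abs_intCast_one).pow n).isConvolutionExtension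
    rw [mul_one] at this
    exact ⟨_, this⟩
  · have := ((hN.hasSymbol_shift abs_intCast_neg_one).pow n).isConvolutionExtension
    rw [mul_neg_one] at this
    exact ⟨_, this⟩

/-- `W0` is some chosen extension, a priori different from `T`. The two agree on `L² ∩ X(ℝ)`, which
contains the extensions by zero of the dense set in `hd`; continuity does the rest. Density is
needed on the half-line only. -/
theorem IsConvBounded.W_eq (hN : IsConvBounded X.line)
    (hd : Dense {g : X.half.Space | MemLp (X.half.incl g) 2 volPos}) {k : ℤ}
    {T : X.line.Space →L[ℂ] X.line.Space} (hT : HasSymbol X.line T (r k)) :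
    W X (r k) = X.rPlus ∘L T ∘L X.ellPlus := by
  refine ContinuousLinearMap.ext fun f => ?_
  refine congrFun (Continuous.ext_on hd (W X (r k)).continuous
    (X.rPlus ∘L T ∘L X.ellPlus).continuous fun g hg => ?_) f
  have h2 : MemLp (X.line.incl (X.ellPlus g)) 2 volume := memLp_ext0 hg
  exact congrArg X.rPlus ((isConvolutionExtension_W0 (hN.isFourierMultiplier k)).eq
    hT.isConvolutionExtension h2)

theorem IsConvBounded.W_natCast (hN : IsConvBounded X.line)
    (hd : Dense {g : X.half.Space | MemLp (X.half.incl g) 2 volPos}) (n : ℕ) :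
    W X (r n) = hN.halfShift abs_intCast_one ^ n := by
  have h := (hN.hasSymbol_shift abs_intCast_one).pow n
  rw [mul_one] at h
  rw [hN.W_eq hd h]
  ext1 f
  change X.rPlus ((hN.shift abs_intCast_one ^ n) (X.ellPlus f)) = _
  rw [← hN.ellPlus_halfShift_pow, X.rPlus_ellPlus]

theorem IsConvBounded.W_neg_natCast (hN : IsConvBounded X.line)
    (hd : Dense {g : X.half.Space | MemLp (X.half.incl g) 2 volPos}) (n : ℕ) :
    W X (r (-(n : ℤ))) = hN.halfShift abs_intCast_neg_one ^ n := by
  have h := (hN.hasSymbol_shift abs_intCast_neg_one).pow n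
  rw [mul_neg_one] at h
  rw [hN.W_eq hd h]
  ext1 f
  change X.rPlus ((hN.shift abs_intCast_neg_one ^ n) (X.ellPlus f)) = _
  rw [hN.rPlus_shift_pow, X.rPlus_ellPlus]

/-- On the line the composite has symbol `r_{-1} r_1 = r_0 = 1`, so its compression equals that of
the identity by `W_eq`; the restriction then moves past the outer, anticausal factor. -/
theorem IsConvBounded.halfShift_leftInverse (hN : IsConvBounded X.line)
    (hd : Dense {g : X.half.Space | MemLp (X.half.incl g) 2 volPos}) (f : X.half.Space) :
    hN.halfShift abs_intCast_neg_one (hN.halfShift abs_intCast_one f) = f := by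
  have h := (hN.hasSymbol_shift abs_intCast_neg_one).comp (hN.hasSymbol_shift abs_intCast_one)
  rw [neg_add_cancel] at h
  have h1 := hN.W_eq hd h
  have h2 := hN.W_eq hd (HasSymbol.one X.line)
  have h3 := DFunLike.congr_fun (h1.symm.trans h2) f
  change X.rPlus (hN.shift abs_intCast_neg_one (hN.shift abs_intCast_one (X.ellPlus f))) =
    X.rPlus (X.ellPlus f) at h3
  rwa [X.rPlus_ellPlus, hN.rPlus_shift] at h3

theorem IsConvBounded.halfShift_eq_zero_iff (hN : IsConvBounded X.line) (f : X.half.Space) :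
    hN.halfShift abs_intCast_neg_one f = 0 ↔ ∀ᵐ x, 0 < x → ext0 (X.half.incl f) x =
      2 * (Real.exp x * ∫ t in Ioi x, (Real.exp (-t) : ℂ) * ext0 (X.half.incl f) t) := by
  rw [← (X.half.incl_injective).eq_iff, map_zero]
  change restr (X.line.incl (hN.shift abs_intCast_neg_one (X.ellPlus f))) = 0 ↔ _
  have h1 := ae_restrict_of_ae (s := Ioi (0 : ℝ))
    (hN.coeFn_shift abs_intCast_neg_one (X.ellPlus f))
  have h2 := coeFn_restr (X.line.incl (hN.shift abs_intCast_neg_one (X.ellPlus f)))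
  have h3 := AEEqFun.coeFn_zero (μ := volPos) (β := ℂ)
  have hI := ae_restrict_iff' (μ := (volume : Measure ℝ)) (s := Ioi (0 : ℝ)) (p := fun x =>
    ext0 (X.half.incl f) x = 2 * (Real.exp x * ∫ t in Ioi x, (Real.exp (-t) : ℂ) *
      ext0 (X.half.incl f) t)) measurableSet_Ioi
  refine Iff.trans ?_ hI
  constructor
  · intro h
    rw [h] at h2
    filter_upwards [h1, h2, h3] with x e1 e2 e3
    rw [← e2, e3, conv_neg_one_eq, X.incl_ellPlus] at e1
    exact (sub_eq_zero.1 e1.symm)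
  · intro h
    refine AEEqFun.ext ?_
    filter_upwards [h1, h2, h3, h] with x e1 e2 e3 e4
    rw [e2, e1, e3, conv_neg_one_eq, X.incl_ellPlus]
    exact sub_eq_zero.2 e4

theorem IsConvBounded.integrableOn_exp_neg_mul (hN : IsConvBounded X.line) (f : X.line.Space) :
    IntegrableOn (fun t => (Real.exp (-t) : ℂ) * X.line.incl f t) (Ioi 0) := by
  have h := integrable_expKer_mul abs_intCast_neg_one (X.line.incl f).aestronglyMeasurable
    (hN.absConv_lt_top (X.line.rho_incl_lt_top f) 0)
  rw [← integrable_indicator_iff measurableSet_Ioi]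
  refine h.congr (ae_of_all _ fun t => ?_)
  simp only
  by_cases ht : 0 < t
  · rw [indicator_of_mem (show t ∈ Ioi (0 : ℝ) from ht), expKer, if_pos (by push_cast; linarith)]
    simp
  · rw [indicator_of_notMem (show t ∉ Ioi (0 : ℝ) from ht), expKer,
      if_neg (by push_cast; linarith)]
    simp

/-- Everything particular to the three families of spaces enters through `hN` and `hd`. The kernel
of `W(r_{-1})` is read off from the integral equation, and `ker_pow_eq_span` is applied with `A =
W(r_1)`, `B = W(r_{-1})`. -/
theorem IsConvBounded.ker_W (hN : IsConvBounded X.line)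
    (hd : Dense {g : X.half.Space | MemLp (X.half.incl g) 2 volPos}) :
    (∀ k : ℤ, IsFourierMultiplier X.line (r k)) ∧
    ∃ psi0 : X.half.Space,
      (X.half.incl psi0 =ᵐ[volume.restrict (Ioi (0 : ℝ))]
        fun x : ℝ => ((Real.sqrt 2 * Real.exp (-x) : ℝ) : ℂ)) ∧
      ∀ n : ℕ, LinearMap.ker (W X (r (-(n : ℤ)))).toLinearMap =
        Submodule.span ℂ (psi X psi0 '' {k : ℕ | k < n}) := by
  refine ⟨hN.isFourierMultiplier, ?_⟩
  set e : X.line.Space := X.line.toSpace expAE hN.rho_expAE_lt_top with he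
  have hext : ext0 (X.half.incl (X.rPlus e)) =ᵐ[volume] expFun := by
    have h1 : ext0 (X.half.incl (X.rPlus e)) =ᵐ[volume] (Ioi (0 : ℝ)).indicator expAE :=
      coeFn_ext0_restr _
    filter_upwards [h1, coeFn_expAE] with x e1 e2
    rw [e1]
    by_cases hx : x ∈ Ioi (0 : ℝ)
    · rw [indicator_of_mem hx, e2]
    · rw [indicator_of_notMem hx, expFun, indicator_of_notMem hx]
  have hpsi : X.half.incl (X.rPlus e) =ᵐ[volume.restrict (Ioi (0 : ℝ))]
      fun x : ℝ => ((Real.sqrt 2 * Real.exp (-x) : ℝ) : ℂ) := by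
    have h1 : X.half.incl (X.rPlus e) =ᵐ[volPos] expAE := coeFn_restr _
    filter_upwards [h1, ae_restrict_of_ae coeFn_expAE, ae_restrict_mem measurableSet_Ioi]
      with x e1 e2 hx
    rw [e1, e2, expFun, indicator_of_mem hx]
  refine ⟨X.rPlus e, hpsi, fun n => ?_⟩
  have hker : LinearMap.ker (hN.halfShift abs_intCast_neg_one).toLinearMap =
      Submodule.span ℂ {X.rPlus e} := by
    refine le_antisymm (fun f hf => ?_) ?_
    · have hf' : hN.halfShift abs_intCast_neg_one f = 0 := hf
      rw [hN.halfShift_eq_zero_iff] at hf'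
      obtain ⟨c, hc⟩ := exists_eq_mul_expFun (hN.integrableOn_exp_neg_mul (X.ellPlus f)) hf'
      rw [Submodule.mem_span_singleton]
      refine ⟨c, X.half.incl_injective (AEEqFun.ext ?_)⟩
      rw [map_smul]
      filter_upwards [AEEqFun.coeFn_smul c (X.half.incl (X.rPlus e)), hpsi,
        ae_restrict_of_ae hc, ae_restrict_of_ae (coeFn_ext0 (X.half.incl f)),
        ae_restrict_mem measurableSet_Ioi] with x e1 e2 e3 e4 hx
      rw [e1, Pi.smul_apply, e2]
      have e5 := e3 hx
      rw [X.incl_ellPlus, e4, indicator_of_mem hx, expFun, indicator_of_mem hx] at e5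
      rw [e5, smul_eq_mul]
    · rw [Submodule.span_singleton_le_iff_mem]
      change hN.halfShift abs_intCast_neg_one (X.rPlus e) = 0
      rw [hN.halfShift_eq_zero_iff]
      filter_upwards [hext] with x hx hx0
      have h1 : ∫ t in Ioi x, (Real.exp (-t) : ℂ) * ext0 (X.half.incl (X.rPlus e)) t =
          ∫ t in Ioi x, (Real.exp (-t) : ℂ) * expFun t := by
        refine integral_congr_ae (ae_restrict_of_ae ?_)
        filter_upwards [hext] with t ht
        rw [ht]
      rw [hx, h1, integral_exp_neg_mul_expFun hx0, expFun,
        indicator_of_mem (show x ∈ Ioi (0 : ℝ) from hx0), ← Complex.ofReal_mul]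
      have h2 : Real.exp x * (Real.sqrt 2 * (Real.exp (-2 * x) / 2)) =
          Real.sqrt 2 * Real.exp (-x) / 2 := by
        have : Real.exp (-x) = Real.exp x * Real.exp (-2 * x) := by
          rw [← Real.exp_add]; congr 1; ring
        rw [this]; ring
      rw [h2]
      push_cast; ring
  have key := ker_pow_eq_span (A := (hN.halfShift abs_intCast_one).toLinearMap)
    (B := (hN.halfShift abs_intCast_neg_one).toLinearMap) (hN.halfShift_leftInverse hd) hker n
  have hpowA : ∀ (T : X.half.Space →L[ℂ] X.half.Space) (k : ℕ) (v : X.half.Space),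
      (T.toLinearMap ^ k) v = (T ^ k) v := by
    intro T k
    induction k with
    | zero => intro v; rfl
    | succ k ih => intro v; rw [pow_succ, pow_succ, Module.End.mul_apply, ih]; rfl
  have hpsik : psi X (X.rPlus e) =
      fun k : ℕ => ((hN.halfShift abs_intCast_one).toLinearMap ^ k) (X.rPlus e) := by
    funext k
    rw [hpowA]
    -- `ψ_0` is given directly and not as `W(r_0) ψ_0`, so it is a separate case.
    cases k with
    | zero => rfl
    | succ k =>
      change W X (r ((k : ℤ) + 1)) _ = _
      rw [← hN.W_natCast hd]
      push_cast; rfl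
  rw [hpsik, ← key, hN.W_neg_natCast hd]
  ext v
  rw [LinearMap.mem_ker, LinearMap.mem_ker, hpowA]
  rfl

/-! ### Truncations -/

/-- The set of points `x ≤ n` where `|f| ≤ n`. -/
def truncSet (f : ℝ → ℂ) (n : ℕ) : Set ℝ := {x | ‖f x‖ ≤ n ∧ x ≤ n}

theorem measurableSet_truncSet (f : ℝ →ₘ[volPos] ℂ) (n : ℕ) : MeasurableSet (truncSet f n) :=
  (measurableSet_le f.stronglyMeasurable.norm.measurable measurable_const).inter
    (measurableSet_le measurable_id measurable_const)

theorem truncSet_mono (f : ℝ → ℂ) : Monotone (truncSet f) := fun m n h x hx => by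
  have h' : (m : ℝ) ≤ n := by exact_mod_cast h
  exact ⟨hx.1.trans h', hx.2.trans h'⟩

theorem exists_mem_truncSet (f : ℝ → ℂ) (x : ℝ) : ∃ n, x ∈ truncSet f n := by
  obtain ⟨n, hn⟩ := exists_nat_ge (max ‖f x‖ x)
  exact ⟨n, (le_max_left _ _).trans hn, (le_max_right _ _).trans hn⟩

/-- The truncation of `f` to the set `truncSet f n`. -/
def trunc (f : ℝ →ₘ[volPos] ℂ) (n : ℕ) : ℝ →ₘ[volPos] ℂ :=
  AEEqFun.mk ((truncSet f n).indicator f)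
    (f.stronglyMeasurable.indicator (measurableSet_truncSet f n)).aestronglyMeasurable

theorem coeFn_trunc (f : ℝ →ₘ[volPos] ℂ) (n : ℕ) :
    trunc f n =ᵐ[volPos] (truncSet f n).indicator f := AEEqFun.coeFn_mk _ _

theorem coeFn_sub_trunc (f : ℝ →ₘ[volPos] ℂ) (n : ℕ) :
    (f - trunc f n : ℝ →ₘ[volPos] ℂ) =ᵐ[volPos] (truncSet f n)ᶜ.indicator f := by
  filter_upwards [coeFn_trunc f n, AEEqFun.coeFn_sub f (trunc f n)] with x h1 h2
  rw [h2, Pi.sub_apply, h1]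
  by_cases hx : x ∈ truncSet f n
  · rw [indicator_of_mem hx, indicator_of_notMem (notMem_compl_iff.2 hx), sub_self]
  · rw [indicator_of_notMem hx, indicator_of_mem (mem_compl hx), sub_zero]

theorem enorm_trunc_le (f : ℝ →ₘ[volPos] ℂ) (n : ℕ) :
    ∀ᵐ x ∂volPos, ‖trunc f n x‖ₑ ≤ ‖f x‖ₑ := by
  filter_upwards [coeFn_trunc f n] with x hx
  rw [hx]
  exact enorm_indicator_le_enorm_self _ _

theorem enorm_sub_trunc_le (f : ℝ →ₘ[volPos] ℂ) (n : ℕ) :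
    ∀ᵐ x ∂volPos, ‖(f - trunc f n : ℝ →ₘ[volPos] ℂ) x‖ₑ ≤ ‖f x‖ₑ := by
  filter_upwards [coeFn_sub_trunc f n] with x hx
  rw [hx]
  exact enorm_indicator_le_enorm_self _ _

theorem eventually_sub_trunc_eq_zero (f : ℝ →ₘ[volPos] ℂ) :
    ∀ᵐ x ∂volPos, ∀ᶠ n in atTop, (f - trunc f n : ℝ →ₘ[volPos] ℂ) x = 0 := by
  filter_upwards [ae_all_iff.2 fun n => coeFn_sub_trunc f n] with x hx
  obtain ⟨N, hN⟩ := exists_mem_truncSet f x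
  filter_upwards [eventually_ge_atTop N] with n hn
  rw [hx n, indicator_of_notMem (notMem_compl_iff.2 (truncSet_mono f hn hN))]

theorem memLp_trunc (f : ℝ →ₘ[volPos] ℂ) (n : ℕ) : MemLp (trunc f n) 2 volPos := by
  refine MemLp.ae_eq (coeFn_trunc f n).symm ?_
  rw [memLp_indicator_iff_restrict (measurableSet_truncSet f n)]
  have hfin : IsFiniteMeasure (volPos.restrict (truncSet f n)) := by
    refine ⟨?_⟩
    rw [Measure.restrict_apply_univ, Measure.restrict_apply' measurableSet_Ioi]
    refine lt_of_le_of_lt (measure_mono fun x hx => ?_)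
      (measure_Ioc_lt_top (a := (0 : ℝ)) (b := n) (μ := volume))
    exact ⟨hx.2, hx.1.2⟩
  refine MemLp.of_bound f.aestronglyMeasurable.restrict n ?_
  filter_upwards [ae_restrict_mem (measurableSet_truncSet f n)] with x hx
  exact hx.1

theorem dense_of_tendsto_trunc (N : FunNorm volPos)
    (htr : ∀ f : ℝ →ₘ[volPos] ℂ, ∀ n, N.rho (trunc f n) ≤ N.rho f)
    (h : ∀ f : N.Space, Tendsto (fun n => N.rho (N.incl f - trunc (N.incl f) n)) atTop (𝓝 0)) :
    Dense {g : N.Space | MemLp (N.incl g) 2 volPos} := by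
  intro f
  set g : ℕ → N.Space := fun n => N.toSpace (trunc (N.incl f) n)
    (lt_of_le_of_lt (htr _ n) (N.rho_incl_lt_top f)) with hg
  refine mem_closure_of_tendsto (f := g) (b := atTop) ?_
    (Eventually.of_forall fun n => memLp_trunc (N.incl f) n)
  rw [tendsto_iff_norm_sub_tendsto_zero]
  have h1 := (ENNReal.tendsto_toReal ENNReal.zero_ne_top).comp (h f)
  refine h1.congr fun n => ?_
  rw [norm_sub_rev, N.norm_def, map_sub]
  rfl

/-! ### Lorentz spaces -/

/-- Separates the power weight from the maximal function; integrability at `0` and at `∞` is read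
off from this form. -/
theorem lorentz_integrand_eq {p q t : ℝ} (hq : 0 < q) (ht : 0 < t) (a : ℝ≥0∞) :
    (ENNReal.ofReal (t ^ (1 / p)) * a) ^ q * (ENNReal.ofReal t)⁻¹ =
      ENNReal.ofReal (t ^ (q / p - 1)) * a ^ q := by
  rw [ENNReal.mul_rpow_of_nonneg _ _ hq.le, ENNReal.ofReal_rpow_of_nonneg (by positivity) hq.le,
    ← Real.rpow_mul ht.le, ← ENNReal.ofReal_inv_of_pos ht, mul_right_comm,
    ← ENNReal.ofReal_mul (by positivity), Real.rpow_sub_one ht.ne', one_div, mul_comm p⁻¹ q,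
    ← div_eq_mul_inv, ← div_eq_mul_inv]

theorem lorentzRho_le_mul {μ ν : Measure ℝ} {p q : ℝ} (hq : 1 ≤ q) {f g : ℝ → ℂ} (c : ℝ≥0)
    (h : ∀ t, 0 < t → rearrAvg μ g t ≤ c * rearrAvg ν f t) :
    lorentzRho μ p q g ≤ c * lorentzRho ν p q f := by
  have hq0 : (0 : ℝ) < q := by linarith
  have hq1 : (0 : ℝ) ≤ 1 / q := by positivity
  have h2 : (c : ℝ≥0∞) = ((c : ℝ≥0∞) ^ q) ^ (1 / q) := by
    rw [← ENNReal.rpow_mul, mul_one_div_cancel hq0.ne', ENNReal.rpow_one]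
  unfold lorentzRho
  conv_rhs => rw [h2]
  rw [← ENNReal.mul_rpow_of_nonneg _ _ hq1, ← lintegral_const_mul' _ _
    (ENNReal.rpow_ne_top_of_nonneg hq0.le ENNReal.coe_ne_top)]
  refine ENNReal.rpow_le_rpow (setLIntegral_mono' measurableSet_Ioi fun t ht => ?_) hq1
  rw [← mul_assoc, ← ENNReal.mul_rpow_of_nonneg _ _ hq0.le, mul_left_comm]
  gcongr
  exact h t ht

theorem lorentzRho_lt_top_iff {μ : Measure ℝ} {p q : ℝ} (hq : 1 ≤ q) {f : ℝ → ℂ} :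
    lorentzRho μ p q f < ∞ ↔ ∫⁻ t in Ioi (0 : ℝ),
      (ENNReal.ofReal (t ^ (1 / p)) * rearrAvg μ f t) ^ q * (ENNReal.ofReal t)⁻¹ < ∞ := by
  have hq0 : (0 : ℝ) < 1 / q := by positivity
  rw [lorentzRho, ENNReal.rpow_lt_top_iff_of_pos hq0]

theorem measurable_lorentz_integrand (μ : Measure ℝ) (p q : ℝ) (f : ℝ → ℂ) :
    Measurable fun t : ℝ =>
      (ENNReal.ofReal (t ^ (1 / p)) * rearrAvg μ f t) ^ q * (ENNReal.ofReal t)⁻¹ :=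
  ((((measurable_id.pow_const _).ennreal_ofReal).mul (measurable_rearrAvg μ f)).pow_const
      q).mul ENNReal.measurable_ofReal.inv

theorem rearrAvg_lt_top_of_lorentzRho {μ : Measure ℝ} {p q : ℝ} (hq : 1 ≤ q) {f : ℝ → ℂ}
    (hf : lorentzRho μ p q f < ∞) :
    ∀ᵐ t ∂(volume.restrict (Ioi (0 : ℝ))), rearrAvg μ f t < ∞ := by
  have hq0 : (0 : ℝ) < q := by linarith
  rw [lorentzRho_lt_top_iff hq] at hf
  filter_upwards [ae_lt_top (measurable_lorentz_integrand μ p q f) hf.ne,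
    ae_restrict_mem measurableSet_Ioi] with t ht ht0
  have ht0' : 0 < t := ht0
  rw [lorentz_integrand_eq hq0 ht0'] at ht
  by_contra hcon
  rw [not_lt, top_le_iff] at hcon
  rw [hcon, ENNReal.top_rpow_of_pos hq0, ENNReal.mul_top (by simpa using Real.rpow_pos_of_pos ht0' _)]
    at ht
  exact lt_irrefl _ ht

theorem lintegral_rearr_lt_top {μ : Measure ℝ} {f : ℝ → ℂ} {t : ℝ}
    (h : rearrAvg μ f t < ∞) : ∫⁻ s in Ioo 0 t, rearr μ f s < ∞ := by
  rw [rearrAvg] at h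
  by_contra hcon
  rw [not_lt, top_le_iff] at hcon
  rw [hcon, ENNReal.mul_top (by simp)] at h
  exact lt_irrefl _ h

theorem rearr_lt_top {μ : Measure ℝ} {f : ℝ → ℂ} {t : ℝ} (ht : 0 < t)
    (h : ∫⁻ s in Ioo 0 t, rearr μ f s < ∞) : rearr μ f t < ∞ := by
  by_contra hcon
  rw [not_lt, top_le_iff] at hcon
  refine absurd h (not_lt.2 ?_)
  calc ∞ = ∫⁻ _ in Ioo 0 t, ∞ := by
        rw [setLIntegral_const, Real.volume_Ioo, ENNReal.top_mul]; simpa using ht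
    _ ≤ _ := setLIntegral_mono' measurableSet_Ioo fun s hs =>
        hcon ▸ rearr_antitone μ f hs.2.le

theorem distr_mono {μ : Measure ℝ} {f g : ℝ → ℂ} (h : ∀ᵐ x ∂μ, ‖f x‖ₑ ≤ ‖g x‖ₑ) (l : ℝ≥0) :
    distr μ f l ≤ distr μ g l := by
  refine measure_mono_ae ?_
  filter_upwards [h] with x hx
  intro (hl : l < ‖f x‖₊)
  exact lt_of_lt_of_le hl (ENNReal.coe_le_coe.1 hx)

/-- Convolution with `e^{-|u|}` has norm at most 2 on both `L¹` and `L^∞`, and `∫₀ᵗ f* = inf_l (t l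
+ ∫ (|f| - l)₊)` is the K-functional of this pair. At the minimising level `l = f*(t)` the bounded
part contributes at most `2l`, the excess `E` an `L¹` function of integral `2 ∫ E`. -/
theorem lintegral_rearr_absConv_le {f g : ℝ →ₘ[volume] ℂ}
    (h : ∀ᵐ x, ‖g x‖ₑ ≤ absConv (fun t => ‖f t‖ₑ) x) {t : ℝ} (ht : 0 < t) :
    ∫⁻ s in Ioo 0 t, rearr volume g s ≤ 2 * ∫⁻ s in Ioo 0 t, rearr volume f s := by
  by_cases hfin : ∫⁻ s in Ioo 0 t, rearr volume f s < ∞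
  swap
  · rw [not_lt, top_le_iff] at hfin
    rw [hfin, ENNReal.mul_top (by simp)]
    exact le_top
  have h1 := rearr_lt_top ht hfin
  lift rearr volume f t to ℝ≥0 using h1.ne with l hl
  set E : ℝ → ℝ≥0∞ := fun x => ENNReal.ofReal (‖f x‖ - l) with hE
  have hEm : Measurable E :=
    (f.stronglyMeasurable.norm.measurable.sub_const _).ennreal_ofReal
  have h2 : ∀ x, absConv (fun t => ‖f t‖ₑ) x ≤ (2 * l : ℝ≥0) + absConv E x := by
    intro x
    have e1 : ∀ t, ‖f t‖ₑ ≤ l + E t := fun t => by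
      rw [← ofReal_norm, ← ENNReal.ofReal_coe_nnreal]
      refine (ENNReal.ofReal_le_ofReal ?_).trans ENNReal.ofReal_add_le
      linarith
    refine (absConv_mono (ae_of_all _ e1) x).trans ?_
    unfold absConv
    simp_rw [mul_add]
    rw [lintegral_add_left ((measurable_expKernel x).mul_const _),
      lintegral_mul_const _ (measurable_expKernel x), lintegral_exp_neg_abs_sub_left]
    push_cast
    exact le_rfl
  have h3 : ∫⁻ x, ENNReal.ofReal (‖g x‖ - (2 * l : ℝ≥0)) ≤ 2 * ∫⁻ x, E x := by
    rw [← lintegral_absConv hEm]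
    refine lintegral_mono_ae ?_
    filter_upwards [h] with x hx
    rw [ENNReal.ofReal_sub _ (NNReal.coe_nonneg _), ofReal_norm, ENNReal.ofReal_coe_nnreal]
    exact tsub_le_iff_left.2 (hx.trans (h2 x))
  calc ∫⁻ s in Ioo 0 t, rearr volume g s
      ≤ ENNReal.ofReal t * (2 * l : ℝ≥0) + ∫⁻ x, ENNReal.ofReal (‖g x‖ - (2 * l : ℝ≥0)) :=
        lintegral_rearr_le g.aestronglyMeasurable t (2 * l)
    _ ≤ ENNReal.ofReal t * (2 * l : ℝ≥0) + 2 * ∫⁻ x, E x := by gcongr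
    _ = 2 * (ENNReal.ofReal t * l + ∫⁻ x, E x) := by push_cast; ring
    _ ≤ _ := by gcongr; exact lintegral_rearr_eq f.aestronglyMeasurable hl.symm

/-- Here `f** ≤ min(1, 1/t)`. Near `0` the weight `t^{q/p-1}` is integrable because `q/p > 0`; at
infinity `t^{q/p-1-q}` is integrable because `p > 1`. -/
theorem lorentzRho_indicator_lt_top {p q : ℝ} (hp : 1 < p) (hq : 1 < q) {f : ℝ → ℂ}
    (hf : f =ᵐ[volume] (Icc (0 : ℝ) 1).indicator 1) : lorentzRho volume p q f < ∞ := by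
  have hq0 : 0 < q := by linarith
  have hp0 : 0 < p := by linarith
  rw [lorentzRho_lt_top_iff hq.le]
  have hd1 : distr volume f 1 = 0 := by
    rw [distr_congr hf, distr]
    convert measure_empty (μ := (volume : Measure ℝ))
    ext x
    by_cases hx : x ∈ Icc (0 : ℝ) 1 <;> simp [hx]
  have hd0 : distr volume f 0 ≤ 1 := by
    rw [distr_congr hf, distr]
    refine (measure_mono (t := Icc (0 : ℝ) 1) fun x hx => ?_).trans (by simp)
    by_contra hcon
    exact hcon (by simpa using hx)
  have hr1 : ∀ t, rearr volume f t ≤ 1 := fun t => by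
    simpa using rearr_le (μ := volume) (f := f) (t := t) 1 (by simp [hd1])
  have hr0 : ∀ t, 1 ≤ t → rearr volume f t ≤ 0 := fun t ht => by
    simpa using rearr_le (μ := volume) (f := f) (t := t) 0 (hd0.trans (by simpa using ht))
  have ha1 : ∀ t, 0 < t → rearrAvg volume f t ≤ 1 := fun t ht => by
    rw [rearrAvg]
    calc _ ≤ (ENNReal.ofReal t)⁻¹ * ∫⁻ _ in Ioo 0 t, 1 := by gcongr; exact hr1 _
      _ = 1 := by
        rw [setLIntegral_const, Real.volume_Ioo, sub_zero, one_mul,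
          ENNReal.inv_mul_cancel (by simpa using ht) ENNReal.ofReal_ne_top]
  have ha2 : ∀ t, 1 < t → rearrAvg volume f t ≤ (ENNReal.ofReal t)⁻¹ := fun t ht => by
    rw [rearrAvg]
    calc _ ≤ (ENNReal.ofReal t)⁻¹ * 1 := by
          gcongr
          calc ∫⁻ s in Ioo 0 t, rearr volume f s
              ≤ ∫⁻ s in Ioo 0 t, (Ioo (0 : ℝ) 1).indicator 1 s :=
                setLIntegral_mono' measurableSet_Ioo fun s hs => by
                  by_cases h1 : s < 1
                  · rw [indicator_of_mem (show s ∈ Ioo (0 : ℝ) 1 from ⟨hs.1, h1⟩)]; exact hr1 s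
                  · exact (hr0 s (not_lt.1 h1)).trans bot_le
            _ ≤ ∫⁻ s, (Ioo (0 : ℝ) 1).indicator 1 s := setLIntegral_le_lintegral _ _
            _ = 1 := by rw [lintegral_indicator_one measurableSet_Ioo]; simp
      _ = _ := mul_one _
  rw [← Ioc_union_Ioi_eq_Ioi (zero_le_one (α := ℝ)), lintegral_union measurableSet_Ioi
    (Ioc_disjoint_Ioi le_rfl), ENNReal.add_lt_top]
  constructor
  · have hi : IntegrableOn (fun t : ℝ => t ^ (q / p - 1)) (Ioc 0 1) := by
      have := intervalIntegral.intervalIntegrable_rpow' (a := 0) (b := 1) (r := q / p - 1)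
        (by have : 0 < q / p := by positivity
            linarith)
      rwa [intervalIntegrable_iff_integrableOn_Ioc_of_le zero_le_one] at this
    refine lt_of_le_of_lt (setLIntegral_mono' measurableSet_Ioc fun t ht => ?_) hi.lintegral_lt_top
    rw [lorentz_integrand_eq hq0 ht.1]
    calc _ ≤ ENNReal.ofReal (t ^ (q / p - 1)) * 1 ^ q := by gcongr; exact ha1 t ht.1
      _ = _ := by simp
  · have hi : IntegrableOn (fun t : ℝ => t ^ (q / p - 1 - q)) (Ioi 1) := by
      refine integrableOn_Ioi_rpow_of_lt ?_ zero_lt_one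
      have : q / p < q := div_lt_self hq0 hp
      linarith
    refine lt_of_le_of_lt (setLIntegral_mono' measurableSet_Ioi fun t ht => ?_) hi.lintegral_lt_top
    have ht1 : 1 < t := ht
    have ht0 : 0 < t := by linarith
    rw [lorentz_integrand_eq hq0 ht0]
    calc _ ≤ ENNReal.ofReal (t ^ (q / p - 1)) * ((ENNReal.ofReal t)⁻¹) ^ q := by
          gcongr; exact ha2 t ht1
      _ = _ := by
        rw [← ENNReal.ofReal_inv_of_pos ht0, ENNReal.ofReal_rpow_of_nonneg (by positivity) hq0.le,
          ← ENNReal.ofReal_mul (by positivity), Real.inv_rpow ht0.le, ← Real.rpow_neg ht0.le,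
          ← Real.rpow_add ht0]
        rfl

theorem isConvBounded_lorentz {p q : ℝ} (hp : 1 < p) (hq : 1 < q) : IsConvBounded (lorentz p q hq).line where
  excess f hf := by
    have hne : (ae (volume.restrict (Ioi (0 : ℝ)))).NeBot := by
      rw [ae_neBot, Ne, Measure.restrict_eq_zero, Real.volume_Ioi]
      exact ENNReal.top_ne_zero
    -- Any `t` with `f**(t) < ∞` yields a suitable level, namely `f*(t)`.
    obtain ⟨t, ht, ht0⟩ := ((rearrAvg_lt_top_of_lorentzRho hq.le hf).and
      (ae_restrict_mem measurableSet_Ioi)).exists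
    have h1 := lintegral_rearr_lt_top ht
    have h2 := rearr_lt_top ht0 h1
    lift rearr volume f t to ℝ≥0 using h2.ne with l hl
    exact ⟨l, lt_of_le_of_lt (le_add_self.trans
      (lintegral_rearr_eq f.aestronglyMeasurable hl.symm)) h1⟩
  bound := by
    refine ⟨2, fun f g _ h => lorentzRho_le_mul hq.le 2 fun t ht => ?_⟩
    rw [rearrAvg, rearrAvg, mul_left_comm]
    gcongr
    exact_mod_cast lintegral_rearr_absConv_le h ht
  indicator f hf := lorentzRho_indicator_lt_top hp hq hf

/-- An infinite distribution function at a level `l > 0` would give `f** ≥ l` everywhere, while no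
power of `t` is integrable over `(0, ∞)`. Finiteness at positive levels is what continuity from
above requires in `tendsto_distr_sub_trunc`. -/
theorem distr_lt_top_of_lorentzRho {μ : Measure ℝ} {p q : ℝ} (hq : 1 ≤ q) {f : ℝ → ℂ}
    (hf : lorentzRho μ p q f < ∞) {l : ℝ≥0} (hl : 0 < l) : distr μ f l < ∞ := by
  have hq0 : 0 < q := by linarith
  by_contra hcon
  rw [not_lt, top_le_iff] at hcon
  have h1 : ∀ t, (l : ℝ≥0∞) ≤ rearr μ f t := fun t => by
    refine le_iInf₂ fun l' hl' => ?_
    by_contra hlt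
    have : l' ≤ l := by exact_mod_cast (not_le.1 hlt).le
    have h2 := (distr_antitone μ f this).trans hl'
    rw [hcon, top_le_iff] at h2
    exact ENNReal.ofReal_ne_top h2
  have h2 : ∀ t, 0 < t → (l : ℝ≥0∞) ≤ rearrAvg μ f t := fun t ht => by
    rw [rearrAvg]
    calc (l : ℝ≥0∞) = (ENNReal.ofReal t)⁻¹ * ∫⁻ _ in Ioo 0 t, (l : ℝ≥0∞) := by
          rw [setLIntegral_const, Real.volume_Ioo, sub_zero, mul_comm (l : ℝ≥0∞), ← mul_assoc,
            ENNReal.inv_mul_cancel (by simpa using ht) ENNReal.ofReal_ne_top, one_mul]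
      _ ≤ _ := by gcongr; exact h1 _
  rw [lorentzRho_lt_top_iff hq] at hf
  refine not_integrableOn_Ioi_rpow (q / p - 1) ⟨by fun_prop, ?_⟩
  have h3 : ∫⁻ t in Ioi (0 : ℝ), ENNReal.ofReal (t ^ (q / p - 1)) * (l : ℝ≥0∞) ^ q < ∞ := by
    refine lt_of_le_of_lt (setLIntegral_mono' measurableSet_Ioi fun t ht => ?_) hf
    rw [lorentz_integrand_eq hq0 ht]
    gcongr
    exact h2 t ht
  have hlq : (l : ℝ≥0∞) ^ q ≠ 0 := by
    rw [Ne, ENNReal.rpow_eq_zero_iff_of_pos hq0]; exact_mod_cast hl.ne'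
  rw [lintegral_mul_const' _ _ (ENNReal.rpow_ne_top_of_nonneg hq0.le ENNReal.coe_ne_top)] at h3
  have h4 := ENNReal.lt_top_of_mul_ne_top_left h3.ne hlq
  rw [HasFiniteIntegral]
  refine lt_of_le_of_lt (setLIntegral_mono' measurableSet_Ioi fun t ht => ?_) h4
  rw [← ofReal_norm, Real.norm_of_nonneg (Real.rpow_nonneg (le_of_lt ht) _)]

theorem tendsto_distr_sub_trunc (f : ℝ →ₘ[volPos] ℂ) {l : ℝ≥0} (h : distr volPos f l < ∞) :
    Tendsto (fun n => distr volPos (f - trunc f n : ℝ →ₘ[volPos] ℂ) l) atTop (𝓝 0) := by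
  set E : ℕ → Set ℝ := fun n => {x | l < ‖f x‖₊} ∩ (truncSet f n)ᶜ with hE
  have hEm : ∀ n, MeasurableSet (E n) := fun n =>
    (measurableSet_lt measurable_const f.stronglyMeasurable.nnnorm.measurable).inter
      (measurableSet_truncSet f n).compl
  have h1 : ∀ n, distr volPos (f - trunc f n : ℝ →ₘ[volPos] ℂ) l = volPos (E n) := by
    intro n
    rw [distr_congr (coeFn_sub_trunc f n), distr]
    congr 1
    ext x
    simp only [hE, mem_inter_iff, mem_ofPred_eq]
    by_cases hx : x ∈ (truncSet f n)ᶜ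
    · simp [hx]
    · simp [hx]
  simp_rw [h1]
  have h2 : ⋂ n, E n = ∅ := by
    rw [eq_empty_iff_forall_notMem]
    intro x hx
    obtain ⟨n, hn⟩ := exists_mem_truncSet f x
    exact (mem_iInter.1 hx n).2 hn
  rw [← measure_empty (μ := volPos), ← h2]
  refine tendsto_measure_iInter_atTop (fun n => (hEm n).nullMeasurableSet)
    (fun m n hmn => inter_subset_inter_right _ (compl_subset_compl.2 (truncSet_mono f hmn)))
    ⟨0, ?_⟩
  exact (lt_of_le_of_lt (measure_mono inter_subset_left) h).ne

/-- Dominated convergence is used twice: over the levels, after the layer-cake formula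
`lintegral_rearr`, to get `f** → 0` for the remainders at almost every `t`; then over `t` in the
integral defining the norm. -/
theorem tendsto_lorentzRho_sub_trunc {p q : ℝ} (hq : 1 < q) (f : ℝ →ₘ[volPos] ℂ)
    (hf : lorentzRho volPos p q f < ∞) :
    Tendsto (fun n => lorentzRho volPos p q (f - trunc f n : ℝ →ₘ[volPos] ℂ)) atTop (𝓝 0) := by
  have hq0 : 0 < q := by linarith
  have hle : ∀ n l, distr volPos (f - trunc f n : ℝ →ₘ[volPos] ℂ) l ≤ distr volPos f l :=
    fun n l => distr_mono (enorm_sub_trunc_le f n) l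
  have hav : ∀ᵐ t ∂(volume.restrict (Ioi (0 : ℝ))),
      Tendsto (fun n => rearrAvg volPos (f - trunc f n : ℝ →ₘ[volPos] ℂ) t) atTop (𝓝 0) := by
    filter_upwards [rearrAvg_lt_top_of_lorentzRho hq.le hf, ae_restrict_mem measurableSet_Ioi]
      with t ht ht0
    have ht0' : 0 < t := ht0
    have h1 : Tendsto (fun n => ∫⁻ s in Ioo 0 t, rearr volPos (f - trunc f n : ℝ →ₘ[volPos] ℂ) s)
        atTop (𝓝 0) := by
      have h2 := lintegral_rearr_lt_top ht
      simp_rw [lintegral_rearr] at h2 ⊢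
      rw [← lintegral_zero (μ := volume.restrict (Ioi (0 : ℝ)))]
      refine tendsto_lintegral_of_dominated_convergence _ (fun n => ?_)
        (fun n => ae_of_all _ fun l => min_le_min_right _ (hle n _)) h2.ne ?_
      · exact (distr_toNNReal_antitone _ _).measurable.min measurable_const
      · filter_upwards [ae_restrict_mem measurableSet_Ioi] with l hl
        have := (tendsto_distr_sub_trunc f (distr_lt_top_of_lorentzRho hq.le hf
          (Real.toNNReal_pos.2 hl))).min (tendsto_const_nhds (x := ENNReal.ofReal t))
        simpa using this
    have h3 := ENNReal.Tendsto.const_mul (a := (ENNReal.ofReal t)⁻¹) h1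
      (Or.inr (by simpa using ht0'))
    simpa [rearrAvg] using h3
  have h1 : Tendsto (fun n => ∫⁻ t in Ioi (0 : ℝ), (ENNReal.ofReal (t ^ (1 / p)) *
      rearrAvg volPos (f - trunc f n : ℝ →ₘ[volPos] ℂ) t) ^ q * (ENNReal.ofReal t)⁻¹)
      atTop (𝓝 0) := by
    rw [lorentzRho_lt_top_iff hq.le] at hf
    rw [← lintegral_zero (μ := volume.restrict (Ioi (0 : ℝ)))]
    refine tendsto_lintegral_of_dominated_convergence _
      (fun n => measurable_lorentz_integrand _ p q _) (fun n => ae_of_all _ fun t => ?_) hf.ne ?_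
    · have : rearrAvg volPos (f - trunc f n : ℝ →ₘ[volPos] ℂ) t ≤ rearrAvg volPos f t := by
        unfold rearrAvg
        gcongr
        exact le_iInf₂ fun l hl => rearr_le l ((hle n l).trans hl)
      exact mul_le_mul_left (ENNReal.rpow_le_rpow (mul_le_mul_right this _) hq0.le) _
    · filter_upwards [hav, ae_restrict_mem measurableSet_Ioi] with t ht ht0
      simp_rw [lorentz_integrand_eq hq0 (show (0 : ℝ) < t from ht0)]
      have := ENNReal.Tendsto.const_mul (a := ENNReal.ofReal (t ^ (q / p - 1)))
        (ht.ennrpow_const q) (Or.inr ENNReal.ofReal_ne_top)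
      simpa [ENNReal.zero_rpow_of_pos hq0] using this
  have h2 := h1.ennrpow_const (1 / q)
  rwa [ENNReal.zero_rpow_of_pos (by positivity)] at h2

theorem dense_lorentz {p q : ℝ} (hq : 1 < q) :
    Dense {g : (lorentz p q hq).half.Space |
      MemLp ((lorentz p q hq).half.incl g) 2 volPos} :=
  dense_of_tendsto_trunc _
    (fun f n => lorentzRho_mono (by linarith) (distr_mono (enorm_trunc_le f n)))
    fun f => tendsto_lorentzRho_sub_trunc hq _ ((lorentz p q hq).half.rho_incl_lt_top f)

/-! ### Luxemburg norms -/

namespace IsModular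

variable {μ : Measure ℝ} {M : ℝ → ℝ≥0∞ → ℝ≥0∞}

theorem luxemburg_mono_of_le (hM : IsModular μ M) {g h : ℝ → ℝ≥0∞} (H : ∀ᵐ x ∂μ, g x ≤ h x) :
    luxemburg μ M g ≤ luxemburg μ M h := by
  refine luxemburg_mono fun l _ => lintegral_mono_ae ?_
  filter_upwards [hM.mono, H] with x h1 h2
  exact h1 (ENNReal.div_le_div_right h2 _)

/-- A modular of at least linear growth controls large values: if the modular of `f/l` is finite,
the excess of `|f|` over `l c` is at most `l M(x, |f|/l)`. -/
theorem excess (hM : IsModular μ M) {c : ℝ≥0} (hc : ∀ᵐ x ∂μ, ∀ t, t ≤ c + M x t)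
    {f : ℝ →ₘ[μ] ℂ} (hf : hM.norm.rho f < ∞) :
    ∃ c : ℝ≥0, ∫⁻ t, ENNReal.ofReal (‖f t‖ - c) ∂μ < ∞ := by
  obtain ⟨l, hl, h⟩ := (hM.luxemburg_lt_top_iff _).1 hf
  have hl0 : (l : ℝ≥0∞) ≠ 0 := by exact_mod_cast hl.ne'
  have h' : ∫⁻ x, l * M x (‖f x‖ₑ / l) ∂μ < ∞ := by
    rw [lintegral_const_mul' _ _ ENNReal.coe_ne_top]
    exact ENNReal.mul_lt_top ENNReal.coe_lt_top h
  refine ⟨l * c, lt_of_le_of_lt (lintegral_mono_ae ?_) h'⟩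
  filter_upwards [hc] with x hx
  rw [ENNReal.ofReal_sub _ (NNReal.coe_nonneg _), ofReal_norm, ENNReal.ofReal_coe_nnreal,
    tsub_le_iff_left, ENNReal.coe_mul, ← mul_add]
  calc ‖f x‖ₑ = l * (‖f x‖ₑ / l) := (ENNReal.mul_div_cancel hl0 ENNReal.coe_ne_top).symm
    _ ≤ _ := by gcongr; exact hx _

theorem rho_indicator_lt_top {M : ℝ → ℝ≥0∞ → ℝ≥0∞} (hM : IsModular volume M) {l : ℝ≥0}
    (hl : 0 < l) (h : ∫⁻ x in Icc (0 : ℝ) 1, M x (1 / l) < ∞) {f : ℝ →ₘ[volume] ℂ}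
    (hf : f =ᵐ[volume] (Icc (0 : ℝ) 1).indicator 1) : hM.norm.rho f < ∞ := by
  rw [← lintegral_indicator measurableSet_Icc] at h
  refine (hM.luxemburg_lt_top_iff _).2 ⟨l, hl, lt_of_le_of_lt (lintegral_mono_ae ?_) h⟩
  filter_upwards [hf, hM.zero] with x h1 h2
  rw [h1]
  by_cases hx : x ∈ Icc (0 : ℝ) 1
  · simp [indicator_of_mem hx]
  · simp [indicator_of_notMem hx, h2]

/-- Dominated convergence in the modular at every scale `l`. The hypothesis at all scales, and not
just one, is a condition of `Δ₂` type. -/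
theorem tendsto_rho_sub_trunc {M : ℝ → ℝ≥0∞ → ℝ≥0∞} (hM : IsModular volPos M)
    {f : ℝ →ₘ[volPos] ℂ} (hf : ∀ l : ℝ≥0, 0 < l → ∫⁻ x, M x (‖f x‖ₑ / l) ∂volPos < ∞) :
    Tendsto (fun n => hM.norm.rho (f - trunc f n)) atTop (𝓝 0) := by
  rw [ENNReal.tendsto_nhds_zero]
  intro ε hε
  obtain ⟨l, hl, hl'⟩ := ENNReal.lt_iff_exists_nnreal_btwn.1 hε
  have hl0 : 0 < l := by exact_mod_cast hl
  have h1 : Tendsto (fun n => ∫⁻ x, M x (‖(f - trunc f n : ℝ →ₘ[volPos] ℂ) x‖ₑ / l) ∂volPos)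
      atTop (𝓝 0) := by
    rw [← lintegral_zero (μ := volPos)]
    refine tendsto_lintegral_of_dominated_convergence' _ (fun n => ?_) (fun n => ?_)
      (hf l hl0).ne ?_
    · exact hM.meas _ ((f - trunc f n).aestronglyMeasurable.enorm.div_const _)
    · filter_upwards [hM.mono, enorm_sub_trunc_le f n] with x h1 h2
      exact h1 (ENNReal.div_le_div_right h2 _)
    · filter_upwards [hM.zero, eventually_sub_trunc_eq_zero f] with x h1 h2
      refine tendsto_const_nhds.congr' ?_
      filter_upwards [h2] with n hn
      rw [hn]
      simp [h1]
  filter_upwards [h1.eventually (gt_mem_nhds zero_lt_one)] with n hn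
  exact (luxemburg_le l hl0 hn.le).trans hl'.le

end IsModular

/-! ### Variable Lebesgue spaces -/

theorem IsExponent.one_le_toReal {p : ℝ → ℝ≥0∞} (hp : IsExponent p) :
    ∀ᵐ x, 1 ≤ (p x).toReal := by
  filter_upwards [hp.finite] with x hx
  simpa using ENNReal.toReal_mono hx.ne (hp.one_le x)

theorem lintegral_Icc_le_maximal (f : ℝ → ℂ) (x : ℝ) {s : ℝ} (hs : 0 < s) :
    ∫⁻ t in Icc (x - s) (x + s), ‖f t‖ₑ ≤ ENNReal.ofReal (2 * s) * maximal f x := by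
  have h1 : (∫⁻ t in Icc (x - s) (x + s), ‖f t‖ₑ) / ENNReal.ofReal (x + s - (x - s)) ≤
      maximal f x := by
    refine le_iSup_of_le (x - s) (le_iSup_of_le (x + s) (le_iSup_of_le (by linarith)
      (le_iSup_of_le ⟨by linarith, by linarith⟩ le_rfl)))
  rw [show x + s - (x - s) = 2 * s by ring] at h1
  rw [mul_comm]
  exact (ENNReal.div_le_iff_le_mul (Or.inl (by simpa using hs)) (Or.inl ENNReal.ofReal_ne_top)).1 h1

/-- Convolution with `e^{-|u|}` is dominated by the maximal function. -/
theorem absConv_le_maximal :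
    ∃ C : ℝ≥0, ∀ f : ℝ → ℂ, Measurable f → ∀ x, absConv (fun t => ‖f t‖ₑ) x ≤ C * maximal f x := by
  -- Since `e^{-|u|} = ∫_{|u|}^∞ e^{-s} ds`, the kernel is a superposition of indicators of the
  -- intervals `[-s, s]` with weights `e^{-s}`.
  have hexp : ∀ u : ℝ, ENNReal.ofReal (Real.exp (-|u|)) =
      ∫⁻ s in Ioi (0 : ℝ), (Icc (-s) s).indicator (fun _ => ENNReal.ofReal (Real.exp (-s))) u := by
    intro u
    have h1 : ∫⁻ s in Ioi |u|, ENNReal.ofReal (Real.exp (-s)) = ENNReal.ofReal (Real.exp (-|u|)) := by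
      rw [← ofReal_integral_eq_lintegral_ofReal (integrableOn_exp_neg_Ioi _)
        (ae_of_all _ fun t => (Real.exp_pos _).le), integral_exp_neg_Ioi]
    rw [← h1, ← lintegral_indicator measurableSet_Ioi, ← lintegral_indicator measurableSet_Ioi]
    refine lintegral_congr_ae ?_
    -- The intervals `[-s, s]` are closed, so the two integrands may differ at `s = |u|`, and only
    -- there.
    have h2 : ∀ᵐ s : ℝ, s ≠ |u| := by simp [ae_iff]
    filter_upwards [h2] with s hs
    by_cases h3 : |u| < s
    · have h4 : 0 < s := (abs_nonneg u).trans_lt h3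
      rw [indicator_of_mem (show s ∈ Ioi |u| from h3),
        indicator_of_mem (show s ∈ Ioi (0 : ℝ) from h4), 
        indicator_of_mem (show u ∈ Icc (-s) s from abs_le.1 h3.le)]
    · rw [indicator_of_notMem (show s ∉ Ioi |u| from h3)]
      have h4 : u ∉ Icc (-s) s := fun h => hs (le_antisymm (not_lt.1 h3) (abs_le.2 h))
      by_cases h5 : s ∈ Ioi (0 : ℝ)
      · rw [indicator_of_mem h5, indicator_of_notMem h4]
      · rw [indicator_of_notMem h5]
  have hG : ∫⁻ s in Ioi (0 : ℝ), ENNReal.ofReal (Real.exp (-s)) * ENNReal.ofReal (2 * s) < ∞ := by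
    have h1 : IntegrableOn (fun s : ℝ => 2 * (Real.exp (-s) * s ^ ((2 : ℝ) - 1))) (Ioi 0) :=
      (Real.GammaIntegral_convergent (s := 2) (by norm_num)).const_mul 2
    refine lt_of_le_of_lt (setLIntegral_mono' measurableSet_Ioi fun s hs => ?_) h1.lintegral_lt_top
    rw [← ENNReal.ofReal_mul (Real.exp_pos _).le]
    refine ENNReal.ofReal_le_ofReal (le_of_eq ?_)
    rw [show (2 : ℝ) - 1 = 1 by norm_num, Real.rpow_one]
    ring
  -- The integral of `|f|` over the interval of length `2s` about `x` is at most `2s` times the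
  -- maximal function, which leaves the constant `∫₀^∞ 2s e^{-s} ds`.
  refine ⟨(∫⁻ s in Ioi (0 : ℝ), ENNReal.ofReal (Real.exp (-s)) *
    ENNReal.ofReal (2 * s)).toNNReal, fun f hf x => ?_⟩
  rw [ENNReal.coe_toNNReal hG.ne, absConv]
  have hm : Measurable fun z : ℝ × ℝ => (Icc (-z.2) z.2).indicator
      (fun _ => ENNReal.ofReal (Real.exp (-z.2))) (x - z.1) * ‖f z.1‖ₑ := by
    have hs : MeasurableSet {z : ℝ × ℝ | -z.2 ≤ x - z.1 ∧ x - z.1 ≤ z.2} :=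
      (measurableSet_le measurable_snd.neg (measurable_const.sub measurable_fst)).inter
        (measurableSet_le (measurable_const.sub measurable_fst) measurable_snd)
    have he : Measurable fun z : ℝ × ℝ => ENNReal.ofReal (Real.exp (-z.2)) := by fun_prop
    exact (he.indicator hs).mul (hf.comp measurable_fst).enorm
  calc ∫⁻ t, ENNReal.ofReal (Real.exp (-|x - t|)) * ‖f t‖ₑ
      = ∫⁻ t, ∫⁻ s in Ioi (0 : ℝ), (Icc (-s) s).indicator
          (fun _ => ENNReal.ofReal (Real.exp (-s))) (x - t) * ‖f t‖ₑ := by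
        refine lintegral_congr fun t => ?_
        rw [hexp, lintegral_mul_const' _ _ enorm_ne_top]
    _ = ∫⁻ s in Ioi (0 : ℝ), ∫⁻ t, (Icc (-s) s).indicator
          (fun _ => ENNReal.ofReal (Real.exp (-s))) (x - t) * ‖f t‖ₑ :=
        lintegral_lintegral_swap hm.aemeasurable
    _ ≤ ∫⁻ s in Ioi (0 : ℝ), ENNReal.ofReal (Real.exp (-s)) * ENNReal.ofReal (2 * s) *
          maximal f x := by
        refine setLIntegral_mono' measurableSet_Ioi fun s hs => ?_
        have h1 : ∀ t, (Icc (-s) s).indicator (fun _ => ENNReal.ofReal (Real.exp (-s))) (x - t) *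
            ‖f t‖ₑ = ENNReal.ofReal (Real.exp (-s)) *
              (Icc (x - s) (x + s)).indicator (fun t => ‖f t‖ₑ) t := by
          intro t
          by_cases ht : t ∈ Icc (x - s) (x + s)
          · rw [indicator_of_mem ht, indicator_of_mem
              (show x - t ∈ Icc (-s) s from ⟨by linarith [ht.2], by linarith [ht.1]⟩)]
          · rw [indicator_of_notMem ht, indicator_of_notMem
              (show x - t ∉ Icc (-s) s from fun h => ht ⟨by linarith [h.2], by linarith [h.1]⟩)]
            simp
        simp_rw [h1]
        rw [lintegral_const_mul' _ _ ENNReal.ofReal_ne_top, lintegral_indicator measurableSet_Icc,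
          mul_assoc]
        gcongr
        exact lintegral_Icc_le_maximal f x hs
    _ = _ := by
        rw [lintegral_mul_const]
        fun_prop

theorem isConvBounded_varLebesgue {p : ℝ → ℝ≥0∞} (hp : IsExponent p) (hM : IsBM p hp) :
    IsConvBounded (varLebesgue p hp).line where
  excess f hf := by
    refine hp.isModular.excess (c := 1) ?_ hf
    filter_upwards [hp.one_le_toReal] with x hx t
    rcases le_total t 1 with h | h
    · exact (h.trans (by simp)).trans le_self_add
    · refine le_trans ?_ le_add_self
      calc t = t ^ (1 : ℝ) := (ENNReal.rpow_one t).symm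
        _ ≤ t ^ (p x).toReal := ENNReal.rpow_le_rpow_of_exponent_le h hx
  bound := by
    obtain ⟨C, hC⟩ := absConv_le_maximal
    obtain ⟨D, hD⟩ := hM.maximal_bounded
    refine ⟨C * D, fun f g hf h => ?_⟩
    have h1 : (varLebesgue p hp).line.rho g ≤
        luxemburg volume (powExp p) fun x => C * maximal f x := by
      refine hp.isModular.luxemburg_mono_of_le ?_
      filter_upwards [h] with x hx
      exact hx.trans (hC f f.stronglyMeasurable.measurable x)
    refine (h1.trans (hp.isModular.luxemburg_smul C _)).trans ?_
    rw [ENNReal.coe_mul, mul_assoc]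
    gcongr
    exact hD ((varLebesgue p hp).line.toSpace f hf)
  indicator f hf := by
    refine hp.isModular.rho_indicator_lt_top one_pos ?_ hf
    simp [powExp]

/-- As the exponent is essentially bounded by some `P`, enlarging the argument by a factor `c ≥ 1`
costs at most `c^P`. So one finite value of the modular makes it finite at all scales, and
truncations converge in norm. -/
theorem dense_varLebesgue {p : ℝ → ℝ≥0∞} (hp : IsExponent p) (hM : IsBM p hp) :
    Dense {g : (varLebesgue p hp).half.Space |
      MemLp ((varLebesgue p hp).half.incl g) 2 volPos} := by
  refine dense_of_tendsto_trunc _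
    (fun f n => hp.isModular.restrict.luxemburg_mono_of_le (enorm_trunc_le f n)) fun f => ?_
  refine hp.isModular.restrict.tendsto_rho_sub_trunc fun l hl => ?_
  obtain ⟨k, hk, h⟩ := (hp.isModular.restrict.luxemburg_lt_top_iff _).1
    ((varLebesgue p hp).half.rho_incl_lt_top f)
  have hk0 : (k : ℝ≥0∞) ≠ 0 := by exact_mod_cast hk.ne'
  have hl0 : (l : ℝ≥0∞) ≠ 0 := by exact_mod_cast hl.ne'
  set P : ℝ := (essSup p volume).toReal with hP
  have hP0 : 0 ≤ P := ENNReal.toReal_nonneg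
  -- The maximum with 1 ensures `c^{p(x)} ≤ c^P`.
  set c : ℝ≥0∞ := max 1 (k / l) with hc
  have hct : c ≠ ∞ := by
    rw [hc, Ne, max_eq_top, not_or]
    exact ⟨ENNReal.one_ne_top, ENNReal.div_ne_top ENNReal.coe_ne_top hl0⟩
  have hcP : c ^ P ≠ ∞ := ENNReal.rpow_ne_top_of_nonneg hP0 hct
  have h' : ∫⁻ x, c ^ P * powExp p x (‖(varLebesgue p hp).half.incl f x‖ₑ / k) ∂volPos < ∞ := by
    rw [lintegral_const_mul' _ _ hcP]
    exact ENNReal.mul_lt_top hcP.lt_top h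
  refine lt_of_le_of_lt (lintegral_mono_ae ?_) h'
  filter_upwards [ae_restrict_of_ae (ENNReal.ae_le_essSup p)] with x hx
  have hpP : (p x).toReal ≤ P := ENNReal.toReal_mono hM.essSup_lt_top.ne hx
  set y := ‖(varLebesgue p hp).half.incl f x‖ₑ
  have e1 : y / l ≤ c * (y / k) := by
    calc y / l = k / l * (y / k) := by
          rw [ENNReal.div_eq_inv_mul, ENNReal.div_eq_inv_mul, ENNReal.div_eq_inv_mul, mul_assoc,
            ← mul_assoc (k : ℝ≥0∞), ENNReal.mul_inv_cancel hk0 ENNReal.coe_ne_top, one_mul]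
      _ ≤ _ := by gcongr; exact le_max_right _ _
  calc powExp p x (y / l) ≤ (c * (y / k)) ^ (p x).toReal :=
        ENNReal.rpow_le_rpow e1 ENNReal.toReal_nonneg
    _ = c ^ (p x).toReal * (y / k) ^ (p x).toReal :=
        ENNReal.mul_rpow_of_nonneg _ _ ENNReal.toReal_nonneg
    _ ≤ _ := by
        unfold powExp
        gcongr
        exact le_max_left _ _

/-! ### Orlicz spaces -/

/-- Beyond a point `T` where `φ > 1` the Young function grows with slope at least one. `exists_le`
gives this at integer distances from `T`, hence the additional 1. -/
theorem IsYoungDensity.le_add_young {φ : ℝ≥0 → ℝ≥0∞} (hφ : IsYoungDensity φ) :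
    ∃ c : ℝ≥0, ∀ t : ℝ≥0∞, t ≤ c + young φ t := by
  obtain ⟨T, hT⟩ := hφ.exists_le
  refine ⟨T + 1, fun t => ?_⟩
  by_cases ht : t = ∞
  · rw [ht, hφ.young_top]; simp
  lift t to ℝ≥0 using ht
  rcases le_total t T with h | h
  · refine le_trans ?_ le_self_add
    exact_mod_cast h.trans le_self_add
  · set n := ⌊t - T⌋₊ with hn
    have h1 : (n : ℝ≥0) ≤ t - T := Nat.floor_le (by positivity)
    have h2 : t - T < n + 1 := Nat.lt_floor_add_one _
    have h3 : T + n ≤ t := by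
      calc T + n ≤ T + (t - T) := by gcongr
        _ = t := add_tsub_cancel_of_le h
    have h4 : t ≤ T + 1 + n := by
      calc t = T + (t - T) := (add_tsub_cancel_of_le h).symm
        _ ≤ T + (n + 1) := by gcongr
        _ = _ := by ring
    calc (t : ℝ≥0∞) ≤ ((T + 1 + n : ℝ≥0) : ℝ≥0∞) := by exact_mod_cast h4
      _ = ((T + 1 : ℝ≥0) : ℝ≥0∞) + n := by push_cast; rfl
      _ ≤ _ := by gcongr; exact hT n _ (by exact_mod_cast h3)

/-- The supporting line of a Young function. -/
theorem IsYoungDensity.young_support {φ : ℝ≥0 → ℝ≥0∞} (hφ : IsYoungDensity φ) (s : ℝ≥0)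
    (z : ℝ≥0∞) : young φ s + φ s * z ≤ young φ z + φ s * s := by
  by_cases hz : z = ∞
  · rw [hz, hφ.young_top, top_add]; exact le_top
  lift z to ℝ≥0 using hz
  rcases le_total s z with h | h
  · have h' : (s : ℝ) ≤ z := by exact_mod_cast h
    have h1 : φ s * ENNReal.ofReal (z - s) ≤ ∫⁻ u in Ioc (s : ℝ) z, φ u.toNNReal := by
      rw [← Real.volume_Ioc, ← setLIntegral_const]
      exact setLIntegral_mono' measurableSet_Ioc fun u hu =>
        hφ.mono (NNReal.le_toNNReal_of_coe_le hu.1.le)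
    have h2 : (z : ℝ≥0∞) = ENNReal.ofReal (z - s) + s := by
      rw [← ENNReal.ofReal_coe_nnreal (p := s), ← ENNReal.ofReal_add (sub_nonneg.2 h') s.coe_nonneg,
        sub_add_cancel, ENNReal.ofReal_coe_nnreal]
    calc young φ s + φ s * z = young φ s + φ s * ENNReal.ofReal (z - s) + φ s * s := by
          conv_lhs => rw [h2]
          ring
      _ ≤ _ := by rw [young_coe_add φ h]; gcongr
  · have h' : (z : ℝ) ≤ s := by exact_mod_cast h
    have h1 : ∫⁻ u in Ioc (z : ℝ) s, φ u.toNNReal ≤ φ s * ENNReal.ofReal (s - z) := by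
      rw [← Real.volume_Ioc, ← setLIntegral_const]
      exact setLIntegral_mono' measurableSet_Ioc fun u hu =>
        hφ.mono (Real.toNNReal_le_iff_le_coe.2 hu.2)
    have h2 : (s : ℝ≥0∞) = ENNReal.ofReal (s - z) + z := by
      rw [← ENNReal.ofReal_coe_nnreal (p := z), ← ENNReal.ofReal_add (sub_nonneg.2 h') z.coe_nonneg,
        sub_add_cancel, ENNReal.ofReal_coe_nnreal]
    calc young φ s + φ s * z
        ≤ young φ z + φ s * ENNReal.ofReal (s - z) + φ s * z := by
          rw [young_coe_add φ h]; gcongr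
      _ = young φ z + φ s * (ENNReal.ofReal (s - z) + z) := by ring
      _ = _ := by rw [← h2]

/-- Young functions are left-continuous. -/
theorem young_le_of_forall_lt (φ : ℝ≥0 → ℝ≥0∞) {m I : ℝ≥0∞}
    (h : ∀ s : ℝ≥0, (s : ℝ≥0∞) < m → young φ s ≤ I) : young φ m ≤ I := by
  rcases eq_or_ne m 0 with rfl | hm
  · rw [young_zero]; exact bot_le
  obtain ⟨u, hu, hum, hlim⟩ := exists_seq_strictMono_tendsto' (pos_iff_ne_zero.2 hm)
  have hset : {t : ℝ | 0 < t ∧ ENNReal.ofReal t ≤ m} =ᵐ[volume]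
      ⋃ n, {t : ℝ | 0 < t ∧ ENNReal.ofReal t ≤ u n} := by
    have h1 : ∀ᵐ t : ℝ, t ≠ m.toReal := by simp [ae_iff]
    filter_upwards [h1] with t ht
    refine propext ⟨fun h2 => ?_, fun h2 => ?_⟩
    · have h2' : 0 < t ∧ ENNReal.ofReal t ≤ m := h2
      have h3 : ENNReal.ofReal t < m := lt_of_le_of_ne h2'.2 fun e => ht (by
        rw [← e, ENNReal.toReal_ofReal h2'.1.le])
      obtain ⟨n, hn⟩ := (hlim.eventually (lt_mem_nhds h3)).exists
      exact mem_iUnion.2 ⟨n, h2'.1, hn.le⟩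
    · obtain ⟨n, hn⟩ := mem_iUnion.1 h2
      exact ⟨hn.1, hn.2.trans (hum n).2.le⟩
  rw [young, setLIntegral_congr hset, setLIntegral_iUnion_of_directed]
  · refine iSup_le fun n => ?_
    have h2 := ((hum n).2.trans_le le_top).ne
    lift u n to ℝ≥0 using h2 with v hv
    exact h v (hv ▸ (hum n).2)
  · exact directed_of_isDirected_le fun a b hab t ht => ⟨ht.1, ht.2.trans (hu.monotone hab)⟩

/-- Jensen's inequality for Young functions. -/
theorem IsYoungDensity.young_lintegral_le {φ : ℝ≥0 → ℝ≥0∞} (hφ : IsYoungDensity φ)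
    (ν : Measure ℝ) [IsProbabilityMeasure ν] {u : ℝ → ℝ≥0∞} (hu : Measurable u) :
    young φ (∫⁻ t, u t ∂ν) ≤ ∫⁻ t, young φ (u t) ∂ν := by
  set m := ∫⁻ t, u t ∂ν with hm
  -- The slope at the mean `m` itself may be infinite, so supporting lines are taken at `s < m`,
  -- integrated, and `s` tends to `m`. If a slope at some `s < m` is infinite, then `Φ = ∞` beyond
  -- `s`, and `u` exceeds `s` on a set of positive measure.
  by_cases hfin : ∀ s : ℝ≥0, (s : ℝ≥0∞) < m → φ s < ∞
  · refine young_le_of_forall_lt φ fun s hs => ?_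
    have hs' := hfin s hs
    have h1 : ∫⁻ t, (young φ s + φ s * u t) ∂ν ≤ ∫⁻ t, (young φ (u t) + φ s * s) ∂ν :=
      lintegral_mono fun t => hφ.young_support s (u t)
    rw [lintegral_add_left measurable_const, lintegral_const_mul _ hu,
      lintegral_add_right _ measurable_const, lintegral_const, lintegral_const, measure_univ,
      mul_one, mul_one, ← hm] at h1
    have h2 : φ s * (s : ℝ≥0∞) ≠ ∞ := (ENNReal.mul_lt_top hs' ENNReal.coe_lt_top).ne
    refine (ENNReal.add_le_add_iff_right h2).1 (le_trans ?_ h1)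
    gcongr
  · push Not at hfin
    obtain ⟨s, hs, hs'⟩ := hfin
    rw [top_le_iff] at hs'
    have h1 : ∀ z : ℝ≥0∞, (s : ℝ≥0∞) < z → young φ z = ∞ := by
      intro z hz
      obtain ⟨w, hw, hwz⟩ := ENNReal.lt_iff_exists_nnreal_btwn.1 hz
      have hsw : s < w := by exact_mod_cast hw
      have hsw' : (s : ℝ) < w := by exact_mod_cast hsw
      refine top_le_iff.1 (le_trans ?_ (young_mono φ hwz.le))
      rw [young_coe_add φ hsw.le]
      refine le_trans ?_ le_add_self
      calc ∞ = ∫⁻ _ in Ioc (s : ℝ) w, ∞ := by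
            rw [setLIntegral_const, Real.volume_Ioc, ENNReal.top_mul]; simpa using hsw'
        _ ≤ _ := setLIntegral_mono' measurableSet_Ioc fun v hv =>
            hs' ▸ hφ.mono (NNReal.le_toNNReal_of_coe_le hv.1.le)
    have h2 : ν {t | (s : ℝ≥0∞) < u t} ≠ 0 := by
      intro h0
      have h3 : ∀ᵐ t ∂ν, u t ≤ s := by
        rw [ae_iff]; simpa only [not_le] using h0
      have h4 : m ≤ s := by
        refine (lintegral_mono_ae h3).trans ?_
        simp
      exact absurd hs (not_lt.2 h4)
    have h3 : ∫⁻ t, young φ (u t) ∂ν = ∞ := by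
      refine top_le_iff.1 ?_
      calc ∞ = ∫⁻ _ in {t | (s : ℝ≥0∞) < u t}, ∞ ∂ν := by
            rw [setLIntegral_const, ENNReal.top_mul h2]
        _ ≤ ∫⁻ t in {t | (s : ℝ≥0∞) < u t}, young φ (u t) ∂ν :=
            setLIntegral_mono' (measurableSet_lt measurable_const hu) fun t ht => (h1 _ ht).ge
        _ ≤ _ := setLIntegral_le_lintegral _ _
    rw [h3]; exact le_top

/-- Jensen's inequality for the probability measure `e^{-|x-t|} dt / 2`. -/
theorem IsYoungDensity.young_absConv_le {φ : ℝ≥0 → ℝ≥0∞} (hφ : IsYoungDensity φ) {u : ℝ → ℝ≥0∞}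
    (hu : Measurable u) (x : ℝ) :
    young φ (2⁻¹ * absConv u x) ≤ 2⁻¹ * absConv (fun t => young φ (u t)) x := by
  set d : ℝ → ℝ≥0∞ := fun t => 2⁻¹ * ENNReal.ofReal (Real.exp (-|x - t|)) with hd
  have hdm : Measurable d := (measurable_expKernel x).const_mul _
  have key : ∀ h : ℝ → ℝ≥0∞, Measurable h →
      ∫⁻ t, h t ∂(volume.withDensity d) = 2⁻¹ * absConv h x := fun h hh => by
    rw [lintegral_withDensity_eq_lintegral_mul _ hdm hh, absConv,
      ← lintegral_const_mul' _ _ (by simp)]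
    simp only [Pi.mul_apply, hd, mul_assoc]
  have hprob : IsProbabilityMeasure (volume.withDensity d) := by
    refine ⟨?_⟩
    rw [withDensity_apply _ MeasurableSet.univ, Measure.restrict_univ,
      lintegral_const_mul' _ _ (by simp), lintegral_exp_neg_abs_sub_left,
      ENNReal.inv_mul_cancel (by simp) (by simp)]
  rw [← key u hu, ← key (fun t => young φ (u t)) ((young_mono φ).measurable.comp hu)]
  exact hφ.young_lintegral_le _ hu

theorem absConv_div (u : ℝ → ℝ≥0∞) {l : ℝ≥0} (hl : 0 < l) (x : ℝ) :
    absConv (fun t => u t / l) x = absConv u x / l := by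
  have hl0 : (l : ℝ≥0∞) ≠ 0 := by exact_mod_cast hl.ne'
  simp_rw [absConv, div_eq_mul_inv, ← mul_assoc]
  rw [lintegral_mul_const' _ _ (ENNReal.inv_ne_top.2 hl0)]

theorem isConvBounded_orlicz {φ : ℝ≥0 → ℝ≥0∞} (hφ : IsYoungDensity φ) : IsConvBounded (orlicz φ hφ).line where
  excess f hf := by
    obtain ⟨c, hc⟩ := hφ.le_add_young
    exact hφ.isModular.excess (ae_of_all _ fun _ => hc) hf
  bound := by
    refine ⟨2, fun f g _ h => ?_⟩
    change luxemburg volume _ _ ≤ _ * luxemburg volume _ _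
    conv_rhs => rw [luxemburg]
    rw [ENNReal.mul_iInf_of_ne (by simp) (by simp)]
    refine le_iInf fun l => ?_
    rw [ENNReal.mul_iInf_of_ne (by simp) (by simp)]
    refine le_iInf fun hl => ?_
    have hl0 : (l : ℝ≥0∞) ≠ 0 := by exact_mod_cast hl.1.ne'
    -- The scale `2l` supplies the factor `1/2` that normalises the kernel to mass one; after
    -- Jensen's inequality, integration in `x` returns the modular of `f/l`.
    refine le_trans (luxemburg_le (2 * l) (by have := hl.1; positivity) ?_)
      (by rw [ENNReal.coe_mul])
    have hm : Measurable fun t => ‖f t‖ₑ / (l : ℝ≥0∞) :=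
      f.stronglyMeasurable.measurable.enorm.div_const _
    have hm' : Measurable fun t => young φ (‖f t‖ₑ / l) := (young_mono φ).measurable.comp hm
    calc ∫⁻ x, young φ (‖g x‖ₑ / ((2 * l : ℝ≥0) : ℝ≥0∞))
        ≤ ∫⁻ x, 2⁻¹ * absConv (fun t => young φ (‖f t‖ₑ / l)) x := by
          refine lintegral_mono_ae ?_
          filter_upwards [h] with x hx
          refine le_trans (young_mono φ ?_) (hφ.young_absConv_le hm x)
          rw [absConv_div _ hl.1, ENNReal.coe_mul, div_eq_mul_inv, div_eq_mul_inv,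
            ENNReal.mul_inv (Or.inl (by simp)) (Or.inl (by simp)), mul_left_comm]
          push_cast
          gcongr
      _ = ∫⁻ t, young φ (‖f t‖ₑ / l) := by
          rw [lintegral_const_mul' _ _ (by simp), lintegral_absConv hm', ← mul_assoc,
            ENNReal.inv_mul_cancel (by simp) (by simp), one_mul]
      _ ≤ 1 := hl.2
  indicator f hf := by
    -- Where `φ(t)` is finite, so is `Φ(t) ≤ t φ(t)`; dividing the indicator by `t⁻¹` gives it the
    -- value `t`.
    obtain ⟨t, ht, ht'⟩ := hφ.finite
    have ht0 : (t : ℝ≥0∞) ≠ 0 := by exact_mod_cast ht.ne'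
    refine hφ.isModular.rho_indicator_lt_top (l := t⁻¹) (inv_pos.2 ht) ?_ hf
    have h1 : (1 : ℝ≥0∞) / ((t⁻¹ : ℝ≥0) : ℝ≥0∞) = t := by
      rw [ENNReal.coe_inv ht.ne', one_div, inv_inv]
    simp only [h1]
    rw [setLIntegral_const, Real.volume_Icc, young_coe]
    simp only [sub_zero, ENNReal.ofReal_one, mul_one]
    calc ∫⁻ u in Ioc 0 (t : ℝ), φ u.toNNReal ≤ ∫⁻ _ in Ioc 0 (t : ℝ), φ t :=
          setLIntegral_mono' measurableSet_Ioc fun u hu =>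
            hφ.mono (Real.toNNReal_le_iff_le_coe.2 hu.2)
      _ < ∞ := by
        rw [setLIntegral_const, Real.volume_Ioc]
        exact ENNReal.mul_lt_top ht' ENNReal.ofReal_lt_top

/-! ### Density in reflexive Orlicz spaces -/

/-- A bounded sequence in a closed subspace of a reflexive space has a weak limit along an
ultrafilter, which lies in the subspace. -/
theorem IsReflexive.exists_weak_limit {E : Type*} [NormedAddCommGroup E] [NormedSpace ℂ E]
    (hE : IsReflexive E) (S : Submodule ℂ E) (g : ℕ → E) (hg : ∀ n, g n ∈ S) {R : ℝ}
    (hR : ∀ n, ‖g n‖ ≤ R) :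
    ∃ y ∈ closure (S : Set E), ∃ U : Ultrafilter ℕ, (U : Filter ℕ) ≤ atTop ∧
      ∀ ℓ : StrongDual ℂ E, Tendsto (fun n => ℓ (g n)) U (𝓝 (ℓ y)) := by
  set J := NormedSpace.inclusionInDoubleDual ℂ E with hJ
  set U : Ultrafilter ℕ := hyperfilter ℕ with hU
  have hUle : (U : Filter ℕ) ≤ atTop := by
    rw [← Nat.cofinite_eq_atTop]; exact hyperfilter_le_cofinite
  have hJn : ∀ x, ‖J x‖ ≤ ‖x‖ := NormedSpace.double_dual_bound ℂ E
  -- Banach-Alaoglu in the bidual. Limits along an ultrafilter replace subsequences, so no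
  -- separability is needed; reflexivity brings the limit back to `E`.
  have hK := WeakDual.isCompact_closedBall (0 : StrongDual ℂ (StrongDual ℂ E)) R
  have hmem : ∀ n, StrongDual.toWeakDual (J (g n)) ∈
      WeakDual.toStrongDual ⁻¹' Metric.closedBall (0 : StrongDual ℂ (StrongDual ℂ E)) R := by
    intro n
    have h := (dist_zero_right (E := StrongDual ℂ (StrongDual ℂ E)) (J (g n))).le.trans
      ((hJn (g n)).trans (hR n))
    exact h
  obtain ⟨Λ, -, hΛ⟩ := hK.ultrafilter_le_nhds (U.map fun n => StrongDual.toWeakDual (J (g n)))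
    (by
      rw [le_principal_iff]
      exact Filter.mem_map.2 (Eventually.of_forall hmem))
  obtain ⟨y, hy⟩ := hE (WeakDual.toStrongDual Λ)
  have hlim : ∀ ℓ : StrongDual ℂ E, Tendsto (fun n => ℓ (g n)) U (𝓝 (ℓ y)) := by
    intro ℓ
    have h1 : Tendsto (fun n => StrongDual.toWeakDual (J (g n))) U (𝓝 Λ) := hΛ
    have h2 := ((WeakDual.eval_continuous ℓ).tendsto Λ).comp h1
    have h3 : Λ ℓ = ℓ y := by
      have := DFunLike.congr_fun hy ℓ
      exact this.symm
    rw [← h3]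
    exact h2
  refine ⟨y, ?_, U, hUle, hlim⟩
  -- The norm closure of a subspace is convex, so by Hahn-Banach a point outside it is strictly
  -- separated from it, which a weak limit of its elements cannot be.
  by_contra hcon
  have hconv : Convex ℝ (closure (S : Set E)) := (S.restrictScalars ℝ).convex.closure
  obtain ⟨ℓ, u, h1, h2⟩ :=
    RCLike.geometric_hahn_banach_closed_point (𝕜 := ℂ) hconv isClosed_closure hcon
  have h3 : Tendsto (fun n => RCLike.re (ℓ (g n))) U (𝓝 (RCLike.re (ℓ y))) :=
    (RCLike.continuous_re.tendsto _).comp (hlim ℓ)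
  exact absurd h2 (not_lt.2 (le_of_tendsto h3
    (Eventually.of_forall fun n => (h1 _ (subset_closure (hg n))).le)))

namespace IsModular

variable {μ : Measure ℝ} {M : ℝ → ℝ≥0∞ → ℝ≥0∞}

/-- For each admissible scale `l` linear growth gives `|f| ≤ l (c + M(x, |f|/l))`. Thus the space
embeds into `L¹` of every set of finite measure, and integration over such a set is a bounded
functional. -/
theorem setLIntegral_enorm_le (hM : IsModular μ M) {c : ℝ≥0} (hc : ∀ᵐ x ∂μ, ∀ t, t ≤ c + M x t)
    (f : ℝ →ₘ[μ] ℂ) {s : Set ℝ} (hs : μ s ≠ ∞) :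
    ∫⁻ x in s, ‖f x‖ₑ ∂μ ≤ (c * μ s + 1) * hM.norm.rho f := by
  have hC : (c : ℝ≥0∞) * μ s + 1 ≠ ∞ :=
    (ENNReal.add_lt_top.2 ⟨ENNReal.mul_lt_top ENNReal.coe_lt_top hs.lt_top, ENNReal.one_lt_top⟩).ne
  have hC0 : (c : ℝ≥0∞) * μ s + 1 ≠ 0 := by simp
  change _ ≤ _ * luxemburg μ M _
  rw [luxemburg, ENNReal.mul_iInf_of_ne hC0 hC]
  refine le_iInf fun l => ?_
  rw [ENNReal.mul_iInf_of_ne hC0 hC]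
  refine le_iInf fun hl => ?_
  have hl0 : (l : ℝ≥0∞) ≠ 0 := by exact_mod_cast hl.1.ne'
  calc ∫⁻ x in s, ‖f x‖ₑ ∂μ ≤ ∫⁻ x in s, l * (c + M x (‖f x‖ₑ / l)) ∂μ := by
        refine lintegral_mono_ae ?_
        filter_upwards [ae_restrict_of_ae hc] with x hx
        calc ‖f x‖ₑ = l * (‖f x‖ₑ / l) := (ENNReal.mul_div_cancel hl0 ENNReal.coe_ne_top).symm
          _ ≤ _ := by gcongr; exact hx _
    _ = l * (c * μ s + ∫⁻ x in s, M x (‖f x‖ₑ / l) ∂μ) := by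
        rw [lintegral_const_mul' _ _ ENNReal.coe_ne_top, lintegral_add_left measurable_const,
          setLIntegral_const]
    _ ≤ l * (c * μ s + 1) := by
        gcongr
        exact (setLIntegral_le_lintegral _ _).trans hl.2
    _ = _ := mul_comm _ _

theorem integrableOn (hM : IsModular μ M) {c : ℝ≥0} (hc : ∀ᵐ x ∂μ, ∀ t, t ≤ c + M x t)
    (f : hM.norm.Space) {s : Set ℝ} (hs : μ s ≠ ∞) : IntegrableOn (hM.norm.incl f) s μ := by
  refine ⟨(hM.norm.incl f).aestronglyMeasurable.restrict, ?_⟩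
  refine lt_of_le_of_lt (hM.setLIntegral_enorm_le hc _ hs)
    (ENNReal.mul_lt_top ?_ (hM.norm.rho_incl_lt_top f))
  exact ENNReal.add_lt_top.2
    ⟨ENNReal.mul_lt_top ENNReal.coe_lt_top hs.lt_top, ENNReal.one_lt_top⟩

/-- Integration over a set of finite measure as a bounded functional. -/
theorem exists_setIntegral_functional (hM : IsModular μ M) {c : ℝ≥0}
    (hc : ∀ᵐ x ∂μ, ∀ t, t ≤ c + M x t) {s : Set ℝ} (hs : μ s ≠ ∞) :
    ∃ ℓ : StrongDual ℂ hM.norm.Space, ∀ f, ℓ f = ∫ x in s, hM.norm.incl f x ∂μ := by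
  have hC : (c : ℝ≥0∞) * μ s + 1 ≠ ∞ :=
    (ENNReal.add_lt_top.2 ⟨ENNReal.mul_lt_top ENNReal.coe_lt_top hs.lt_top, ENNReal.one_lt_top⟩).ne
  refine ⟨LinearMap.mkContinuous
    { toFun := fun f => ∫ x in s, hM.norm.incl f x ∂μ
      map_add' := fun f g => by
        rw [← integral_add (hM.integrableOn hc f hs) (hM.integrableOn hc g hs), map_add]
        exact integral_congr_ae (ae_restrict_of_ae (AEEqFun.coeFn_add _ _))
      map_smul' := fun a f => by
        rw [RingHom.id_apply, smul_eq_mul, ← integral_const_mul, map_smul]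
        exact integral_congr_ae (ae_restrict_of_ae (AEEqFun.coeFn_smul _ _)) }
    ((c : ℝ≥0∞) * μ s + 1).toReal (fun f => ?_), fun f => rfl⟩
  have h1 := hM.setLIntegral_enorm_le hc (hM.norm.incl f) hs
  have h2 : ‖∫ x in s, hM.norm.incl f x ∂μ‖ₑ ≤ (c * μ s + 1) * hM.norm.rho (hM.norm.incl f) :=
    (enorm_integral_le_lintegral_enorm _).trans h1
  have h3 := ENNReal.toReal_mono
    (ENNReal.mul_lt_top hC.lt_top (hM.norm.rho_incl_lt_top f)).ne h2
  rwa [ENNReal.toReal_mul, toReal_enorm] at h3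

end IsModular

/-- The truncations of `f` have norm at most `‖f‖`, so reflexivity gives them a weak limit `y` in
the closure of the `L²` functions. Integrals over subsets of `truncSet f k` are bounded functionals
that eventually agree on the truncations and on `f`; hence `y = f`. Norm convergence of the
truncations is never claimed. -/
theorem IsModular.dense_of_reflexive {M : ℝ → ℝ≥0∞ → ℝ≥0∞} (hM : IsModular volPos M) {c : ℝ≥0}
    (hc : ∀ᵐ x ∂volPos, ∀ t, t ≤ c + M x t) (hr : IsReflexive hM.norm.Space) :
    Dense {g : hM.norm.Space | MemLp (hM.norm.incl g) 2 volPos} := by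
  set N : FunNorm volPos := hM.norm with hN
  intro f
  have htr : ∀ n, N.rho (trunc (N.incl f) n) ≤ N.rho (N.incl f) := fun n =>
    hM.luxemburg_mono_of_le (enorm_trunc_le (N.incl f) n)
  set g : ℕ → N.Space := fun n => N.toSpace (trunc (N.incl f) n)
    (lt_of_le_of_lt (htr n) (N.rho_incl_lt_top f)) with hg
  let S : Submodule ℂ N.Space :=
    { carrier := {g | MemLp (N.incl g) 2 volPos}
      zero_mem' := by
        change MemLp (N.incl 0) 2 volPos
        rw [map_zero]
        exact MemLp.zero.ae_eq AEEqFun.coeFn_zero.symm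
      add_mem' := fun {a b} ha hb => by
        change MemLp (N.incl (a + b)) 2 volPos
        rw [map_add]
        exact (MemLp.add ha hb).ae_eq (AEEqFun.coeFn_add _ _).symm
      smul_mem' := fun z a ha => by
        change MemLp (N.incl (z • a)) 2 volPos
        rw [map_smul]
        exact (MemLp.const_smul ha z).ae_eq (AEEqFun.coeFn_smul _ _).symm }
  obtain ⟨y, hy, U, hU, hlim⟩ := hr.exists_weak_limit S g
    (fun n => memLp_trunc (N.incl f) n) (R := ‖f‖)
    (fun n => ENNReal.toReal_mono (N.rho_incl_lt_top f).ne (htr n))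
  have hfin : ∀ n, volPos (truncSet (N.incl f) n) ≠ ∞ := by
    intro n
    rw [Measure.restrict_apply' measurableSet_Ioi]
    refine (lt_of_le_of_lt (measure_mono fun x hx => ?_)
      (measure_Ioc_lt_top (a := (0 : ℝ)) (b := n) (μ := volume))).ne
    exact ⟨hx.2, hx.1.2⟩
  have heq : ∀ k, N.incl y =ᵐ[volPos.restrict (truncSet (N.incl f) k)] N.incl f := by
    intro k
    refine Integrable.ae_eq_of_forall_setIntegral_eq _ _ (hM.integrableOn hc y (hfin k))
      (hM.integrableOn hc f (hfin k)) fun s hs _ => ?_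
    rw [Measure.restrict_restrict hs]
    have hsfin : volPos (s ∩ truncSet (N.incl f) k) ≠ ∞ :=
      (lt_of_le_of_lt (measure_mono inter_subset_right) (hfin k).lt_top).ne
    obtain ⟨ℓ, hℓ⟩ := hM.exists_setIntegral_functional hc hsfin
    have h1 := hlim ℓ
    -- For `n ≥ k` the `n`-th truncation coincides with `f` on the `k`-th set.
    have h2 : ∀ᶠ n in (U : Filter ℕ), ℓ (g n) = ℓ f := by
      refine hU ?_
      filter_upwards [eventually_ge_atTop k] with n hn
      rw [hℓ, hℓ]
      refine setIntegral_congr_ae (hs.inter (measurableSet_truncSet _ k)) ?_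
      filter_upwards [coeFn_trunc (N.incl f) n] with x hx hxs
      have hx2 : x ∈ truncSet (N.incl f) n := truncSet_mono _ hn hxs.2
      exact hx.trans (indicator_of_mem hx2 _)
    have h3 : ℓ y = ℓ f := tendsto_nhds_unique h1 (tendsto_const_nhds.congr' (by
      filter_upwards [h2] with n hn; exact hn.symm))
    rw [hℓ, hℓ] at h3
    exact h3
  have hyf : y = f := by
    refine N.incl_injective (AEEqFun.ext ?_)
    have h1 : ∀ᵐ x ∂volPos, ∀ k, x ∈ truncSet (N.incl f) k → N.incl y x = N.incl f x :=
      ae_all_iff.2 fun k => (ae_restrict_iff' (measurableSet_truncSet _ k)).1 (heq k)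
    filter_upwards [h1] with x hx
    obtain ⟨k, hk⟩ := exists_mem_truncSet (N.incl f) x
    exact hx k hk
  rw [← hyf]
  exact hy

theorem dense_orlicz {φ : ℝ≥0 → ℝ≥0∞} (hφ : IsYoungDensity φ)
    (hr : IsReflexive (orlicz φ hφ).half.Space) :
    Dense {g : (orlicz φ hφ).half.Space | MemLp ((orlicz φ hφ).half.incl g) 2 volPos} := by
  obtain ⟨c, hc⟩ := hφ.le_add_young
  exact hφ.isModular.restrict.dense_of_reflexive (ae_of_all _ fun _ => hc) hr

end WH
end

/-- Let `X` be one of the three spaces. The functions `r_k` are Fourier multipliers on `X(ℝ)`, the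
function `ψ_0(x) = √2 e^{-x}` belongs to `X(ℝ₊)`, and for all `n` the kernel of `W(r_{-n})` on
`X(ℝ₊)` is the span of `ψ_0, …, ψ_{n-1}`, where `ψ_k = W(r_k) ψ_0`. -/
theorem mainTheorem10 (X : WH.SpacePair) (hX : WH.IsAdmissible X) :
    (∀ k : ℤ, WH.IsFourierMultiplier X.line (WH.r k)) ∧
    ∃ psi0 : X.half.Space,
      (X.half.incl psi0 =ᵐ[volume.restrict (Ioi (0 : ℝ))]
        fun x : ℝ => ((Real.sqrt 2 * Real.exp (-x) : ℝ) : ℂ)) ∧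
      ∀ n : ℕ, LinearMap.ker (WH.W X (WH.r (-(n : ℤ)))).toLinearMap =
        Submodule.span ℂ (WH.psi X psi0 '' {k : ℕ | k < n}) := by
  cases hX with
  | lorentz p q hp hq => exact (WH.isConvBounded_lorentz hp hq).ker_W (WH.dense_lorentz hq)
  | orlicz φ hφ hr => exact (WH.isConvBounded_orlicz hφ).ker_W (WH.dense_orlicz hφ hr)
  | varLebesgue p hp hM => exact (WH.isConvBounded_varLebesgue hp hM).ker_W (WH.dense_varLebesgue hp hM)
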